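/- **Setting.** Let $\mathbb D$ be the open unit disk. Let $\{\alpha_{n,N}\}_{n,N\ge 0}\subset\mathbb D$. For each $N$, define monic polynomials by $\Phi_{0,N}=1$, $\Phi_{n+1,N}(z)=z\Phi_{n,N}(z)-\overline{\alpha_{n,N}}\,\Phi^*_{n,N}(z)$, where $\Phi_{n,N}^*(z)=z^n\overline{\Phi_{n,N}(1/\bar z)}$. For $|\beta|=1$ let $\Phi^{(\beta)}_{n+1,N}(z)=z\Phi_{n,N}(z)-\bar\beta\,\Phi^*_{n,N}(z)$, $n\ge 0$. For $t>0$, a limit as $n/N\to t$ means the limit along every pair of sequences $n_j,N_j\to\infty$ of positive integers with $n_j/N_j\to t$. A quotient converges uniformly on a compact set $K$ as $n/N\to t$ if, along every such pair of sequences, its denominator has no zero in $K$ for all large $j$ and the quotients converge uniformly on $K$. *Limiting zero sets.* $\Lambda_{\beta,t}$ is the set of all $\xi\in\partial\mathbb D$ for which there are $n_j,N_j\to\infty$ with $n_j/N_j\to t$ and $\liminf_{j\to\infty}\operatorname{dist}\bigl(\xi,\{z\in\partial\mathbb D:\Phi^{(\beta)}_{n_j,N_j}(z)=0\}\bigr)=0$;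 moreover $\Lambda_t=\bigcap_{|\beta|=1}\Lambda_{\beta,t}$. *Limit functions.* For $|\gamma|\le1$ put $\rho=\sqrt{1-|\gamma|^2}$ and let $\mathcal C(\gamma)$ be the CMV operator on $\ell^2(\mathbb N_0)$ all of whose Verblunsky coefficients equal $\gamma$, i.e. the operator with matrix $$\begin{pmatrix}\bar\gamma&\bar\gamma\rho&\rho^2&0&0&\cdots\\ \rho&-|\gamma|^2&-\rho\gamma&0&0&\cdots\\ 0&\bar\gamma\rho&-|\gamma|^2&\bar\gamma\rho&\rho^2&\cdots\\ 0&\rho^2&-\rho\gamma&-|\gamma|^2&-\rho\gamma&\cdots\\ 0&0&0&\bar\gamma\rho&-|\gamma|^2&\cdots\\ \vdots&\vdots&\vdots&\vdots&\vdots&\ddots\end{pmatrix}.$$ For $z$ outside its spectrum let $m_\gamma(z)=\langle e_0,(z-\mathcal C(\gamma))^{-1}e_0\rangle$, $F_\gamma(z)=\langle e_0,(\mathcal C(\gamma)+z)(\mathcal C(\gamma)-z)^{-1}e_0\rangle$, and let $f_\gamma(z)=\dfrac1z\,\dfrac{F_\gamma(z)-1}{F_\gamma(z)+1}$, where the values at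 $z=0$ and at isolated points of the spectrum are defined by taking limits. For $a\in[0,1]$ let $\theta_a=2\arcsin a$, $\Gamma_a=\{e^{i\theta}:\theta_a\le\theta\le 2\pi-\theta_a\}$, and $$G_a(z)=\tfrac12\Bigl(z+1+\sqrt{(z-1)^2+4a^2z}\Bigr),\qquad z\in\mathbb C\setminus\Gamma_a,$$ where the square root is analytic on $\mathbb C\setminus\Gamma_a$ and equals $1$ at $z=0$; for $a=0$ it is $1-z$ if $|z|<1$ and $z-1$ if $|z|>1$. **Theorem.** Let $|\beta|=1$, $t>0$, $|\alpha|\le 1$, $a=|\alpha|$, and suppose that $\lim_{n/N\to t}\alpha_{n,N}=\alpha$. Then, as $n/N\to t$: 1. $\dfrac{\Phi_{n,N}}{\Phi^{(\beta)}_{n+1,N}}\to m_{-\bar\alpha\beta}$ uniformly on compact subsets of $\mathbb C\setminus\Lambda_{\beta,t}$. 2. $\dfrac{\Phi_{n,N}}{\Phi^*_{n,N}}\to f_{-\bar\alpha}$ uniformly on compact subsets of $\mathbb C\setminus\Lambda_t$ if $\alpha\ne0$, and of $\mathbb D$ if $\alpha=0$. 3. $\dfrac{\Phi^*_{n+1,N}}{\Phi^*_{n,N}}\to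 G_a$ uniformly on compact subsets of $\mathbb C\setminus\Lambda_t$ if $\alpha\neq0$, and uniformly on $\overline{\mathbb D}$ if $\alpha=0$, where $G_0$ is extended to $\partial\mathbb D$ by its limits from inside $\mathbb D$. 4. $\dfrac{\Phi_{n+1,N}}{\Phi_{n,N}}\to G_a$ uniformly on compact subsets of $\mathbb C\setminus\Lambda_t$ if $\alpha\ne0$, and of $\mathbb C\setminus\mathbb D$ if $\alpha=0$, where $G_0$ is extended to $\partial\mathbb D$ by its limits from outside $\overline{\mathbb D}$. 5. $\dfrac{\Phi^{(\beta)}_{n+1,N}}{\Phi^{(\beta)}_{n,N}}\to G_a$ uniformly on compact subsets of $\mathbb C\setminus\Lambda_{\beta,t}$. -/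

import Mathlib

open Filter Topology Polynomial
open scoped ComplexConjugate

noncomputable section

namespace VaryingOPUC

/-! ### Orthogonal and paraorthogonal polynomials on the unit circle -/

/-- The reversed polynomial `z ^ n * conj (p (1 / conj z))` of a polynomial `p` of degree at most
`n`: the coefficients are conjugated and listed in the opposite order. -/
def revPoly (n : ℕ) (p : ℂ[X]) : ℂ[X] := reflect n (p.map (starRingEnd ℂ))

/-- The monic orthogonal polynomials `Φ_n` with Verblunsky coefficients `a`, generated by the
Szegő recurrence. -/
def opuc (a : ℕ → ℂ) : ℕ → ℂ[X]
  | 0 => 1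
  | n + 1 => X * opuc a n - C (conj (a n)) * revPoly n (opuc a n)

/-- The reversed orthogonal polynomials `Φ_n^*`. -/
def opucStar (a : ℕ → ℂ) (n : ℕ) : ℂ[X] := revPoly n (opuc a n)

/-- The paraorthogonal polynomials `Φ_n^{(β)}` (the value `1` at `n = 0` is a convention). -/
def popuc (a : ℕ → ℂ) (β : ℂ) : ℕ → ℂ[X]
  | 0 => 1
  | n + 1 => X * opuc a n - C (conj β) * opucStar a n

/-! ### The CMV operator on `ℓ²(ℕ₀)` -/

/-- `ρ(α) = √(1 - |α|²)`. -/
def rho (α : ℂ) : ℂ := (Real.sqrt (1 - ‖α‖ ^ 2) : ℝ)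

/-- `prev a j = α_{j-1}`, with the usual convention `α_{-1} = -1` (so that `ρ_{-1} = 0`). -/
def prev (a : ℕ → ℂ) : ℕ → ℂ
  | 0 => -1
  | j + 1 => a j

/-- The entries of the pentadiagonal CMV matrix
```
  conj α₀   conj α₁ ρ₀     ρ₁ ρ₀         0             0        ...
  ρ₀       -conj α₁ α₀    -ρ₁ α₀         0             0        ...
  0         conj α₂ ρ₁    -conj α₂ α₁    conj α₃ ρ₂    ρ₃ ρ₂    ...
  0         ρ₂ ρ₁         -ρ₂ α₁        -conj α₃ α₂   -ρ₃ α₂    ...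
  0         0              0             conj α₄ ρ₃   -conj α₄ α₃ ...
```
with Verblunsky coefficients `a`. -/
def cmvEntry (a : ℕ → ℂ) (j k : ℕ) : ℂ :=
  if Even j then
    if k + 1 = j then conj (a j) * rho (prev a j)
    else if k = j then -(conj (a j) * prev a j)
    else if k = j + 1 then conj (a (j + 1)) * rho (a j)
    else if k = j + 2 then rho (a (j + 1)) * rho (a j)
    else 0
  else
    if k + 2 = j then rho (prev a j) * rho (prev a (j - 1))
    else if k + 1 = j then -(rho (prev a j) * prev a (j - 1))
    else if k = j then -(conj (a j) * prev a j)
    else if k = j + 1 then -(rho (a j) * prev a j)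
    else 0

/-- The Hilbert space `ℓ²(ℕ₀)`. -/
abbrev Ell2 : Type := lp (fun _ : ℕ => ℂ) 2

lemma norm_rho_le (α : ℂ) : ‖rho α‖ ≤ 1 := by
  rw [rho, Complex.norm_real, Real.norm_of_nonneg (Real.sqrt_nonneg _)]
  exact Real.sqrt_le_one.mpr (by nlinarith [sq_nonneg ‖α‖])

lemma norm_cmvEntry_le {a : ℕ → ℂ} {M : ℝ} (hM : 1 ≤ M) (ha : ∀ n, ‖a n‖ ≤ M) (j k : ℕ) :
    ‖cmvEntry a j k‖ ≤ M * M := by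
  have hr : ∀ α, ‖rho α‖ ≤ M := fun α => (norm_rho_le α).trans hM
  have hp : ∀ n, ‖prev a n‖ ≤ M := by
    intro n
    cases n with
    | zero => simpa [prev] using hM
    | succ n => exact ha n
  have h0 : (0 : ℝ) ≤ M := by linarith
  have hmul : ∀ x y : ℂ, ‖x‖ ≤ M → ‖y‖ ≤ M → ‖x * y‖ ≤ M * M := fun x y hx hy => by
    rw [norm_mul]; exact mul_le_mul hx hy (norm_nonneg _) h0
  have hc : ∀ n, ‖conj (a n)‖ ≤ M := fun n => by simpa using ha n
  unfold cmvEntry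
  split_ifs <;> first
    | exact hmul _ _ (hc _) (hr _)
    | exact hmul _ _ (hr _) (hr _)
    | (rw [norm_neg]; exact hmul _ _ (hc _) (hp _))
    | (rw [norm_neg]; exact hmul _ _ (hr _) (hp _))
    | (rw [norm_zero]; positivity)

lemma cmvEntry_eq_zero {a : ℕ → ℂ} {j k : ℕ} (h : k + 2 < j ∨ j + 2 < k) :
    cmvEntry a j k = 0 := by
  unfold cmvEntry
  split_ifs <;> first | rfl | omega

lemma memℓp_cmv {a : ℕ → ℂ} (ha : ∃ M, ∀ n, ‖a n‖ ≤ M) (x : Ell2) :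
    Memℓp (fun j : ℕ => ∑ k ∈ Finset.range (j + 3), cmvEntry a j k * x k) 2 := by
  obtain ⟨M₀, hM₀⟩ := ha
  set M := max M₀ 1
  have hM : ∀ n, ‖a n‖ ≤ M := fun n => (hM₀ n).trans (le_max_left _ _)
  have hE := norm_cmvEntry_le (le_max_right M₀ 1) hM
  have hsum : Summable fun n : ℕ => ‖x n‖ ^ 2 := by
    have := (lp.memℓp x).summable (by norm_num)
    simpa using this
  -- the first two coordinates are split off, so that the indices can be shifted
  have key : Summable fun i : ℕ =>
      ‖∑ k ∈ Finset.range (i + 2 + 3), cmvEntry a (i + 2) k * x k‖ ^ 2 := by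
    have hb : Summable fun i : ℕ => (M * M) ^ 2 * (5 * (‖x i‖ ^ 2 + ‖x (i + 1)‖ ^ 2
        + ‖x (i + 2)‖ ^ 2 + ‖x (i + 3)‖ ^ 2 + ‖x (i + 4)‖ ^ 2)) := by
      have hs : ∀ d, Summable fun i : ℕ => ‖x (i + d)‖ ^ 2 := fun d =>
        (summable_nat_add_iff (f := fun n : ℕ => ‖x n‖ ^ 2) d).mpr hsum
      exact (((((hs 0).add (hs 1)).add (hs 2)).add (hs 3)).add (hs 4)).mul_left 5 |>.mul_left _
    refine Summable.of_nonneg_of_le (fun i => by positivity) (fun i => ?_) hb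
    have h1 : ∑ k ∈ Finset.range (i + 2 + 3), cmvEntry a (i + 2) k * x k
        = ∑ d ∈ Finset.range 5, cmvEntry a (i + 2) (i + d) * x (i + d) := by
      rw [show i + 2 + 3 = i + 5 by ring, Finset.sum_range_add, Finset.sum_eq_zero, zero_add]
      intro k hk
      rw [cmvEntry_eq_zero (Or.inl (by have := Finset.mem_range.mp hk; omega)), zero_mul]
    have h2 : ‖∑ k ∈ Finset.range (i + 2 + 3), cmvEntry a (i + 2) k * x k‖
        ≤ M * M * (‖x i‖ + ‖x (i + 1)‖ + ‖x (i + 2)‖ + ‖x (i + 3)‖ + ‖x (i + 4)‖) := by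
      rw [h1]
      refine (norm_sum_le _ _).trans ?_
      have : ∀ d ∈ Finset.range 5, ‖cmvEntry a (i + 2) (i + d) * x (i + d)‖
          ≤ M * M * ‖x (i + d)‖ := fun d _ => by
        rw [norm_mul]; exact mul_le_mul_of_nonneg_right (hE _ _) (norm_nonneg _)
      refine (Finset.sum_le_sum this).trans (le_of_eq ?_)
      simp [Finset.sum_range_succ]; ring
    calc _ ≤ (M * M * (‖x i‖ + ‖x (i + 1)‖ + ‖x (i + 2)‖ + ‖x (i + 3)‖ + ‖x (i + 4)‖)) ^ 2 :=
          pow_le_pow_left₀ (norm_nonneg _) h2 2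
      _ ≤ _ := by
          rw [mul_pow]
          refine mul_le_mul_of_nonneg_left ?_ (by positivity)
          generalize ‖x i‖ = p
          generalize ‖x (i + 1)‖ = q
          generalize ‖x (i + 2)‖ = r
          generalize ‖x (i + 3)‖ = s
          generalize ‖x (i + 4)‖ = u
          nlinarith [sq_nonneg (p - q), sq_nonneg (p - r), sq_nonneg (p - s), sq_nonneg (p - u),
            sq_nonneg (q - r), sq_nonneg (q - s), sq_nonneg (q - u), sq_nonneg (r - s),
            sq_nonneg (r - u), sq_nonneg (s - u)]
  refine memℓp_gen ?_
  have := (summable_nat_add_iff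
    (f := fun j : ℕ => ‖∑ k ∈ Finset.range (j + 3), cmvEntry a j k * x k‖ ^ 2) 2).mp key
  simpa using this

/-- The linear map of the CMV matrix on `ℓ²(ℕ₀)`. Row `j` of the matrix vanishes beyond
column `j + 2`, so the sum is the full matrix-vector product. -/
def cmvLin (a : ℕ → ℂ) (ha : ∃ M, ∀ n, ‖a n‖ ≤ M) : Ell2 →ₗ[ℂ] Ell2 where
  toFun x := ⟨fun j => ∑ k ∈ Finset.range (j + 3), cmvEntry a j k * x k, memℓp_cmv ha x⟩
  map_add' x y := by
    ext j
    change ∑ k ∈ Finset.range (j + 3), cmvEntry a j k * (x k + y k) = _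
    simp only [mul_add, Finset.sum_add_distrib]
    rfl
  map_smul' c x := by
    ext j
    simp [Finset.mul_sum, mul_left_comm]

/-- The CMV operator `𝒞` on `ℓ²(ℕ₀)` with Verblunsky coefficients `a`. -/
def cmv (a : ℕ → ℂ) (ha : ∃ M, ∀ n, ‖a n‖ ≤ M) : Ell2 →L[ℂ] Ell2 :=
  ContinuousLinearMap.ofSeqClosedGraph (g := cmvLin a ha) <| by
    intro u x y hu hy
    ext j
    have h1 : Tendsto (fun i => (cmvLin a ha (u i)) j) atTop (𝓝 (y j)) :=
      ((lp.evalCLM ℂ (fun _ : ℕ => ℂ) 2 j).continuous.tendsto y).comp hy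
    have h2 : Tendsto (fun i => (cmvLin a ha (u i)) j) atTop (𝓝 ((cmvLin a ha x) j)) := by
      change Tendsto (fun i => ∑ k ∈ Finset.range (j + 3), cmvEntry a j k * u i k) atTop
        (𝓝 (∑ k ∈ Finset.range (j + 3), cmvEntry a j k * x k))
      refine tendsto_finsetSum _ fun k _ => Tendsto.const_mul _ ?_
      exact ((lp.evalCLM ℂ (fun _ : ℕ => ℂ) 2 k).continuous.tendsto x).comp hu
    exact tendsto_nhds_unique h1 h2

/-- The CMV operator `𝒞(γ)` with constant Verblunsky coefficients `γ`. -/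
def constCMV (γ : ℂ) : Ell2 →L[ℂ] Ell2 := cmv (fun _ => γ) ⟨‖γ‖, fun _ => le_rfl⟩

/-- The vector `e₀ ∈ ℓ²(ℕ₀)`. -/
def e0 : Ell2 := lp.single 2 0 1

/-! ### The `m`-function, Carathéodory function and Schur function of `𝒞(γ)` -/

/-- `m_γ(z) = ⟨e₀, (z - 𝒞(γ))⁻¹ e₀⟩` for `z` outside the spectrum of `𝒞(γ)`. -/
def mFun (γ z : ℂ) : ℂ := inner ℂ e0 (resolvent (constCMV γ) z e0)

/-- `F_γ(z) = ⟨e₀, (𝒞(γ) + z) (𝒞(γ) - z)⁻¹ e₀⟩` for `z` outside the spectrum of `𝒞(γ)`. -/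
def caraFun (γ z : ℂ) : ℂ :=
  inner ℂ e0 ((constCMV γ + algebraMap ℂ (Ell2 →L[ℂ] Ell2) z)
    (Ring.inverse (constCMV γ - algebraMap ℂ (Ell2 →L[ℂ] Ell2) z) e0))

/-- The Schur function `f_γ(z) = (1 / z) (F_γ(z) - 1) / (F_γ(z) + 1)`. The values at `z = 0` and
at isolated points of the spectrum (where `F_γ` has a pole or `e₀` does not see the spectrum) are
obtained by taking limits; at all other points outside the spectrum this is the quotient itself,
whenever it is finite. -/
def schurFun (γ z : ℂ) : ℂ :=
  limUnder (𝓝[≠] z) fun w => 1 / w * ((caraFun γ w - 1) / (caraFun γ w + 1))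

/-! ### The function `G_a` -/

/-- The arc `Γ_a = {e^{iθ} | θ_a ≤ θ ≤ 2π - θ_a}`, where `θ_a = 2 arcsin a`. -/
def arc (a : ℝ) : Set ℂ :=
  {z | ∃ θ : ℝ, 2 * Real.arcsin a ≤ θ ∧ θ ≤ 2 * Real.pi - 2 * Real.arcsin a ∧
    z = Complex.exp (θ * Complex.I)}

/-- The square root of `(z - 1)² + 4 a² z` that is analytic off `Γ_a` and equals `1` at `0`,
written through the principal square root. For `a = 0` it is `1 - z` for `|z| < 1` and `z - 1`
for `|z| > 1`. These properties are proved below. -/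
def arcRoot (a : ℝ) (z : ℂ) : ℂ :=
  (z + 1) * Complex.sqrt (((z - 1) ^ 2 + 4 * z * (a : ℂ) ^ 2) / (z + 1) ^ 2)

lemma arcRoot_zero (a : ℝ) : arcRoot a 0 = 1 := by
  simp [arcRoot, Complex.sqrt]

lemma arcRoot_zero_of_norm_lt {z : ℂ} (hz : ‖z‖ < 1) : arcRoot 0 z = 1 - z := by
  have h1 : z + 1 ≠ 0 := fun h => by simp [eq_neg_of_add_eq_zero_left h] at hz
  have hn : z.re * z.re + z.im * z.im < 1 := by
    rw [← Complex.normSq_apply, Complex.normSq_eq_norm_sq]; nlinarith [norm_nonneg z]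
  have hre : 0 < ((1 - z) / (z + 1)).re := by
    rw [Complex.div_re, ← add_div]
    refine div_pos ?_ (Complex.normSq_pos.mpr h1)
    simp; nlinarith
  have : ((z - 1) ^ 2 + 4 * z * ((0 : ℝ) : ℂ) ^ 2) / (z + 1) ^ 2 = ((1 - z) / (z + 1)) ^ 2 := by
    rw [div_pow]; simp; ring
  rw [arcRoot, this, Complex.sqrt, Complex.sq_cpow_two_inv hre]
  field_simp

lemma arcRoot_zero_of_one_lt_norm {z : ℂ} (hz : 1 < ‖z‖) : arcRoot 0 z = z - 1 := by
  have h1 : z + 1 ≠ 0 := fun h => by simp [eq_neg_of_add_eq_zero_left h] at hz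
  have hn : 1 < z.re * z.re + z.im * z.im := by
    rw [← Complex.normSq_apply, Complex.normSq_eq_norm_sq]; nlinarith [norm_nonneg z]
  have hre : 0 < ((z - 1) / (z + 1)).re := by
    rw [Complex.div_re, ← add_div]
    refine div_pos ?_ (Complex.normSq_pos.mpr h1)
    simp; nlinarith
  have : ((z - 1) ^ 2 + 4 * z * ((0 : ℝ) : ℂ) ^ 2) / (z + 1) ^ 2 = ((z - 1) / (z + 1)) ^ 2 := by
    rw [div_pow]; simp
  rw [arcRoot, this, Complex.sqrt, Complex.sq_cpow_two_inv hre]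
  field_simp

lemma neg_one_mem_arc {a : ℝ} : (-1 : ℂ) ∈ arc a := by
  refine ⟨Real.pi, ?_, ?_, by rw [Complex.exp_pi_mul_I]⟩ <;>
    linarith [Real.arcsin_le_pi_div_two a]

lemma arcRoot_sq {a : ℝ} {z : ℂ} (hz : z ∉ arc a) :
    arcRoot a z ^ 2 = (z - 1) ^ 2 + 4 * z * (a : ℂ) ^ 2 := by
  have h1 : z + 1 ≠ 0 := fun h => hz (by rw [eq_neg_of_add_eq_zero_left h]; exact neg_one_mem_arc)
  rw [arcRoot, mul_pow, Complex.sqrt, ← Complex.cpow_nat_mul]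
  simp only [Nat.cast_ofNat, ne_eq, OfNat.ofNat_ne_zero, not_false_eq_true, mul_inv_cancel₀,
    Complex.cpow_one]
  field_simp

/-- Off `Γ_a` the argument of the principal square root avoids `(-∞, 0]`. -/
lemma arcRoot_arg_mem_slitPlane {a : ℝ} (ha0 : 0 ≤ a) (ha1 : a ≤ 1) {z : ℂ} (hz : z ∉ arc a) :
    ((z - 1) ^ 2 + 4 * z * (a : ℂ) ^ 2) / (z + 1) ^ 2 ∈ Complex.slitPlane := by
  by_contra hw
  have h1 : z + 1 ≠ 0 := fun h => hz (by rw [eq_neg_of_add_eq_zero_left h]; exact neg_one_mem_arc)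
  set w := ((z - 1) ^ 2 + 4 * z * (a : ℂ) ^ 2) / (z + 1) ^ 2 with hwdef
  rw [Complex.mem_slitPlane_iff, not_or, not_lt, not_not] at hw
  obtain ⟨hre, him⟩ := hw
  set r : ℝ := -w.re with hr
  have hr0 : 0 ≤ r := by linarith
  have hwr : w = ((-r : ℝ) : ℂ) := Complex.ext (by simp [hr]) (by simpa using him)
  have hq : (z - 1) ^ 2 + 4 * z * (a : ℂ) ^ 2 = ((-r : ℝ) : ℂ) * (z + 1) ^ 2 := by
    rw [← hwr, hwdef]; field_simp
  have hasq : a ^ 2 ≤ 1 := by nlinarith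
  -- real and imaginary parts of `(1 + r) (z + 1)² = 4 (1 - a²) z`
  have hR := congrArg Complex.re hq
  have hI := congrArg Complex.im hq
  simp [pow_two] at hR hI
  obtain ⟨x, y⟩ := z
  simp only at hR hI
  have hnorm : x ^ 2 + y ^ 2 = 1 := by
    by_cases hy : y = 0
    · subst hy
      exfalso
      have h1' : x + 1 ≠ 0 := fun h => h1 (Complex.ext (by simpa using h) (by simp))
      have h2 : 0 < (x + 1) ^ 2 := by positivity
      have h3 : (x - 1) ^ 2 + 4 * x * a ^ 2 = -r * (x + 1) ^ 2 := by nlinarith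
      by_cases hx : 0 ≤ x
      · have h4 : x = 1 ∧ a = 0 := by
          have e1 : 0 ≤ 4 * x * a ^ 2 := by positivity
          have e2 : 0 ≤ r * (x + 1) ^ 2 := by positivity
          have e3 : (x - 1) ^ 2 = 0 := by nlinarith [sq_nonneg (x - 1)]
          have e4 : x = 1 := by nlinarith [pow_eq_zero_iff (two_ne_zero) |>.mp e3]
          refine ⟨e4, ?_⟩
          subst e4
          have : a ^ 2 = 0 := by nlinarith [sq_nonneg a]
          exact pow_eq_zero_iff two_ne_zero |>.mp this
        refine hz ⟨0, by simp [h4.2], by simp [h4.2, Real.pi_pos.le], ?_⟩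
        simp only [Complex.ofReal_zero, zero_mul, Complex.exp_zero]
        exact Complex.ext (by simpa using h4.1) (by simp)
      · nlinarith [mul_nonneg hr0 h2.le, mul_nonneg (by linarith : 0 ≤ -x) (sub_nonneg.mpr hasq)]
    · -- divide the imaginary part by `y`
      have hI' : (1 + r) * (x + 1) = 2 * (1 - a ^ 2) := by
        have : y * ((1 + r) * (x + 1) - 2 * (1 - a ^ 2)) = 0 := by nlinarith
        rcases mul_eq_zero.mp this with h | h
        · exact absurd h hy
        · linarith
      have : (1 + r) * (x ^ 2 + y ^ 2 - 1) = 0 := by nlinarith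
      rcases mul_eq_zero.mp this with h | h <;> linarith
  have hx : x ≤ 1 - 2 * a ^ 2 := by
    have e1 : (1 + r) * (x ^ 2 + 2 * x + 1 - y ^ 2) = 4 * (1 - a ^ 2) * x := by nlinarith
    have e2 : (1 + r) * (2 * (x + 1) * y) = 4 * (1 - a ^ 2) * y := by nlinarith
    have e3 : (1 + r) * (x + 1) = 2 * (1 - a ^ 2) := by
      have f1 : x * ((1 + r) * (x + 1) - 2 * (1 - a ^ 2)) = 0 := by
        have : y ^ 2 = 1 - x ^ 2 := by linarith
        rw [this] at e1
        nlinarith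
      have f2 : y * ((1 + r) * (x + 1) - 2 * (1 - a ^ 2)) = 0 := by nlinarith
      have f3 : (x ^ 2 + y ^ 2) * ((1 + r) * (x + 1) - 2 * (1 - a ^ 2)) = 0 := by
        linear_combination x * f1 + y * f2
      rw [hnorm] at f3
      linarith
    have e4 : 0 ≤ x + 1 := by nlinarith
    nlinarith
  -- a point of the unit circle with real part at most `cos θ_a` is on the arc
  have hs0 : 0 ≤ Real.arcsin a := Real.arcsin_nonneg.mpr ha0
  have hcos : Real.cos (2 * Real.arcsin a) = 1 - 2 * a ^ 2 := by
    rw [Real.cos_two_mul, Real.cos_sq', Real.sin_arcsin (by linarith) ha1]; ring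
  have hx1 : -1 ≤ x := by nlinarith
  have hle : 2 * Real.arcsin a ≤ Real.arccos x := by
    rw [← Real.arccos_cos (x := 2 * Real.arcsin a) (by linarith)
      (by linarith [Real.arcsin_le_pi_div_two a]), hcos]
    exact Real.arccos_le_arccos hx
  have hcx : Real.cos (Real.arccos x) = x := Real.cos_arccos hx1 (by nlinarith)
  have hsx : Real.sin (Real.arccos x) = |y| := by
    rw [Real.sin_arccos, show 1 - x ^ 2 = y ^ 2 by linarith, Real.sqrt_sq_eq_abs]
  have hpi := Real.arccos_le_pi x
  rcases abs_cases y with ⟨h, -⟩ | ⟨h, -⟩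
  · refine hz ⟨Real.arccos x, hle, by linarith [Real.arcsin_le_pi_div_two a], ?_⟩
    rw [Complex.exp_mul_I, ← Complex.ofReal_cos, ← Complex.ofReal_sin, hcx, hsx, h]
    exact Complex.ext (by simp) (by simp)
  · refine hz ⟨2 * Real.pi - Real.arccos x, by linarith [Real.arcsin_le_pi_div_two a],
      by linarith, ?_⟩
    rw [Complex.exp_mul_I, ← Complex.ofReal_cos, ← Complex.ofReal_sin,
      Real.cos_two_pi_sub, Real.sin_two_pi_sub, hcx, hsx, h]
    exact Complex.ext (by simp) (by simp)

lemma differentiableOn_arcRoot {a : ℝ} (ha0 : 0 ≤ a) (ha1 : a ≤ 1) :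
    DifferentiableOn ℂ (arcRoot a) (arc a)ᶜ := by
  intro z hz
  have h1 : z + 1 ≠ 0 := fun h => hz (by rw [eq_neg_of_add_eq_zero_left h]; exact neg_one_mem_arc)
  have hs := arcRoot_arg_mem_slitPlane ha0 ha1 hz
  have h2 : (z + 1) ^ 2 ≠ 0 := pow_ne_zero 2 h1
  refine DifferentiableAt.differentiableWithinAt ?_
  unfold arcRoot Complex.sqrt
  refine DifferentiableAt.mul (by fun_prop) (DifferentiableAt.cpow ?_ (by fun_prop) hs)
  exact DifferentiableAt.div (by fun_prop) (by fun_prop) h2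

/-- `G_a(z) = (z + 1 + √((z - 1)² + 4 a² z)) / 2`, for `z` outside `Γ_a`. -/
def G (a : ℝ) (z : ℂ) : ℂ := 1 / 2 * (z + 1 + arcRoot a z)

/-! ### Limits along `n / N → t` and the limiting zero sets -/

/-- The index sequences over which a limit `n / N → t` is taken: `n_j, N_j → ∞` and
`n_j / N_j → t`. -/
def RatioSeq (t : ℝ) (n N : ℕ → ℕ) : Prop :=
  Tendsto n atTop atTop ∧ Tendsto N atTop atTop ∧
    Tendsto (fun j => (n j : ℝ) / (N j : ℝ)) atTop (𝓝 t)

/-- `lim_{n/N → t} x_{n,N} = l`. -/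
def RatioTendsto (t : ℝ) (x : ℕ → ℕ → ℂ) (l : ℂ) : Prop :=
  ∀ n N : ℕ → ℕ, RatioSeq t n N → Tendsto (fun j => x (n j) (N j)) atTop (𝓝 l)

/-- `lim_{n/N → t} P_{n,N}(z) / Q_{n,N}(z) = g(z)` uniformly on compact subsets of `S`. On each
compact set the denominators are eventually free of zeros, so that the quotients make sense. -/
def RatioTendstoOnCompacts (t : ℝ) (P Q : ℕ → ℕ → ℂ[X]) (g : ℂ → ℂ) (S : Set ℂ) : Prop :=
  ∀ n N : ℕ → ℕ, RatioSeq t n N → ∀ K : Set ℂ, K ⊆ S → IsCompact K →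
    (∀ᶠ j in atTop, ∀ z ∈ K, (Q (n j) (N j)).eval z ≠ 0) ∧
    TendstoUniformlyOn (fun j z => (P (n j) (N j)).eval z / (Q (n j) (N j)).eval z) g atTop K

/-- For a doubly indexed family `α_{n,N}` (written `α n N`), the coefficients `n ↦ α_{n,N}`. -/
def coeffs (α : ℕ → ℕ → ℂ) (N : ℕ) : ℕ → ℂ := fun n => α n N

/-- The zero set of `Φ_{n,N}^{(β)}` on the unit circle. -/
def popucZeros (α : ℕ → ℕ → ℂ) (β : ℂ) (n N : ℕ) : Set ℂ :=
  {z | ‖z‖ = 1 ∧ (popuc (coeffs α N) β n).eval z = 0}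

/-- The set `Λ_{β,t}` of limit points of zeros of `Φ_{n,N}^{(β)}` as `n / N → t`. -/
def limitZeros (α : ℕ → ℕ → ℂ) (t : ℝ) (β : ℂ) : Set ℂ :=
  {ξ | ‖ξ‖ = 1 ∧ ∃ n N : ℕ → ℕ, RatioSeq t n N ∧
    liminf (fun j => Metric.infEDist ξ (popucZeros α β (n j) (N j))) atTop = 0}

/-- The set `Λ_t`, the intersection of all `Λ_{β,t}` with `|β| = 1`. -/
def limitZerosInter (α : ℕ → ℕ → ℂ) (t : ℝ) : Set ℂ :=
  {ξ | ∀ β : ℂ, ‖β‖ = 1 → ξ ∈ limitZeros α t β}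

end VaryingOPUC

end

open VaryingOPUC

/-!
The quotients `Φ_n / Φ_n^*` are iterates of the Schur algorithm run backwards with coefficients
that become constant, so in the disc the Schwarz–Pick contraction drives them to the fixed point
`f_{-ᾱ}`. This gives the limit of `m = Φ_n / Φ_{n+1}^{(β)}` inside the disc, and outside it by
reflection.

Moreover `m` is the Cauchy transform of a probability measure on the zeros of `Φ_{n+1}^{(β)}`, so
near a point of the unit circle outside `Λ_{β,t}` it is bounded and equi-Lipschitz, which carries
the convergence over to the circle. What remains is `Γ_a ⊆ Λ_{β,t}`. Away from the zeros
`Re (z m) = 1 / 2` on the circle, so at a point `ξ` that no zeros approach the limit `f_{-ᾱ}` is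
unimodular, and its fixed point equation then forces `|1 - ξ| ≤ 2 a`; the case `a = 1` follows from
Hurwitz's theorem at the point `-1`.
-/

namespace VaryingOPUC

/-! ### Reversed polynomials and the Szegő recurrence -/

section RevPoly

variable {n : ℕ} {p : ℂ[X]}

lemma natDegree_revPoly_le (hp : p.natDegree ≤ n) : (revPoly n p).natDegree ≤ n := by
  rw [natDegree_le_iff_coeff_eq_zero]
  intro k hk
  rw [revPoly, coeff_reflect, revAt_eq_self_of_lt hk, coeff_map,
    coeff_eq_zero_of_natDegree_lt (hp.trans_lt hk), map_zero]

lemma revPoly_revPoly (n : ℕ) (p : ℂ[X]) : revPoly n (revPoly n p) = p := by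
  ext k
  simp [revPoly, coeff_reflect]

lemma revPoly_sub (n : ℕ) (p q : ℂ[X]) : revPoly n (p - q) = revPoly n p - revPoly n q := by
  simp [revPoly, reflect_sub]

lemma revPoly_C_mul (n : ℕ) (c : ℂ) (p : ℂ[X]) :
    revPoly n (C c * p) = C (conj c) * revPoly n p := by
  simp [revPoly, reflect_C_mul]

lemma revPoly_succ_X_mul (hp : p.natDegree ≤ n) : revPoly (n + 1) (X * p) = revPoly n p := by
  rw [revPoly, Polynomial.map_mul, map_X, add_comm,
    reflect_mul _ _ natDegree_X_le (natDegree_map_le.trans hp), reflect_one_X, one_mul, revPoly]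

lemma revPoly_succ (hp : p.natDegree ≤ n) : revPoly (n + 1) p = X * revPoly n p := by
  rw [← revPoly_revPoly (n + 1) (X * revPoly n p), revPoly_succ_X_mul (natDegree_revPoly_le hp),
    revPoly_revPoly]

lemma eval_revPoly (hp : p.natDegree ≤ n) {z : ℂ} (hz : z ≠ 0) :
    (revPoly n p).eval z = z ^ n * conj (p.eval (conj z)⁻¹) := by
  let := invertibleOfNonzero hz
  have key := eval₂_reflect_mul_pow (RingHom.id ℂ) z n (revPoly n p)
    (natDegree_revPoly_le hp)
  have hrev : reflect n (revPoly n p) = p.map (starRingEnd ℂ) := reflect_reflect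
  rw [hrev, eval₂_id, eval₂_id, invOf_eq_inv, eval_map] at key
  have hconj : conj (p.eval (conj z)⁻¹) = p.eval₂ (starRingEnd ℂ) z⁻¹ := by
    rw [eval, hom_eval₂, RingHom.comp_id, map_inv₀, Complex.conj_conj]
  rw [← key, hconj, mul_comm]

lemma natDegree_X_mul_sub_C_mul {R : Type*} [CommRing R] [Nontrivial R] {p q : R[X]}
    (hp : p.Monic) (hq : q.natDegree ≤ p.natDegree) (c : R) :
    (X * p - C c * q).natDegree = p.natDegree + 1 := by
  rw [natDegree_sub_eq_left_of_natDegree_lt, natDegree_X_mul hp.ne_zero]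
  rw [natDegree_X_mul hp.ne_zero]
  exact Nat.lt_succ_of_le ((natDegree_C_mul_le c q).trans hq)

lemma monic_X_mul_sub_C_mul {R : Type*} [CommRing R] [Nontrivial R] {p q : R[X]}
    (hp : p.Monic) (hq : q.natDegree ≤ p.natDegree) (c : R) : (X * p - C c * q).Monic := by
  refine (monic_X.mul hp).sub_of_left (degree_lt_degree ?_)
  rw [natDegree_X_mul hp.ne_zero]
  exact Nat.lt_succ_of_le ((natDegree_C_mul_le c q).trans hq)

end RevPoly

section Recurrence

variable (a : ℕ → ℂ) (β : ℂ) (n : ℕ) (z : ℂ)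

lemma opuc_succ : opuc a (n + 1) = X * opuc a n - C (conj (a n)) * opucStar a n := rfl

lemma popuc_succ : popuc a β (n + 1) = X * opuc a n - C (conj β) * opucStar a n := rfl

lemma opucStar_zero : opucStar a 0 = 1 := by simp [opucStar, revPoly, opuc]

lemma monic_and_natDegree_opuc : (opuc a n).Monic ∧ (opuc a n).natDegree = n := by
  induction n with
  | zero => simp [opuc]
  | succ n ih =>
    have hstar : (opucStar a n).natDegree ≤ (opuc a n).natDegree :=
      ih.2.symm ▸ natDegree_revPoly_le ih.2.le
    exact ⟨monic_X_mul_sub_C_mul ih.1 hstar _, by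
      rw [opuc_succ, natDegree_X_mul_sub_C_mul ih.1 hstar, ih.2]⟩

lemma opuc_monic : (opuc a n).Monic := (monic_and_natDegree_opuc a n).1

lemma natDegree_opuc : (opuc a n).natDegree = n := (monic_and_natDegree_opuc a n).2

lemma natDegree_opucStar_le : (opucStar a n).natDegree ≤ n :=
  natDegree_revPoly_le (natDegree_opuc a n).le

lemma natDegree_opucStar_le_natDegree_opuc :
    (opucStar a n).natDegree ≤ (opuc a n).natDegree :=
  (natDegree_opucStar_le a n).trans_eq (natDegree_opuc a n).symm

lemma natDegree_popuc_succ : (popuc a β (n + 1)).natDegree = n + 1 := by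
  rw [popuc_succ, natDegree_X_mul_sub_C_mul (opuc_monic a n)
    (natDegree_opucStar_le_natDegree_opuc a n), natDegree_opuc]

lemma popuc_succ_monic : (popuc a β (n + 1)).Monic :=
  monic_X_mul_sub_C_mul (opuc_monic a n) (natDegree_opucStar_le_natDegree_opuc a n) _

lemma opucStar_succ : opucStar a (n + 1) = opucStar a n - C (a n) * (X * opuc a n) := by
  have hX : revPoly (n + 1) (X * opuc a n) = opucStar a n :=
    revPoly_succ_X_mul (natDegree_opuc a n).le
  have hstar : revPoly (n + 1) (opucStar a n) = X * opuc a n := by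
    rw [revPoly_succ (natDegree_opucStar_le a n), opucStar, revPoly_revPoly]
  rw [opucStar, opuc_succ, revPoly_sub, revPoly_C_mul, hX, hstar, Complex.conj_conj]

lemma eval_opuc_succ : (opuc a (n + 1)).eval z
    = z * (opuc a n).eval z - conj (a n) * (opucStar a n).eval z := by
  simp [opuc_succ]

lemma eval_opucStar_succ : (opucStar a (n + 1)).eval z
    = (opucStar a n).eval z - a n * (z * (opuc a n).eval z) := by
  simp [opucStar_succ]

lemma eval_popuc_succ : (popuc a β (n + 1)).eval z
    = z * (opuc a n).eval z - conj β * (opucStar a n).eval z := by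
  simp [popuc_succ]

variable {z}

lemma eval_opucStar (hz : z ≠ 0) :
    (opucStar a n).eval z = z ^ n * conj ((opuc a n).eval (conj z)⁻¹) :=
  eval_revPoly (natDegree_opuc a n).le hz

lemma eval_opuc (hz : z ≠ 0) :
    (opuc a n).eval z = z ^ n * conj ((opucStar a n).eval (conj z)⁻¹) := by
  rw [← revPoly_revPoly n (opuc a n)]
  exact eval_revPoly (natDegree_opucStar_le a n) hz

lemma inv_conj_of_norm_eq_one (hz : ‖z‖ = 1) : (conj z)⁻¹ = z := by
  rw [← Complex.inv_eq_conj hz, inv_inv]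

lemma eval_opuc_mul_opucStar_of_norm_eq_one (hz : ‖z‖ = 1) :
    (opuc a n).eval z * (opucStar a n).eval z = z ^ n * (‖(opuc a n).eval z‖ : ℂ) ^ 2 := by
  rw [eval_opucStar a n (norm_ne_zero_iff.mp (by simp [hz])), inv_conj_of_norm_eq_one hz,
    ← Complex.mul_conj']
  ring

end Recurrence

/-! ### Location of the zeros -/

lemma norm_sub_mul_sq_sub_norm_sub_conj_mul_sq (γ u v : ℂ) :
    ‖v - γ * u‖ ^ 2 - ‖u - conj γ * v‖ ^ 2 = (1 - ‖γ‖ ^ 2) * (‖v‖ ^ 2 - ‖u‖ ^ 2) := by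
  simp only [← Complex.normSq_eq_norm_sq, Complex.normSq_apply, Complex.sub_re, Complex.sub_im,
    Complex.mul_re, Complex.mul_im, Complex.conj_re, Complex.conj_im]
  ring

lemma one_sub_norm_sq_pos {c : ℂ} (hc : ‖c‖ < 1) : 0 < 1 - ‖c‖ ^ 2 :=
  sub_pos.mpr (pow_lt_one₀ (norm_nonneg c) hc two_ne_zero)

section Zeros

variable {a : ℕ → ℂ} (ha : ∀ n, ‖a n‖ < 1) (n : ℕ) {z : ℂ}
include ha

lemma opucStar_ne_zero_and_norm_opuc_le (hz : ‖z‖ ≤ 1) :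
    (opucStar a n).eval z ≠ 0 ∧ ‖(opuc a n).eval z‖ ≤ ‖(opucStar a n).eval z‖ := by
  induction n with
  | zero => simp [opuc, opucStar_zero]
  | succ n ih =>
    obtain ⟨hne, hle⟩ := ih
    set u := z * (opuc a n).eval z with hu
    set v := (opucStar a n).eval z
    have huv : ‖u‖ ≤ ‖v‖ := by
      rw [hu, norm_mul]
      exact (mul_le_of_le_one_left (norm_nonneg _) hz).trans hle
    rw [eval_opucStar_succ, eval_opuc_succ, ← hu]
    constructor
    · have hlt : ‖a n * u‖ < ‖v‖ := by
        rw [norm_mul]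
        nlinarith [ha n, norm_nonneg (a n), norm_pos_iff.mpr hne]
      exact sub_ne_zero.mpr fun h => hlt.ne' (congrArg norm h)
    · have hprod : 0 ≤ (1 - ‖a n‖ ^ 2) * (‖v‖ ^ 2 - ‖u‖ ^ 2) :=
        mul_nonneg (one_sub_norm_sq_pos (ha n)).le (sub_nonneg.mpr (by gcongr))
      have hid := norm_sub_mul_sq_sub_norm_sub_conj_mul_sq (a n) u v
      exact (sq_le_sq₀ (norm_nonneg _) (norm_nonneg _)).mp (by linarith)

lemma opucStar_ne_zero (hz : ‖z‖ ≤ 1) : (opucStar a n).eval z ≠ 0 :=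
  (opucStar_ne_zero_and_norm_opuc_le ha n hz).1

lemma norm_opuc_le (hz : ‖z‖ ≤ 1) : ‖(opuc a n).eval z‖ ≤ ‖(opucStar a n).eval z‖ :=
  (opucStar_ne_zero_and_norm_opuc_le ha n hz).2

lemma opuc_ne_zero (hz : 1 ≤ ‖z‖) : (opuc a n).eval z ≠ 0 := by
  have hz0 : z ≠ 0 := norm_pos_iff.mp (zero_lt_one.trans_le hz)
  rw [eval_opuc a n hz0]
  exact mul_ne_zero (pow_ne_zero _ hz0) <| (_root_.map_ne_zero _).mpr <|
    opucStar_ne_zero ha n (by simpa using inv_le_one_of_one_le₀ hz)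

lemma norm_opucStar_le (hz : 1 ≤ ‖z‖) : ‖(opucStar a n).eval z‖ ≤ ‖(opuc a n).eval z‖ := by
  have hz0 : z ≠ 0 := norm_pos_iff.mp (zero_lt_one.trans_le hz)
  rw [eval_opuc a n hz0, eval_opucStar a n hz0, norm_mul, norm_mul, RCLike.norm_conj,
    RCLike.norm_conj]
  gcongr
  exact norm_opuc_le ha n (by simpa using inv_le_one_of_one_le₀ hz)

lemma norm_eq_one_of_popuc_eq_zero {β : ℂ} (hβ : ‖β‖ = 1) (h : (popuc a β n).eval z = 0) :
    ‖z‖ = 1 := by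
  cases n with
  | zero => simp [popuc] at h
  | succ n =>
    have hnorm : ‖z‖ * ‖(opuc a n).eval z‖ = ‖(opucStar a n).eval z‖ := by
      rw [eval_popuc_succ, sub_eq_zero] at h
      simpa [hβ] using congrArg norm h
    rcases lt_trichotomy ‖z‖ 1 with hz | hz | hz
    · nlinarith [norm_pos_iff.mpr (opucStar_ne_zero ha n hz.le), norm_opuc_le ha n hz.le,
        norm_nonneg z]
    · exact hz
    · nlinarith [norm_pos_iff.mpr (opuc_ne_zero ha n hz.le), norm_opucStar_le ha n hz.le]

end Zeros

/-! ### Partial fractions of `Φ_n / Φ_{n+1}^{(β)}` -/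

section SimpleRoots

variable {K : Type*} [Field K] {P Q : K[X]}

lemma nodup_roots_of_eval_derivative_ne_zero (hP : P ≠ 0)
    (h : ∀ x, P.eval x = 0 → (derivative P).eval x ≠ 0) : P.roots.Nodup := by
  classical
  refine Multiset.nodup_iff_count_le_one.mpr fun x => not_lt.mp fun hlt => ?_
  rw [count_roots, one_lt_rootMultiplicity_iff_isRoot hP] at hlt
  exact h x hlt.1 hlt.2

lemma card_roots_toFinset [DecidableEq K] (hsplits : P.Splits) (hnodup : P.roots.Nodup) :
    P.roots.toFinset.card = P.natDegree := by
  rw [Multiset.toFinset_card_of_nodup hnodup, ← hsplits.natDegree_eq_card_roots]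

variable [DecidableEq K] (hP : P.Monic) (hsplits : P.Splits) (hnodup : P.roots.Nodup)
include hP hsplits hnodup

lemma nodal_roots_toFinset : Lagrange.nodal P.roots.toFinset id = P := by
  conv_rhs => rw [hsplits.eq_prod_roots_of_monic hP]
  rw [Lagrange.nodal_eq, Finset.prod, Multiset.toFinset_val, hnodup.dedup]
  rfl

lemma nodalWeight_roots_toFinset {x : K} (hx : x ∈ P.roots.toFinset) :
    Lagrange.nodalWeight P.roots.toFinset id x = ((derivative P).eval x)⁻¹ := by
  rw [Lagrange.nodalWeight_eq_eval_derivative_nodal hx,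
    nodal_roots_toFinset hP hsplits hnodup, id]

lemma eval_div_eval_eq_sum_roots (hdeg : Q.natDegree < P.natDegree) {z : K}
    (hz : P.eval z ≠ 0) : Q.eval z / P.eval z
      = ∑ x ∈ P.roots.toFinset, Q.eval x / (derivative P).eval x / (z - x) := by
  have hnode : ∀ x ∈ P.roots.toFinset, z ≠ id x := by
    rintro x hx rfl
    exact hz (isRoot_of_mem_roots (Multiset.mem_toFinset.mp hx))
  have hinterp : Q = Lagrange.interpolate P.roots.toFinset id fun x => Q.eval x := by
    refine Lagrange.eq_interpolate (Set.injOn_id _) ?_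
    rw [card_roots_toFinset hsplits hnodup, ← degree_eq_natDegree hP.ne_zero]
    exact degree_lt_degree hdeg
  have heval := Lagrange.eval_interpolate_not_at_node (fun x => Q.eval x) hnode
  rw [← hinterp, nodal_roots_toFinset hP hsplits hnodup] at heval
  rw [heval, mul_div_cancel_left₀ _ hz]
  refine Finset.sum_congr rfl fun x hx => ?_
  rw [nodalWeight_roots_toFinset hP hsplits hnodup hx, id]
  ring

lemma sum_roots_eval_div_eval_derivative (hQ : Q.Monic)
    (hdeg : P.natDegree = Q.natDegree + 1) :
    ∑ x ∈ P.roots.toFinset, Q.eval x / (derivative P).eval x = 1 := by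
  have hlead := Lagrange.leadingCoeff_eq_sum (P := Q) (s := P.roots.toFinset) (Set.injOn_id _) (by
    rw [card_roots_toFinset hsplits hnodup, hdeg, degree_eq_natDegree hQ.ne_zero]; rfl)
  rw [← hQ.leadingCoeff, hlead]
  refine Finset.sum_congr rfl fun x hx => ?_
  rw [div_eq_mul_inv, ← nodalWeight_roots_toFinset hP hsplits hnodup hx, Lagrange.nodalWeight,
    Finset.prod_inv_distrib, div_eq_mul_inv]
  rfl

end SimpleRoots

section Residues

variable {a : ℕ → ℂ} (ha : ∀ n, ‖a n‖ < 1) {β : ℂ} (hβ : ‖β‖ = 1) (n : ℕ) {z : ℂ}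
include ha

lemma exists_wronskian_eq (hz : ‖z‖ = 1) :
    ∃ c : ℝ, 0 ≤ c ∧ z * ((derivative (opuc a n)).eval z * (opucStar a n).eval z
      - (opuc a n).eval z * (derivative (opucStar a n)).eval z) = z ^ n * c := by
  induction n with
  | zero => exact ⟨0, le_rfl, by simp [opuc, opucStar_zero]⟩
  | succ n ih =>
    obtain ⟨c, hc, hW⟩ := ih
    refine ⟨(1 - ‖a n‖ ^ 2) * (‖(opuc a n).eval z‖ ^ 2 + c),
      mul_nonneg (one_sub_norm_sq_pos (ha n)).le (by positivity), ?_⟩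
    have hprod := eval_opuc_mul_opucStar_of_norm_eq_one a n hz
    rw [opuc_succ, opucStar_succ]
    simp only [derivative_sub, derivative_mul, derivative_X, derivative_C, eval_sub, eval_mul,
      eval_add, eval_X, eval_C, eval_one, eval_zero]
    push_cast
    rw [← Complex.mul_conj' (a n)]
    linear_combination (1 - a n * conj (a n)) * z * (hprod + hW)

include hβ

lemma exists_popuc_residue (h : (popuc a β (n + 1)).eval z = 0) :
    (derivative (popuc a β (n + 1))).eval z ≠ 0 ∧ ∃ r : ℝ, 0 ≤ r ∧
      (opuc a n).eval z / (derivative (popuc a β (n + 1))).eval z = r := by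
  have hz := norm_eq_one_of_popuc_eq_zero ha (n + 1) hβ h
  have hstar := opucStar_ne_zero ha n hz.le
  obtain ⟨c, hc, hW⟩ := exists_wronskian_eq ha n hz
  have hprod := eval_opuc_mul_opucStar_of_norm_eq_one a n hz
  set S : ℝ := ‖(opuc a n).eval z‖ ^ 2 with hS
  have hSpos : 0 < S := pow_pos (norm_pos_iff.mpr (opuc_ne_zero ha n hz.ge)) 2
  rw [eval_popuc_succ] at h
  have hder : (derivative (popuc a β (n + 1))).eval z * (opucStar a n).eval z
      = z ^ n * ((S + c : ℝ) : ℂ) := by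
    rw [popuc_succ]
    simp only [derivative_sub, derivative_mul, derivative_X, derivative_C, eval_sub, eval_mul,
      eval_add, eval_X, eval_C, eval_one, eval_zero]
    push_cast [hS]
    linear_combination hprod + hW + (derivative (opucStar a n)).eval z * h
  have hzn : z ^ n ≠ 0 := pow_ne_zero _ (norm_ne_zero_iff.mp (by simp [hz]))
  have hSc : ((S + c : ℝ) : ℂ) ≠ 0 := Complex.ofReal_ne_zero.mpr (by positivity)
  refine ⟨left_ne_zero_of_mul (hder ▸ mul_ne_zero hzn hSc), S / (S + c), by positivity, ?_⟩
  rw [← mul_div_mul_right _ _ hstar, hder, hprod, mul_div_mul_left _ _ hzn]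
  push_cast [hS]
  rfl

lemma exists_partial_fractions :
    ∃ (s : Finset ℂ) (r : ℂ → ℝ), (∀ x ∈ s, (popuc a β (n + 1)).eval x = 0) ∧
      (∀ x ∈ s, 0 ≤ r x) ∧ ∑ x ∈ s, r x = 1 ∧
      ∀ z, (popuc a β (n + 1)).eval z ≠ 0 →
        (opuc a n).eval z / (popuc a β (n + 1)).eval z = ∑ x ∈ s, r x / (z - x) := by
  set P := popuc a β (n + 1)
  have hP : P.Monic := popuc_succ_monic a β n
  have hdeg : P.natDegree = (opuc a n).natDegree + 1 := by
    rw [natDegree_popuc_succ, natDegree_opuc]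
  have hsplits : P.Splits := IsAlgClosed.splits P
  have hnodup : P.roots.Nodup := nodup_roots_of_eval_derivative_ne_zero hP.ne_zero
    fun x hx => (exists_popuc_residue ha hβ n hx).1
  have hroot : ∀ x ∈ P.roots.toFinset, P.eval x = 0 := fun x hx =>
    isRoot_of_mem_roots (Multiset.mem_toFinset.mp hx)
  choose! r hr0 hr using fun x hx => (exists_popuc_residue ha hβ n (hroot x hx)).2
  refine ⟨P.roots.toFinset, r, hroot, hr0, ?_, fun z hz => ?_⟩
  · rw [← Complex.ofReal_inj, Complex.ofReal_sum, Complex.ofReal_one,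
      ← sum_roots_eval_div_eval_derivative hP hsplits hnodup (opuc_monic a n) hdeg]
    exact Finset.sum_congr rfl fun x hx => (hr x hx).symm
  · rw [eval_div_eval_eq_sum_roots hP hsplits hnodup (by omega) hz]
    exact Finset.sum_congr rfl fun x hx => by rw [hr x hx]

end Residues

section CauchyTransform

variable {s : Finset ℂ} {r : ℂ → ℝ} (hr : ∀ x ∈ s, 0 ≤ r x) (hsum : ∑ x ∈ s, r x = 1)
  {δ : ℝ} (hδ : 0 < δ) {z w : ℂ}
include hr hsum hδ

lemma norm_sum_div_sub_le (hz : ∀ x ∈ s, δ ≤ ‖z - x‖) : ‖∑ x ∈ s, r x / (z - x)‖ ≤ 1 / δ := by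
  calc ‖∑ x ∈ s, r x / (z - x)‖ ≤ ∑ x ∈ s, r x * (1 / δ) := by
        refine norm_sum_le_of_le _ fun x hx => ?_
        rw [norm_div, Complex.norm_of_nonneg (hr x hx), div_eq_mul_one_div]
        exact mul_le_mul_of_nonneg_left (one_div_le_one_div_of_le hδ (hz x hx)) (hr x hx)
    _ = 1 / δ := by rw [← Finset.sum_mul, hsum, one_mul]

lemma norm_sum_div_sub_sub_le (hz : ∀ x ∈ s, δ ≤ ‖z - x‖) (hw : ∀ x ∈ s, δ ≤ ‖w - x‖) :
    ‖∑ x ∈ s, r x / (z - x) - ∑ x ∈ s, r x / (w - x)‖ ≤ ‖z - w‖ / δ ^ 2 := by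
  rw [← Finset.sum_sub_distrib]
  calc ‖∑ x ∈ s, (r x / (z - x) - r x / (w - x))‖ ≤ ∑ x ∈ s, r x * (‖z - w‖ / δ ^ 2) := by
        refine norm_sum_le_of_le _ fun x hx => ?_
        have hzx : z - x ≠ 0 := norm_pos_iff.mp (hδ.trans_le (hz x hx))
        have hwx : w - x ≠ 0 := norm_pos_iff.mp (hδ.trans_le (hw x hx))
        have hres : (r x : ℂ) / (z - x) - r x / (w - x)
            = r x * ((w - z) / ((z - x) * (w - x))) := by
          field_simp
          ring
        rw [hres, norm_mul, Complex.norm_of_nonneg (hr x hx), norm_div, norm_mul,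
          norm_sub_rev w z, pow_two]
        have := hr x hx
        gcongr
        exacts [hz x hx, hw x hx]
    _ = ‖z - w‖ / δ ^ 2 := by rw [← Finset.sum_mul, hsum, one_mul]

end CauchyTransform

lemma re_div_sub_of_norm_eq {u v : ℂ} (h : ‖u‖ = ‖v‖) (hne : u ≠ v) : (u / (u - v)).re = 1 / 2 := by
  have hsq : u.re * u.re + u.im * u.im = v.re * v.re + v.im * v.im := by
    rw [← Complex.normSq_apply, ← Complex.normSq_apply, Complex.normSq_eq_norm_sq,
      Complex.normSq_eq_norm_sq, h]
  rw [Complex.div_re, ← add_div, div_eq_iff (Complex.normSq_pos.mpr (sub_ne_zero.mpr hne)).ne',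
    Complex.normSq_apply]
  simp only [Complex.sub_re, Complex.sub_im]
  linear_combination (1 / 2) * hsq

section FiniteM

lemma mul_conj_of_norm_eq_one {β : ℂ} (hβ : ‖β‖ = 1) : β * conj β = 1 := by
  simp [Complex.mul_conj', hβ]

/-- The quotient `Φ_n / Φ_{n+1}^{(β)}`, the `m`-function of the finite unitary CMV matrix with last
Verblunsky coefficient `β`. -/
noncomputable def finiteM (a : ℕ → ℂ) (β : ℂ) (n : ℕ) (z : ℂ) : ℂ :=
  (opuc a n).eval z / (popuc a β (n + 1)).eval z

lemma eval_ne_zero_of_le_dist {P : ℂ[X]} {δ : ℝ} (hδ : 0 < δ) {z : ℂ}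
    (hz : ∀ x, P.eval x = 0 → δ ≤ ‖z - x‖) : P.eval z ≠ 0 := fun h =>
  absurd (hz z h) (by simpa using hδ)

variable {a : ℕ → ℂ} {β : ℂ} (hβ : ‖β‖ = 1) {n : ℕ} {δ : ℝ} (hδ : 0 < δ) {z w : ℂ}

include hβ in
lemma popuc_div_popuc_eq (h : (popuc a β (n + 1)).eval z ≠ 0) :
    (popuc a β (n + 2)).eval z / (popuc a β (n + 1)).eval z
      = 1 + z * (conj (a n) * β) + z * finiteM a β n z
        * (z * (1 - conj (a n) * β) - (1 - a n * conj β)) := by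
  rw [finiteM]
  field_simp
  rw [eval_popuc_succ, eval_popuc_succ, eval_opuc_succ, eval_opucStar_succ]
  linear_combination (opucStar a n).eval z * z * conj (a n) * mul_conj_of_norm_eq_one hβ

variable (ha : ∀ n, ‖a n‖ < 1)
include ha hβ

lemma re_mul_finiteM (hz : ‖z‖ = 1) (h : (popuc a β (n + 1)).eval z ≠ 0) :
    (z * finiteM a β n z).re = 1 / 2 := by
  rw [eval_popuc_succ] at h
  rw [finiteM, ← mul_div_assoc, eval_popuc_succ]
  refine re_div_sub_of_norm_eq ?_ (sub_ne_zero.mp h)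
  rw [norm_mul, norm_mul, RCLike.norm_conj, hz, hβ,
    (norm_opuc_le ha n hz.le).antisymm (norm_opucStar_le ha n hz.ge)]

include hδ

lemma norm_finiteM_le (hz : ∀ x, (popuc a β (n + 1)).eval x = 0 → δ ≤ ‖z - x‖) :
    ‖finiteM a β n z‖ ≤ 1 / δ := by
  obtain ⟨s, r, hs, hr, hsum, hm⟩ := exists_partial_fractions ha hβ n
  rw [finiteM, hm z (eval_ne_zero_of_le_dist hδ hz)]
  exact norm_sum_div_sub_le hr hsum hδ fun x hx => hz x (hs x hx)

lemma norm_finiteM_sub_le (hz : ∀ x, (popuc a β (n + 1)).eval x = 0 → δ ≤ ‖z - x‖)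
    (hw : ∀ x, (popuc a β (n + 1)).eval x = 0 → δ ≤ ‖w - x‖) :
    ‖finiteM a β n z - finiteM a β n w‖ ≤ ‖z - w‖ / δ ^ 2 := by
  obtain ⟨s, r, hs, hr, hsum, hm⟩ := exists_partial_fractions ha hβ n
  rw [finiteM, finiteM, hm z (eval_ne_zero_of_le_dist hδ hz),
    hm w (eval_ne_zero_of_le_dist hδ hw)]
  exact norm_sum_div_sub_sub_le hr hsum hδ (fun x hx => hz x (hs x hx)) fun x hx => hw x (hs x hx)

end FiniteM

/-! ### The constant CMV operator -/

section BlockDiagonal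

variable {c : ℂ}

lemma rho_conj (c : ℂ) : rho (conj c) = rho c := by simp [rho]

lemma conj_rho (c : ℂ) : conj (rho c) = rho c := by simp [rho]

lemma rho_sq (hc : ‖c‖ ≤ 1) : rho c ^ 2 = 1 - c * conj c := by
  have : 0 ≤ 1 - ‖c‖ ^ 2 := by nlinarith [norm_nonneg c]
  rw [rho, ← Complex.ofReal_pow, Real.sq_sqrt this, Complex.mul_conj']
  push_cast; ring

/-- The direct sum of the blocks `(conj c, ρ; ρ, -c)` acting on sequences: the left factor of the
factorization of `𝒞(c)` into two block diagonal unitaries. -/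
noncomputable def blockSeq (c : ℂ) (y : ℕ → ℂ) (j : ℕ) : ℂ :=
  if Even j then conj c * y j + rho c * y (j + 1) else rho c * y (j - 1) - c * y j

/-- The direct sum of `1` and the blocks `(conj c, ρ; ρ, -c)` acting on sequences: the right
factor of the factorization of `𝒞(c)` into two block diagonal unitaries. -/
noncomputable def shiftedBlockSeq (c : ℂ) (y : ℕ → ℂ) : ℕ → ℂ
  | 0 => y 0
  | j + 1 => blockSeq c (fun n => y (n + 1)) j

lemma blockSeq_even (c : ℂ) (y : ℕ → ℂ) (k : ℕ) :
    blockSeq c y (2 * k) = conj c * y (2 * k) + rho c * y (2 * k + 1) := by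
  simp [blockSeq]

lemma blockSeq_odd (c : ℂ) (y : ℕ → ℂ) (k : ℕ) :
    blockSeq c y (2 * k + 1) = rho c * y (2 * k) - c * y (2 * k + 1) := by
  simp [blockSeq]

lemma blockSeq_sub (c : ℂ) (x y : ℕ → ℂ) : blockSeq c (x - y) = blockSeq c x - blockSeq c y := by
  ext j
  simp only [blockSeq, Pi.sub_apply]
  split_ifs <;> ring

lemma shiftedBlockSeq_zero (c : ℂ) (y : ℕ → ℂ) : shiftedBlockSeq c y 0 = y 0 := rfl

lemma shiftedBlockSeq_odd (c : ℂ) (y : ℕ → ℂ) (k : ℕ) :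
    shiftedBlockSeq c y (2 * k + 1) = conj c * y (2 * k + 1) + rho c * y (2 * k + 2) :=
  blockSeq_even c (fun n => y (n + 1)) k

lemma shiftedBlockSeq_even (c : ℂ) (y : ℕ → ℂ) (k : ℕ) :
    shiftedBlockSeq c y (2 * k + 2) = rho c * y (2 * k + 1) - c * y (2 * k + 2) :=
  blockSeq_odd c (fun n => y (n + 1)) k

lemma funext_even_odd {E : Type*} {f g : ℕ → E} (heven : ∀ k, f (2 * k) = g (2 * k))
    (hodd : ∀ k, f (2 * k + 1) = g (2 * k + 1)) : f = g := by
  ext j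
  rcases Nat.even_or_odd' j with ⟨k, rfl | rfl⟩
  exacts [heven k, hodd k]

lemma blockSeq_conj_blockSeq (hc : ‖c‖ ≤ 1) (y : ℕ → ℂ) :
    blockSeq (conj c) (blockSeq c y) = y := by
  have h := rho_sq hc
  refine funext_even_odd (fun k => ?_) fun k => ?_
  · rw [blockSeq_even, blockSeq_even, blockSeq_odd, rho_conj, Complex.conj_conj]
    linear_combination y (2 * k) * h
  · rw [blockSeq_odd, blockSeq_even, blockSeq_odd, rho_conj]
    linear_combination y (2 * k + 1) * h

lemma blockSeq_blockSeq_conj (hc : ‖c‖ ≤ 1) (y : ℕ → ℂ) :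
    blockSeq c (blockSeq (conj c) y) = y := by
  simpa using blockSeq_conj_blockSeq (c := conj c) (by simpa using hc) y

lemma shiftedBlockSeq_shiftedBlockSeq_conj (hc : ‖c‖ ≤ 1) (y : ℕ → ℂ) :
    shiftedBlockSeq c (shiftedBlockSeq (conj c) y) = y := by
  ext j
  cases j with
  | zero => rfl
  | succ j => exact congrFun (blockSeq_blockSeq_conj hc fun n => y (n + 1)) j

lemma norm_sq_block_add_norm_sq_block (hc : ‖c‖ ≤ 1) (u v : ℂ) :
    ‖conj c * u + rho c * v‖ ^ 2 + ‖rho c * u - c * v‖ ^ 2 = ‖u‖ ^ 2 + ‖v‖ ^ 2 := by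
  rw [← Complex.ofReal_inj]
  push_cast
  simp only [← Complex.mul_conj', map_add, map_sub, map_mul, Complex.conj_conj, conj_rho]
  linear_combination (u * conj u + v * conj v) * rho_sq hc

lemma hasSum_even_add_odd_iff {f : ℕ → ℝ} (hf : ∀ n, 0 ≤ f n) {S : ℝ} :
    HasSum (fun k => f (2 * k) + f (2 * k + 1)) S ↔ HasSum f S := by
  have hsum {S' : ℝ} (he : Summable fun k => f (2 * k)) (ho : Summable fun k => f (2 * k + 1)) :
      HasSum (fun k => f (2 * k) + f (2 * k + 1)) S' ↔ HasSum f S' := by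
    constructor <;> intro h
    · rw [h.unique (he.hasSum.add ho.hasSum)]
      exact he.hasSum.even_add_odd ho.hasSum
    · rw [h.unique (he.hasSum.even_add_odd ho.hasSum)]
      exact he.hasSum.add ho.hasSum
  constructor <;> intro h
  · refine (hsum ?_ ?_).mp h
    · exact h.summable.of_nonneg_of_le (fun k => hf _) fun k => by linarith [hf (2 * k + 1)]
    · exact h.summable.of_nonneg_of_le (fun k => hf _) fun k => by linarith [hf (2 * k)]
  · refine (hsum ?_ ?_).mpr h
    · exact h.summable.comp_injective (mul_right_injective₀ two_ne_zero)
    · exact h.summable.comp_injective fun a b hab => by simpa using hab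

lemma hasSum_norm_sq_blockSeq (hc : ‖c‖ ≤ 1) {y : ℕ → ℂ} {S : ℝ}
    (h : HasSum (fun n => ‖y n‖ ^ 2) S) : HasSum (fun n => ‖blockSeq c y n‖ ^ 2) S := by
  rw [← hasSum_even_add_odd_iff fun n => by positivity] at h ⊢
  simpa only [blockSeq_even, blockSeq_odd, norm_sq_block_add_norm_sq_block hc] using h

lemma hasSum_norm_sq_shiftedBlockSeq (hc : ‖c‖ ≤ 1) {y : ℕ → ℂ} {S : ℝ}
    (h : HasSum (fun n => ‖y n‖ ^ 2) S) : HasSum (fun n => ‖shiftedBlockSeq c y n‖ ^ 2) S := by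
  rw [← hasSum_nat_add_iff' 1] at h ⊢
  simpa [shiftedBlockSeq] using hasSum_norm_sq_blockSeq hc h

end BlockDiagonal

section Ell2

lemma hasSum_norm_sq (x : Ell2) : HasSum (fun n => ‖x n‖ ^ 2) (‖x‖ ^ 2) := by
  simpa using lp.hasSum_norm (p := 2) (by norm_num) x

lemma memℓp_two_of_hasSum {y : ℕ → ℂ} {S : ℝ} (h : HasSum (fun n => ‖y n‖ ^ 2) S) :
    Memℓp y 2 :=
  memℓp_gen (by simpa using h.summable)

lemma tendsto_coe_ell2_atTop_zero (x : Ell2) : Tendsto (fun n => x n) atTop (𝓝 0) := by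
  rw [tendsto_zero_iff_norm_tendsto_zero]
  simpa [Real.sqrt_sq] using (hasSum_norm_sq x).summable.tendsto_atTop_zero.sqrt

lemma inner_e0 (x : Ell2) : inner ℂ e0 x = x 0 := by
  rw [e0, lp.inner_single_left]
  simp

lemma e0_apply (n : ℕ) : e0 n = if n = 0 then 1 else 0 := by
  rw [e0, lp.single_apply]
  split_ifs with h
  · subst h; rfl
  · exact Pi.single_eq_of_ne h 1

lemma norm_e0 : ‖e0‖ = 1 := by
  rw [e0, lp.norm_single (by norm_num)]
  simp

end Ell2

section Factorization

variable {c : ℂ}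

lemma constCMV_apply_eq_sum (c : ℂ) (x : Ell2) (j : ℕ) :
    constCMV c x j = ∑ k ∈ Finset.range (j + 3), cmvEntry (fun _ => c) j k * x k := by
  rw [constCMV, cmv, ContinuousLinearMap.coeFn_ofSeqClosedGraph]
  rfl

lemma constCMV_apply_add_two (c : ℂ) (x : Ell2) (j : ℕ) : constCMV c x (j + 2)
    = ∑ d ∈ Finset.range 5, cmvEntry (fun _ => c) (j + 2) (j + d) * x (j + d) := by
  rw [constCMV_apply_eq_sum, show j + 2 + 3 = j + 5 by ring, Finset.sum_range_add,
    Finset.sum_eq_zero, zero_add]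
  intro k hk
  rw [cmvEntry_eq_zero (Or.inl (by have := Finset.mem_range.mp hk; omega)), zero_mul]

lemma coe_constCMV_apply (c : ℂ) (x : Ell2) :
    (constCMV c x : ℕ → ℂ) = blockSeq c (shiftedBlockSeq c x) := by
  have hs1 : shiftedBlockSeq c x 1 = _ := shiftedBlockSeq_odd c x 0
  refine funext_even_odd (fun k => ?_) fun k => ?_
  · rw [blockSeq_even]
    obtain - | k := k
    · simp [Finset.sum_range_succ, cmvEntry, prev, constCMV_apply_eq_sum, shiftedBlockSeq_zero, hs1]
      ring
    · have hk : Even (2 * k + 2) := ⟨k + 1, by ring⟩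
      have h1 : 2 * k ≠ 2 * k + 2 + 1 := by omega
      have h2 : 2 * k ≠ 2 * k + 2 + 2 := by omega
      rw [shiftedBlockSeq_odd, Nat.mul_succ, shiftedBlockSeq_even, constCMV_apply_add_two]
      simp [Finset.sum_range_succ, cmvEntry, prev, hk, mul_add, h1, h2]
      ring_nf
  · rw [blockSeq_odd]
    obtain - | k := k
    · simp [Finset.sum_range_succ, cmvEntry, prev, constCMV_apply_eq_sum, shiftedBlockSeq_zero, hs1]
      ring
    · have hk : ¬ Even (2 * k + 1 + 2) := by simp [parity_simps]
      rw [shiftedBlockSeq_odd, Nat.mul_succ, shiftedBlockSeq_even,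
        show 2 * k + 2 + 1 = 2 * k + 1 + 2 by ring, constCMV_apply_add_two]
      simp [Finset.sum_range_succ, cmvEntry, prev, hk, mul_add]
      ring_nf

lemma norm_constCMV_apply (hc : ‖c‖ ≤ 1) (x : Ell2) : ‖constCMV c x‖ = ‖x‖ := by
  have h := hasSum_norm_sq (constCMV c x)
  rw [coe_constCMV_apply] at h
  exact (sq_eq_sq₀ (norm_nonneg _) (norm_nonneg _)).mp <| h.unique <|
    hasSum_norm_sq_blockSeq hc (hasSum_norm_sq_shiftedBlockSeq hc (hasSum_norm_sq x))

lemma constCMV_surjective (hc : ‖c‖ ≤ 1) : Function.Surjective (constCMV c) := by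
  intro y
  have hc' : ‖conj c‖ ≤ 1 := by simpa using hc
  have h := hasSum_norm_sq_shiftedBlockSeq hc' (hasSum_norm_sq_blockSeq hc' (hasSum_norm_sq y))
  refine ⟨⟨_, memℓp_two_of_hasSum h⟩, lp.ext ?_⟩
  rw [coe_constCMV_apply, shiftedBlockSeq_shiftedBlockSeq_conj hc, blockSeq_blockSeq_conj hc]

lemma constCMV_mem_unitary (hc : ‖c‖ ≤ 1) : constCMV c ∈ unitary (Ell2 →L[ℂ] Ell2) := by
  let U : Ell2 ≃ₗᵢ[ℂ] Ell2 := LinearIsometryEquiv.ofSurjective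
    ⟨constCMV c, norm_constCMV_apply hc⟩ (constCMV_surjective hc)
  have hU : constCMV c = (Unitary.linearIsometryEquiv.symm U : unitary (Ell2 →L[ℂ] Ell2)) := by
    rw [Unitary.coe_symm_linearIsometryEquiv_apply]
    rfl
  exact hU ▸ SetLike.coe_mem _

lemma isStarNormal_constCMV (hc : ‖c‖ ≤ 1) : IsStarNormal (constCMV c) := by
  obtain ⟨hleft, hright⟩ := Unitary.mem_iff.mp (constCMV_mem_unitary hc)
  exact ⟨hleft.trans hright.symm⟩

lemma isUnit_sub_constCMV_of_norm_ne_one (hc : ‖c‖ ≤ 1) {z : ℂ} (hz : ‖z‖ ≠ 1) :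
    IsUnit (algebraMap ℂ (Ell2 →L[ℂ] Ell2) z - constCMV c) := by
  by_contra h
  have := spectrum.subset_circle_of_unitary (𝕜 := ℂ) (constCMV_mem_unitary hc)
    (show z ∈ spectrum ℂ (constCMV c) from h)
  exact hz (by simpa using this)

end Factorization

/-! ### The spectrum of the constant CMV operator off the arc -/

section NumericalRange

variable {c : ℂ}

lemma norm_sq_block_sub_block_ge (c p q r s : ℂ) :
    4 * ‖c‖ ^ 2 * (‖q‖ ^ 2 + ‖r‖ ^ 2)
      + 4 * ((rho c * c * conj r * s).re - (rho c * c * conj p * q).re)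
    ≤ ‖(c * q + rho c * r) - (rho c * p - c * q)‖ ^ 2
      + ‖(rho c * q - conj c * r) - (conj c * r + rho c * s)‖ ^ 2 := by
  obtain ⟨t, ht⟩ : ∃ t : ℝ, rho c = t := ⟨_, rfl⟩
  rw [ht]
  simp only [← Complex.normSq_eq_norm_sq, Complex.normSq_apply]
  simp only [Complex.mul_re, Complex.mul_im, Complex.add_re, Complex.add_im, Complex.sub_re,
    Complex.sub_im, Complex.conj_re, Complex.conj_im, Complex.ofReal_re, Complex.ofReal_im]
  nlinarith [sq_nonneg (t * (r.re - p.re)), sq_nonneg (t * (r.im - p.im)),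
    sq_nonneg (t * (q.re - s.re)), sq_nonneg (t * (q.im - s.im))]

-- The cross terms of the blocks telescope, and `x 0 = 0` removes the one at the left end (which
-- is why the truncated `2 * 0 - 1` is harmless).
lemma sum_norm_sq_blockSeq_sub_shiftedBlockSeq_ge {x : ℕ → ℂ} (hx : x 0 = 0) (K : ℕ) :
    4 * ‖c‖ ^ 2 * ∑ k ∈ Finset.range K, (‖x (2 * k)‖ ^ 2 + ‖x (2 * k + 1)‖ ^ 2)
      + 4 * (rho c * c * conj (x (2 * K - 1)) * x (2 * K)).re
    ≤ ∑ k ∈ Finset.range K, (‖(blockSeq (conj c) x - shiftedBlockSeq c x) (2 * k)‖ ^ 2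
      + ‖(blockSeq (conj c) x - shiftedBlockSeq c x) (2 * k + 1)‖ ^ 2) := by
  induction K with
  | zero => simp [hx]
  | succ K ih =>
    rw [Finset.sum_range_succ, Finset.sum_range_succ, mul_add]
    suffices h : 4 * ‖c‖ ^ 2 * (‖x (2 * K)‖ ^ 2 + ‖x (2 * K + 1)‖ ^ 2)
        + 4 * ((rho c * c * conj (x (2 * (K + 1) - 1)) * x (2 * (K + 1))).re
          - (rho c * c * conj (x (2 * K - 1)) * x (2 * K)).re)
        ≤ ‖(blockSeq (conj c) x - shiftedBlockSeq c x) (2 * K)‖ ^ 2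
          + ‖(blockSeq (conj c) x - shiftedBlockSeq c x) (2 * K + 1)‖ ^ 2 by linarith
    simp only [Pi.sub_apply, blockSeq_even, blockSeq_odd, shiftedBlockSeq_odd, rho_conj,
      Complex.conj_conj]
    obtain - | k := K
    · simpa [hx, shiftedBlockSeq_zero] using! norm_sq_block_sub_block_ge c 0 (x 0) (x 1) (x 2)
    · rw [show shiftedBlockSeq c x (2 * (k + 1)) = _ from shiftedBlockSeq_even c x k]
      exact norm_sq_block_sub_block_ge c (x (2 * k + 1)) (x (2 * (k + 1))) (x (2 * (k + 1) + 1))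
        (x (2 * (k + 1) + 2))

lemma hasSum_norm_sq_sub_constCMV (hc : ‖c‖ ≤ 1) (x : Ell2) :
    HasSum (fun n => ‖(blockSeq (conj c) x - shiftedBlockSeq c x) n‖ ^ 2)
      (‖x - constCMV c x‖ ^ 2) := by
  have h := hasSum_norm_sq_blockSeq (c := conj c) (by simpa using hc)
    (hasSum_norm_sq (x - constCMV c x))
  rwa [lp.coeFn_sub, blockSeq_sub, coe_constCMV_apply, blockSeq_conj_blockSeq hc] at h

lemma four_mul_norm_sq_le_norm_sub_constCMV_sq (hc : ‖c‖ ≤ 1) {x : Ell2} (hx : x 0 = 0) :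
    4 * ‖c‖ ^ 2 * ‖x‖ ^ 2 ≤ ‖x - constCMV c x‖ ^ 2 := by
  have hnorm := ((hasSum_even_add_odd_iff fun n => by positivity).mpr
    (hasSum_norm_sq x)).tendsto_sum_nat
  have hdiff := ((hasSum_even_add_odd_iff fun n => by positivity).mpr
    (hasSum_norm_sq_sub_constCMV hc x)).tendsto_sum_nat
  have hx0 := tendsto_coe_ell2_atTop_zero x
  have heven : Tendsto (fun k : ℕ => 2 * k) atTop atTop :=
    tendsto_id.const_mul_atTop' two_pos
  have hodd : Tendsto (fun k : ℕ => 2 * k - 1) atTop atTop :=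
    (tendsto_sub_atTop_nat 1).comp heven
  have hboundary : Tendsto (fun k : ℕ => (rho c * c * conj (x (2 * k - 1)) * x (2 * k)).re)
      atTop (𝓝 0) := by
    have := (Complex.continuous_re.tendsto _).comp
      ((((Complex.continuous_conj.tendsto 0).comp (hx0.comp hodd)).const_mul (rho c * c)).mul
        (hx0.comp heven))
    simpa only [mul_zero, Complex.zero_re] using! this
  have := le_of_tendsto_of_tendsto' ((hnorm.const_mul (4 * ‖c‖ ^ 2)).add (hboundary.const_mul 4))
    hdiff (sum_norm_sq_blockSeq_sub_shiftedBlockSeq_ge hx)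
  linarith

lemma re_inner_constCMV_le (hc : ‖c‖ ≤ 1) {x : Ell2} (hx : x 0 = 0) :
    (inner ℂ x (constCMV c x)).re ≤ (1 - 2 * ‖c‖ ^ 2) * ‖x‖ ^ 2 := by
  have hsub := norm_sub_sq (𝕜 := ℂ) x (constCMV c x)
  rw [norm_constCMV_apply hc] at hsub
  simp only [RCLike.re_to_complex] at hsub
  linarith [four_mul_norm_sq_le_norm_sub_constCMV_sq hc hx]

end NumericalRange

section NormalOperator

variable {𝕜 H : Type*} [RCLike 𝕜] [NormedAddCommGroup H] [InnerProductSpace 𝕜 H] [CompleteSpace H]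
  {T : H →L[𝕜] H} (hT : IsStarNormal T)
include hT

lemma isUnit_of_isStarNormal_of_norm_le {M : ℝ} (h : ∀ x, ‖x‖ ≤ M * ‖T x‖) : IsUnit T := by
  have hM : ∀ x, ‖x‖ ≤ (M.toNNReal : ℝ) * ‖T x‖ := fun x =>
    (h x).trans (mul_le_mul_of_nonneg_right (Real.le_coe_toNNReal M) (norm_nonneg _))
  rw [ContinuousLinearMap.isUnit_iff_bijective,
    ContinuousLinearMap.bijective_iff_dense_range_and_antilipschitz]
  refine ⟨?_, _, T.antilipschitz_of_bound hM⟩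
  rw [Submodule.topologicalClosure_eq_top_iff,
    ContinuousLinearMap.IsStarNormal.orthogonal_range hT, LinearMap.ker_eq_bot']
  intro x hx
  have := hM x
  rw [show T x = 0 from hx, norm_zero, mul_zero] at this
  exact norm_le_zero_iff.mp this

lemma isUnit_of_isStarNormal_of_coercive_on_orthogonal {v : H} (hv : ‖T v‖ = 1) {δ : ℝ} (hδ : 0 < δ)
    (h : ∀ y, inner 𝕜 (T v) y = 0 → δ * ‖y‖ ^ 2 ≤ RCLike.re (inner 𝕜 y (T y))) : IsUnit T := by
  set e := T v with he
  have hadj := ContinuousLinearMap.isStarNormal_iff_norm_eq_adjoint.mp hT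
  refine isUnit_of_isStarNormal_of_norm_le hT (M := (1 + ‖v‖ * ‖T‖) / δ + ‖v‖) fun x => ?_
  set ξ := inner 𝕜 e x
  set y := x - ξ • e
  have hξ : ‖ξ‖ ≤ ‖T x‖ * ‖v‖ := by
    rw [← norm_inner_symm, he, ← ContinuousLinearMap.adjoint_inner_left, hadj x]
    exact norm_inner_le_norm _ _
  have hy0 : inner 𝕜 e y = 0 := by
    rw [inner_sub_right, inner_smul_right, inner_self_eq_norm_sq_to_K, hv]
    simp [ξ]
  have hcoercive : δ * ‖y‖ ≤ ‖T y‖ := by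
    have := (h y hy0).trans ((RCLike.re_le_norm _).trans (norm_inner_le_norm _ _))
    rcases (norm_nonneg y).eq_or_lt with hy | hy
    · rw [← hy, mul_zero]; exact norm_nonneg _
    · nlinarith
  have hTy : ‖T y‖ ≤ ‖T x‖ + ‖ξ‖ * ‖T‖ := by
    rw [map_sub, map_smul]
    refine (norm_sub_le _ _).trans ?_
    rw [norm_smul]
    gcongr
    simpa [hv] using T.le_opNorm e
  have hy : ‖y‖ ≤ (‖T x‖ + ‖T x‖ * ‖v‖ * ‖T‖) / δ := by
    rw [le_div_iff₀ hδ]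
    have : ‖ξ‖ * ‖T‖ ≤ ‖T x‖ * ‖v‖ * ‖T‖ := by gcongr
    linarith
  calc ‖x‖ = ‖y + ξ • e‖ := by simp [y]
    _ ≤ ‖y‖ + ‖ξ • e‖ := norm_add_le _ _
    _ = ‖y‖ + ‖ξ‖ := by rw [norm_smul, hv, mul_one]
    _ ≤ (‖T x‖ + ‖T x‖ * ‖v‖ * ‖T‖) / δ + ‖T x‖ * ‖v‖ := by gcongr
    _ = _ := by field_simp

end NormalOperator

section Resolvent

variable {c z : ℂ}

lemma isStarNormal_algebraMap_sub {A : Type*} [Ring A] [StarRing A] [Algebra ℂ A]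
    [StarModule ℂ A] {u : A} (hu : IsStarNormal u) (z : ℂ) :
    IsStarNormal (algebraMap ℂ A z - u) := by
  refine ⟨?_⟩
  rw [star_sub, ← algebraMap_star_comm]
  exact (Algebra.commute_algebraMap_left _ _).sub_left
    ((Algebra.commute_algebraMap_right _ _).sub_right hu.1)

lemma isUnit_sub_constCMV_of_lt_re (hc : ‖c‖ ≤ 1) (hre : 1 - 2 * ‖c‖ ^ 2 < z.re) {v : Ell2}
    (hv : z • v - constCMV c v = e0) :
    IsUnit (algebraMap ℂ (Ell2 →L[ℂ] Ell2) z - constCMV c) := by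
  have hT (x : Ell2) :
      (algebraMap ℂ (Ell2 →L[ℂ] Ell2) z - constCMV c) x = z • x - constCMV c x := by
    simp [Algebra.algebraMap_eq_smul_one]
  refine isUnit_of_isStarNormal_of_coercive_on_orthogonal (v := v)
    (isStarNormal_algebraMap_sub (isStarNormal_constCMV hc) z)
    (by rw [hT, hv, norm_e0]) (sub_pos.mpr hre) fun y hy => ?_
  rw [hT, hv, inner_e0] at hy
  have hzy : inner ℂ y (z • y) = z * (‖y‖ ^ 2 : ℝ) := by
    rw [inner_smul_right, inner_self_eq_norm_sq_to_K]
    simp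
  rw [hT, inner_sub_right, hzy, RCLike.re_to_complex, Complex.sub_re, Complex.re_mul_ofReal]
  linarith [re_inner_constCMV_le hc hy]

lemma resolvent_constCMV_e0 (h : IsUnit (algebraMap ℂ (Ell2 →L[ℂ] Ell2) z - constCMV c))
    {v : Ell2} (hv : z • v - constCMV c v = e0) : resolvent (constCMV c) z e0 = v := by
  have h' := congrArg (fun T : Ell2 →L[ℂ] Ell2 => T v) (Ring.inverse_mul_cancel _ h)
  simpa [Algebra.algebraMap_eq_smul_one, hv, resolvent] using h'

lemma add_mul_inverse_sub_eq_one_sub_resolvent {A : Type*} [Ring A] [Algebra ℂ A] {u : A}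
    (h : IsUnit (algebraMap ℂ A z - u)) :
    (u + algebraMap ℂ A z) * Ring.inverse (u - algebraMap ℂ A z) = 1 - (2 * z) • resolvent u z := by
  have hinv : Ring.inverse (u - algebraMap ℂ A z) = -resolvent u z := by
    obtain ⟨w, hw⟩ := h
    rw [← neg_sub, resolvent, ← hw, ← Units.val_neg, Ring.inverse_unit, Ring.inverse_unit,
      inv_neg, Units.val_neg]
  calc (u + algebraMap ℂ A z) * Ring.inverse (u - algebraMap ℂ A z)
      = (algebraMap ℂ A z - u) * resolvent u z
        - (2 : ℂ) • (algebraMap ℂ A z * resolvent u z) := by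
        rw [hinv, two_smul]; noncomm_ring
    _ = 1 - (2 * z) • resolvent u z := by
        rw [resolvent, Ring.mul_inverse_cancel _ h, Algebra.algebraMap_eq_smul_one, smul_mul_assoc,
          one_mul, smul_smul]

lemma caraFun_eq_one_sub (h : IsUnit (algebraMap ℂ (Ell2 →L[ℂ] Ell2) z - constCMV c)) :
    caraFun c z = 1 - 2 * z * mFun c z := by
  rw [caraFun, mFun, ← mul_apply_eq_comp, add_mul_inverse_sub_eq_one_sub_resolvent h]
  simp only [sub_apply, one_apply_eq_self, smul_apply, inner_sub_right, inner_smul_right]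
  rw [inner_self_eq_norm_sq_to_K, norm_e0]
  simp

/-- The sequence `A, B, A l, B l, A l², B l², …`: the shape of `(z - 𝒞(c))⁻¹ e₀` after the right
block factor of `𝒞(c)` has been applied to it. -/
noncomputable def interleavedGeometric (A B l : ℂ) (n : ℕ) : ℂ :=
  (if Even n then A else B) * l ^ (n / 2)

lemma interleavedGeometric_even (A B l : ℂ) (k : ℕ) :
    interleavedGeometric A B l (2 * k) = A * l ^ k := by
  simp [interleavedGeometric]

lemma interleavedGeometric_odd (A B l : ℂ) (k : ℕ) :
    interleavedGeometric A B l (2 * k + 1) = B * l ^ k := by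
  simp [interleavedGeometric, show (2 * k + 1) / 2 = k by omega]

lemma hasSum_norm_sq_interleavedGeometric (A B : ℂ) {l : ℂ} (hl : ‖l‖ < 1) :
    HasSum (fun n => ‖interleavedGeometric A B l n‖ ^ 2)
      ((‖A‖ ^ 2 + ‖B‖ ^ 2) * (1 - ‖l‖ ^ 2)⁻¹) := by
  rw [← hasSum_even_add_odd_iff fun n => by positivity]
  have hl2 : ‖l‖ ^ 2 < 1 := by nlinarith [norm_nonneg l]
  have hterm (k : ℕ) : ‖interleavedGeometric A B l (2 * k)‖ ^ 2
      + ‖interleavedGeometric A B l (2 * k + 1)‖ ^ 2 = (‖A‖ ^ 2 + ‖B‖ ^ 2) * (‖l‖ ^ 2) ^ k := by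
    rw [interleavedGeometric_even, interleavedGeometric_odd, norm_mul, norm_mul, norm_pow]
    ring
  simpa only [hterm] using
    (hasSum_geometric_of_lt_one (by positivity) hl2).mul_left (‖A‖ ^ 2 + ‖B‖ ^ 2)

-- After applying the right block factor to `v`, the resolvent equation for `𝒞(c)` becomes a
-- two-periodic tridiagonal system, which has a geometric solution.
lemma exists_resolvent_vector (hc : ‖c‖ ≤ 1) {A B l : ℂ} (hl : ‖l‖ < 1)
    (h0 : (z - conj c) * A - rho c * B = 1) (h1 : c * (1 + z) * B = rho c * (1 - z * l) * A)
    (h2 : rho c * (z - l) * B = conj c * (1 + z) * l * A) :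
    ∃ v : Ell2, z • v - constCMV c v = e0 ∧ v 0 = A := by
  set w := interleavedGeometric A B l
  have heven (k : ℕ) : w (2 * k) = A * l ^ k := interleavedGeometric_even A B l k
  have hodd (k : ℕ) : w (2 * k + 1) = B * l ^ k := interleavedGeometric_odd A B l k
  have hw0 : w 0 = A := by simpa using heven 0
  obtain ⟨v, hv⟩ : ∃ v : Ell2, (v : ℕ → ℂ) = shiftedBlockSeq (conj c) w :=
    ⟨⟨_, memℓp_two_of_hasSum (hasSum_norm_sq_shiftedBlockSeq (c := conj c) (by simpa using hc)
      (hasSum_norm_sq_interleavedGeometric A B hl))⟩, rfl⟩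
  refine ⟨v, lp.ext ?_, by rw [hv, shiftedBlockSeq_zero, hw0]⟩
  rw [lp.coeFn_sub, lp.coeFn_smul, coe_constCMV_apply, hv, shiftedBlockSeq_shiftedBlockSeq_conj hc]
  refine funext_even_odd (fun k => ?_) fun k => ?_ <;>
    rw [Pi.sub_apply, Pi.smul_apply, smul_eq_mul, e0_apply]
  · rw [blockSeq_even, hodd, heven]
    obtain - | k := k
    · rw [mul_zero, shiftedBlockSeq_zero, hw0, if_pos rfl]
      linear_combination h0
    · rw [if_neg (by omega), show 2 * (k + 1) = 2 * k + 2 by ring, shiftedBlockSeq_even, rho_conj,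
        hodd, show 2 * k + 2 = 2 * (k + 1) by ring, heven]
      linear_combination l ^ k * h2
  · rw [blockSeq_odd, shiftedBlockSeq_odd, rho_conj, Complex.conj_conj, hodd, heven,
      show 2 * k + 2 = 2 * (k + 1) by ring, heven, if_neg (by omega)]
    linear_combination l ^ k * h1

lemma isUnit_sub_constCMV_and_mFun_eq (hc : ‖c‖ ≤ 1) {A B l : ℂ}
    (hz : ‖z‖ ≠ 1 ∨ 1 - 2 * ‖c‖ ^ 2 < z.re) (hl : ‖l‖ < 1)
    (h0 : (z - conj c) * A - rho c * B = 1) (h1 : c * (1 + z) * B = rho c * (1 - z * l) * A)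
    (h2 : rho c * (z - l) * B = conj c * (1 + z) * l * A) :
    IsUnit (algebraMap ℂ (Ell2 →L[ℂ] Ell2) z - constCMV c) ∧ mFun c z = A := by
  obtain ⟨v, hv, hv0⟩ := exists_resolvent_vector hc hl h0 h1 h2
  have hu : IsUnit (algebraMap ℂ (Ell2 →L[ℂ] Ell2) z - constCMV c) := by
    rcases hz with hz | hz
    · exact isUnit_sub_constCMV_of_norm_ne_one hc hz
    · exact isUnit_sub_constCMV_of_lt_re hc hz hv
  exact ⟨hu, by rw [mFun, resolvent_constCMV_e0 hu hv, inner_e0, hv0]⟩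

end Resolvent

/-! ### The arc `Γ_a` and the function `G_a` -/

section Arc

variable {a : ℝ} (ha0 : 0 ≤ a) (ha1 : a ≤ 1) {z : ℂ}

lemma add_one_ne_zero_of_notMem_arc (hz : z ∉ arc a) : z + 1 ≠ 0 :=
  fun h => hz (by rw [eq_neg_of_add_eq_zero_left h]; exact neg_one_mem_arc)

include ha0 ha1

lemma cos_two_mul_arcsin : Real.cos (2 * Real.arcsin a) = 1 - 2 * a ^ 2 := by
  rw [Real.cos_two_mul, Real.cos_sq', Real.sin_arcsin (by linarith) ha1]
  ring

lemma norm_eq_one_and_re_le_of_mem_arc (hz : z ∈ arc a) : ‖z‖ = 1 ∧ z.re ≤ 1 - 2 * a ^ 2 := by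
  obtain ⟨θ, hθ, hθ', rfl⟩ := hz
  have harcsin : 0 ≤ Real.arcsin a := Real.arcsin_nonneg.mpr ha0
  refine ⟨Complex.norm_exp_ofReal_mul_I θ, ?_⟩
  rw [Complex.exp_ofReal_mul_I_re, ← cos_two_mul_arcsin ha0 ha1]
  rcases le_total θ Real.pi with h | h
  · exact Real.cos_le_cos_of_nonneg_of_le_pi (by linarith) h hθ
  · rw [← Real.cos_two_pi_sub θ]
    exact Real.cos_le_cos_of_nonneg_of_le_pi (by linarith) (by linarith) (by linarith)

lemma mem_arc_of_re_le (hz : ‖z‖ = 1) (hre : z.re ≤ 1 - 2 * a ^ 2) : z ∈ arc a := by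
  have harcsin : 0 ≤ Real.arcsin a := Real.arcsin_nonneg.mpr ha0
  have harcsin' := Real.arcsin_le_pi_div_two a
  have hnorm : z.re ^ 2 + z.im ^ 2 = 1 := by
    have := Complex.normSq_apply z
    rw [Complex.normSq_eq_norm_sq, hz] at this
    linarith
  have hcos : Real.cos (Real.arccos z.re) = z.re :=
    Real.cos_arccos (by nlinarith) (by nlinarith)
  have hsin : Real.sin (Real.arccos z.re) = |z.im| := by
    rw [Real.sin_arccos, show 1 - z.re ^ 2 = z.im ^ 2 by linarith, Real.sqrt_sq_eq_abs]
  have hle : 2 * Real.arcsin a ≤ Real.arccos z.re := by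
    rw [← Real.arccos_cos (x := 2 * Real.arcsin a) (by linarith) (by linarith),
      cos_two_mul_arcsin ha0 ha1]
    exact Real.arccos_le_arccos hre
  have hpi := Real.arccos_le_pi z.re
  rcases abs_cases z.im with ⟨him, -⟩ | ⟨him, -⟩
  · refine ⟨Real.arccos z.re, hle, by linarith, Complex.ext ?_ ?_⟩
    · rw [Complex.exp_ofReal_mul_I_re, hcos]
    · rw [Complex.exp_ofReal_mul_I_im, hsin, him]
  · refine ⟨2 * Real.pi - Real.arccos z.re, by linarith, by linarith, Complex.ext ?_ ?_⟩
    · rw [Complex.exp_ofReal_mul_I_re, Real.cos_two_pi_sub, hcos]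
    · rw [Complex.exp_ofReal_mul_I_im, Real.sin_two_pi_sub, hsin, him, neg_neg]

lemma mem_arc_iff : z ∈ arc a ↔ ‖z‖ = 1 ∧ z.re ≤ 1 - 2 * a ^ 2 :=
  ⟨norm_eq_one_and_re_le_of_mem_arc ha0 ha1, fun h => mem_arc_of_re_le ha0 ha1 h.1 h.2⟩

lemma isClosed_arc : IsClosed (arc a) := by
  rw [show arc a = {z : ℂ | ‖z‖ = 1} ∩ {z : ℂ | z.re ≤ 1 - 2 * a ^ 2} from
    Set.ext fun z => mem_arc_iff ha0 ha1]
  exact (isClosed_eq continuous_norm continuous_const).inter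
    (isClosed_le Complex.continuous_re continuous_const)

lemma notMem_arc_of_norm_ne_one (hz : ‖z‖ ≠ 1) : z ∉ arc a :=
  fun h => hz ((mem_arc_iff ha0 ha1).mp h).1

lemma norm_ne_one_or_lt_re (hz : z ∉ arc a) : ‖z‖ ≠ 1 ∨ 1 - 2 * a ^ 2 < z.re := by
  rw [mem_arc_iff ha0 ha1, not_and, not_le] at hz
  exact or_iff_not_imp_left.mpr fun h => hz (not_not.mp h)

end Arc

section G

lemma re_sqrt_pos {w : ℂ} (hw : w ∈ Complex.slitPlane) : 0 < (Complex.sqrt w).re := by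
  have hpi := (Complex.arg_le_pi w).lt_of_ne (Complex.mem_slitPlane_iff_arg.mp hw).1
  have hneg := Complex.neg_pi_lt_arg w
  have him : (Complex.log w * 2⁻¹).im = Complex.arg w / 2 := by
    rw [show (2 : ℂ)⁻¹ = ((2⁻¹ : ℝ) : ℂ) by push_cast; rfl, Complex.im_mul_ofReal, Complex.log_im]
    ring
  rw [Complex.sqrt, Complex.cpow_def_of_ne_zero (Complex.slitPlane_ne_zero hw), Complex.exp_re, him]
  exact mul_pos (Real.exp_pos _) (Real.cos_pos_of_mem_Ioo ⟨by linarith, by linarith⟩)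

lemma conj_sqrt_conj {w : ℂ} (hw : w ∈ Complex.slitPlane) :
    conj (Complex.sqrt (conj w)) = Complex.sqrt w := by
  have := Complex.cpow_conj w 2⁻¹ (Complex.mem_slitPlane_iff_arg.mp hw).1
  rwa [map_inv₀, Complex.conj_ofNat, eq_comm] at this

lemma G_apply_zero (a : ℝ) : G a 0 = 1 := by
  rw [G, arcRoot_zero]; ring

lemma G_zero_of_norm_lt {z : ℂ} (hz : ‖z‖ < 1) : G 0 z = 1 := by
  rw [G, arcRoot_zero_of_norm_lt hz]; ring

lemma G_zero_of_one_lt_norm {z : ℂ} (hz : 1 < ‖z‖) : G 0 z = z := by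
  rw [G, arcRoot_zero_of_one_lt_norm hz]; ring

lemma G_one (z : ℂ) : G 1 z = z + 1 := by
  rw [G, arcRoot]
  by_cases h : z + 1 = 0
  · simp [h]
  · have : ((z - 1) ^ 2 + 4 * z * ((1 : ℝ) : ℂ) ^ 2) / (z + 1) ^ 2 = 1 := by
      rw [div_eq_one_iff_eq (pow_ne_zero 2 h)]; push_cast; ring
    rw [this, Complex.sqrt, Complex.one_cpow]
    ring

variable {a : ℝ} {z : ℂ}

lemma G_quadratic (hz : z ∉ arc a) :
    G a z ^ 2 - (z + 1) * G a z + z * (1 - (a : ℂ) ^ 2) = 0 := by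
  rw [G]
  linear_combination 1 / 4 * arcRoot_sq hz

lemma norm_G_sub_self_ne (ha : 0 < a) (ha1 : a < 1) (hz : ‖z‖ < 1) : ‖G a z - z‖ ≠ a := by
  intro hD
  have hq := G_quadratic (notMem_arc_of_norm_ne_one ha.le ha1.le hz.ne)
  set D := G a z - z
  have hmul : D * (D + z) = D + (a ^ 2 : ℝ) * z := by
    push_cast
    linear_combination hq
  have hnorm : ‖D‖ ^ 2 * (‖D + z‖ ^ 2) = ‖D + (a ^ 2 : ℝ) * z‖ ^ 2 := by
    rw [← mul_pow, ← norm_mul, hmul]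
  have hD2 : D.re * D.re + D.im * D.im = a ^ 2 := by
    rw [← Complex.normSq_apply, Complex.normSq_eq_norm_sq, hD]
  have hz2 : z.re * z.re + z.im * z.im < 1 := by
    rw [← Complex.normSq_apply, Complex.normSq_eq_norm_sq]
    nlinarith [norm_nonneg z]
  rw [hD] at hnorm
  simp only [← Complex.normSq_eq_norm_sq, Complex.normSq_apply, Complex.add_re, Complex.add_im,
    Complex.re_ofReal_mul, Complex.im_ofReal_mul] at hnorm
  have hzero : a ^ 2 * (1 - a ^ 2) * (1 - (z.re * z.re + z.im * z.im)) = 0 := by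
    linear_combination (-1 : ℝ) * hnorm - (1 - a ^ 2) * hD2
  have hpos : 0 < a ^ 2 * (1 - a ^ 2) * (1 - (z.re * z.re + z.im * z.im)) :=
    mul_pos (mul_pos (by positivity) (by nlinarith)) (by linarith)
  exact hpos.ne' hzero

variable (ha0 : 0 ≤ a) (ha1 : a ≤ 1)
include ha0 ha1

lemma continuousAt_G (hz : z ∉ arc a) : ContinuousAt (G a) z := by
  have : ContinuousAt (arcRoot a) z :=
    ((differentiableOn_arcRoot ha0 ha1).continuousOn z hz).continuousAt
      ((isClosed_arc ha0 ha1).isOpen_compl.mem_nhds hz)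
  unfold G
  fun_prop

lemma exists_G_eq (hz : z ∉ arc a) : ∃ s : ℂ, 0 < s.re ∧ G a z = 1 / 2 * (z + 1) * (1 + s) :=
  ⟨_, re_sqrt_pos (arcRoot_arg_mem_slitPlane ha0 ha1 hz), by rw [G, arcRoot]; ring⟩

lemma G_ne_zero (hz : z ∉ arc a) : G a z ≠ 0 := by
  obtain ⟨s, hs, h⟩ := exists_G_eq ha0 ha1 hz
  rw [h]
  refine mul_ne_zero (mul_ne_zero (by norm_num) (add_one_ne_zero_of_notMem_arc hz)) fun h0 => ?_
  rw [eq_neg_of_add_eq_zero_right h0, Complex.neg_re, Complex.one_re] at hs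
  linarith

-- `z + 1 - G_a(z)` is the second root of `G_quadratic`.
lemma norm_add_one_sub_G_div_G_lt_one (hz : z ∉ arc a) : ‖(z + 1 - G a z) / G a z‖ < 1 := by
  rw [norm_div, div_lt_one (norm_pos_iff.mpr (G_ne_zero ha0 ha1 hz))]
  obtain ⟨s, hs, h⟩ := exists_G_eq ha0 ha1 hz
  have hother : z + 1 - G a z = 1 / 2 * (z + 1) * (1 - s) := by rw [h]; ring
  have hne : 1 / 2 * (z + 1) ≠ 0 := mul_ne_zero (by norm_num) (add_one_ne_zero_of_notMem_arc hz)
  rw [hother, h, norm_mul, norm_mul (1 / 2 * (z + 1))]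
  refine mul_lt_mul_of_pos_left ?_ (norm_pos_iff.mpr hne)
  rw [← sq_lt_sq₀ (norm_nonneg _) (norm_nonneg _), ← Complex.normSq_eq_norm_sq,
    ← Complex.normSq_eq_norm_sq, Complex.normSq_apply, Complex.normSq_apply, Complex.sub_re,
    Complex.sub_im, Complex.add_re, Complex.add_im, Complex.one_re, Complex.one_im]
  linarith

lemma conj_G_inv_conj (hz : z ∉ arc a) (hz0 : z ≠ 0) : conj (G a (conj z)⁻¹) = G a z / z := by
  have hz1 : z + 1 ≠ 0 := add_one_ne_zero_of_notMem_arc hz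
  have hw := arcRoot_arg_mem_slitPlane ha0 ha1 hz
  set w := ((z - 1) ^ 2 + 4 * z * (a : ℂ) ^ 2) / (z + 1) ^ 2 with hwdef
  have hconj : (((conj z)⁻¹ - 1) ^ 2 + 4 * (conj z)⁻¹ * (a : ℂ) ^ 2) / ((conj z)⁻¹ + 1) ^ 2
      = conj w := by
    apply (starRingEnd ℂ).injective
    simp only [map_div₀, map_inv₀, map_add, map_pow, map_sub, map_mul, map_one, Complex.conj_ofReal,
      Complex.conj_conj, Complex.conj_ofNat, hwdef]
    have : z⁻¹ + 1 ≠ 0 := by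
      rw [inv_eq_one_div, div_add_one hz0, add_comm]
      exact div_ne_zero hz1 hz0
    rw [div_eq_div_iff (pow_ne_zero 2 this) (pow_ne_zero 2 hz1)]
    field_simp
    ring
  have hroot : arcRoot a z = (z + 1) * Complex.sqrt w := by rw [arcRoot, hwdef]
  rw [G, G, hroot, arcRoot, hconj]
  simp only [map_mul, map_add, map_div₀, map_inv₀, map_one, Complex.conj_conj, Complex.conj_ofNat,
    conj_sqrt_conj hw]
  clear_value w
  field_simp
  ring

lemma G_ne_self (hz : z ∉ arc a) (h : a ≠ 0 ∨ ‖z‖ < 1) : G a z ≠ z := by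
  intro hG
  have hq := G_quadratic hz
  rw [hG] at hq
  rcases mul_eq_zero.mp (show z * (a : ℂ) ^ 2 = 0 by linear_combination -hq) with hz0 | ha
  · rw [hz0, G_apply_zero] at hG
    exact one_ne_zero hG
  · obtain rfl : a = 0 := by simpa using ha
    have hlt := h.resolve_left (by simp)
    rw [G_zero_of_norm_lt hlt] at hG
    simp [← hG] at hlt

-- By connectedness of the disc: `|G_a(z) - z|` equals `1` at the origin and never equals `a`.
lemma le_norm_G_sub_self (hz : ‖z‖ < 1) : a ≤ ‖G a z - z‖ := by
  rcases ha0.eq_or_lt with rfl | hpos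
  · exact norm_nonneg _
  rcases ha1.eq_or_lt with rfl | hlt
  · simp [G_one]
  by_contra! hcon
  have hcont : ContinuousOn (fun w => ‖G a w - w‖) (Metric.ball 0 1) := fun w hw =>
    ((continuousAt_G ha0 ha1 (notMem_arc_of_norm_ne_one ha0 ha1
      (mem_ball_zero_iff.mp hw).ne)).sub continuousAt_id).norm.continuousWithinAt
  obtain ⟨w, hw, hwa⟩ := (convex_ball (0 : ℂ) 1).isPreconnected.intermediate_value
    (mem_ball_zero_iff.mpr hz) (Metric.mem_ball_self one_pos) hcont
    (show a ∈ Set.Icc _ _ from ⟨hcon.le, by simpa [G_apply_zero] using hlt.le⟩)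
  exact norm_G_sub_self_ne hpos hlt (mem_ball_zero_iff.mp hw) hwa

end G

/-! ### The resolvent functions of the constant CMV operator -/

section ConstantCoefficients

variable {c z : ℂ}

lemma norm_inv_conj_lt_one (hz : 1 < ‖z‖) : ‖(conj z)⁻¹‖ < 1 := by
  rw [norm_inv, RCLike.norm_conj]
  exact inv_lt_one_of_one_lt₀ hz

lemma G_norm_quadratic (hz : z ∉ arc ‖c‖) :
    G ‖c‖ z ^ 2 - (z + 1) * G ‖c‖ z + z * (1 - c * conj c) = 0 := by
  simpa only [Complex.mul_conj'] using G_quadratic hz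

section

variable (hc : ‖c‖ ≤ 1)
include hc

lemma isUnit_sub_constCMV_and_mFun_eq_div (hz : z ∉ arc ‖c‖) (hD : z * (1 + c) - G ‖c‖ z ≠ 0) :
    IsUnit (algebraMap ℂ (Ell2 →L[ℂ] Ell2) z - constCMV c) ∧
      mFun c z = c / (z * (1 + c) - G ‖c‖ z) := by
  have hG := G_ne_zero (norm_nonneg c) hc hz
  have hl := norm_add_one_sub_G_div_G_lt_one (norm_nonneg c) hc hz
  have hq := G_norm_quadratic hz
  have hr := rho_sq hc
  set g := G ‖c‖ z
  refine isUnit_sub_constCMV_and_mFun_eq hc (norm_ne_one_or_lt_re (norm_nonneg c) hc hz) hl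
    (B := rho c * (g - z) / (g * (z * (1 + c) - g))) ?_ ?_ ?_
  · field_simp
    linear_combination hq - (g - z) * hr
  · field_simp
    ring
  · field_simp
    linear_combination (z + 1) * hq + (z + 1) * (g - 1) * (g - z) * hr

-- The form of `m_c` whose denominator is under control outside the disc.
lemma mFun_eq_G_sub_one_div (hz : z ∉ arc ‖c‖) (hz0 : z ≠ 0) (hE : G ‖c‖ z - 1 - conj c ≠ 0) :
    mFun c z = (G ‖c‖ z - 1) / (z * (G ‖c‖ z - 1 - conj c)) := by
  have hG := G_ne_zero (norm_nonneg c) hc hz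
  have hl := norm_add_one_sub_G_div_G_lt_one (norm_nonneg c) hc hz
  have hq := G_norm_quadratic hz
  have hr := rho_sq hc
  set g := G ‖c‖ z
  refine (isUnit_sub_constCMV_and_mFun_eq hc (norm_ne_one_or_lt_re (norm_nonneg c) hc hz) hl
    (B := conj c * rho c / (g * (g - 1 - conj c))) ?_ ?_ ?_).2
  · field_simp
    linear_combination -conj c * hq - conj c * z * hr
  · field_simp
    linear_combination - (1 + z) * rho c * hq
  · field_simp
    linear_combination conj c * (1 + z) * (g - 1) * (hq + z * hr)

lemma mul_one_add_sub_G_ne_zero (hz : ‖z‖ < 1) : z * (1 + c) - G ‖c‖ z ≠ 0 := by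
  have hle := le_norm_G_sub_self (norm_nonneg c) hc hz
  have hpos := norm_pos_iff.mpr <| sub_ne_zero.mpr <| G_ne_self (norm_nonneg c) hc
    (notMem_arc_of_norm_ne_one (norm_nonneg c) hc hz.ne) (Or.inr hz)
  intro h
  rw [show G ‖c‖ z - z = z * c by linear_combination -h, norm_mul] at hle hpos
  nlinarith [norm_nonneg c, norm_nonneg z]

-- The reflection of the previous lemma in the unit circle.
lemma G_sub_one_sub_conj_ne_zero (hz : 1 < ‖z‖) : G ‖c‖ z - 1 - conj c ≠ 0 := by
  have hz0 : z ≠ 0 := norm_pos_iff.mp (by linarith)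
  have hreflect := conj_G_inv_conj (norm_nonneg c) hc
    (notMem_arc_of_norm_ne_one (norm_nonneg c) hc hz.ne') hz0
  intro h
  refine mul_one_add_sub_G_ne_zero hc (norm_inv_conj_lt_one hz) ((starRingEnd ℂ).injective ?_)
  rw [map_sub, hreflect, map_zero, map_mul, map_inv₀, Complex.conj_conj, map_add, map_one]
  field_simp
  linear_combination -h

end

/-- The explicit form of the Schur function `f_c` off the arc `Γ_{|c|}`. -/
noncomputable def constSchur (c z : ℂ) : ℂ := c / (G ‖c‖ z - z)

-- The fixed-point equation of the Schur algorithm, cleared of denominators.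
lemma constSchur_mul_eq (hz : z ∉ arc ‖c‖) (hG : G ‖c‖ z ≠ z) :
    constSchur c z * (1 + conj c * (z * constSchur c z)) = c + z * constSchur c z := by
  have hsub : G ‖c‖ z - z ≠ 0 := sub_ne_zero.mpr hG
  rw [constSchur]
  field_simp
  linear_combination -c * G_norm_quadratic hz

lemma norm_constSchur_le_one (hc : ‖c‖ ≤ 1) (hz : ‖z‖ < 1) : ‖constSchur c z‖ ≤ 1 := by
  rw [constSchur, norm_div]
  exact div_le_one_of_le₀ (le_norm_G_sub_self (norm_nonneg c) hc hz) (norm_nonneg _)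

lemma schur_quotient_eq_constSchur (hc : ‖c‖ ≤ 1) (hz : z ∉ arc ‖c‖) (hz0 : z ≠ 0)
    (hD : z * (1 + c) - G ‖c‖ z ≠ 0) (hG : G ‖c‖ z ≠ z) :
    1 / z * ((caraFun c z - 1) / (caraFun c z + 1)) = constSchur c z := by
  obtain ⟨hu, hm⟩ := isUnit_sub_constCMV_and_mFun_eq_div hc hz hD
  have hsub : G ‖c‖ z - z ≠ 0 := sub_ne_zero.mpr hG
  have hadd : 1 - 2 * z * (c / (z * (1 + c) - G ‖c‖ z)) + 1
      = -2 * (G ‖c‖ z - z) / (z * (1 + c) - G ‖c‖ z) := by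
    field_simp
    ring
  rw [caraFun_eq_one_sub hu, hm, hadd, constSchur]
  field_simp
  ring

lemma eq_of_mul_one_add_sub_G_eq_zero (hc : ‖c‖ ≤ 1) (hc0 : c ≠ 0) (hz : z ∉ arc ‖c‖)
    (hz0 : z ≠ 0) (hD : z * (1 + c) - G ‖c‖ z = 0) : z = (1 + conj c) / (1 + c) := by
  have hq := G_norm_quadratic hz
  have hG : G ‖c‖ z = z * (1 + c) := (sub_eq_zero.mp hD).symm
  rw [hG] at hq
  have hc1 : 1 + c ≠ 0 := fun h => G_ne_zero (norm_nonneg c) hc hz (by rw [hG, h, mul_zero])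
  have := (mul_eq_zero.mp (show z * c * (z * (1 + c) - (1 + conj c)) = 0 by
    linear_combination hq)).resolve_left (mul_ne_zero hz0 hc0)
  rw [eq_div_iff hc1]
  linear_combination this

lemma eventually_schur_quotient_eq_constSchur (hc : ‖c‖ ≤ 1) (hz : z ∉ arc ‖c‖)
    (h : c ≠ 0 ∨ ‖z‖ < 1) : ∀ᶠ w in 𝓝[≠] z,
      1 / w * ((caraFun c w - 1) / (caraFun c w + 1)) = constSchur c w := by
  have harc : ∀ᶠ w in 𝓝[≠] z, w ∉ arc ‖c‖ :=
    nhdsWithin_le_nhds ((isClosed_arc (norm_nonneg c) hc).isOpen_compl.mem_nhds hz)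
  have hne (x : ℂ) : ∀ᶠ w in 𝓝[≠] z, w ≠ x := by
    rcases eq_or_ne x z with rfl | hx
    · exact self_mem_nhdsWithin
    · exact nhdsWithin_le_nhds (isOpen_ne.mem_nhds hx.symm)
  have hor : ∀ᶠ w in 𝓝[≠] z, c ≠ 0 ∨ ‖w‖ < 1 := by
    rcases h with h | h
    · exact Eventually.of_forall fun _ => Or.inl h
    · filter_upwards [nhdsWithin_le_nhds ((continuous_norm.tendsto z).eventually_lt_const h)]
        with w hw using Or.inr hw
  filter_upwards [harc, hne 0, hne ((1 + conj c) / (1 + c)), hor] with w hw hw0 hw1 hor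
  refine schur_quotient_eq_constSchur hc hw hw0 ?_
    (G_ne_self (norm_nonneg c) hc hw (hor.imp_left norm_ne_zero_iff.mpr))
  rcases hor with hc0 | hlt
  · exact fun hD => hw1 (eq_of_mul_one_add_sub_G_eq_zero hc hc0 hw hw0 hD)
  · exact mul_one_add_sub_G_ne_zero hc hlt

lemma schurFun_eq_constSchur (hc : ‖c‖ ≤ 1) (hz : z ∉ arc ‖c‖) (h : c ≠ 0 ∨ ‖z‖ < 1) :
    schurFun c z = constSchur c z := by
  have hsub : G ‖c‖ z - z ≠ 0 :=
    sub_ne_zero.mpr (G_ne_self (norm_nonneg c) hc hz (h.imp_left norm_ne_zero_iff.mpr))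
  have hcont : Tendsto (constSchur c) (𝓝 z) (𝓝 (constSchur c z)) :=
    tendsto_const_nhds.div ((continuousAt_G (norm_nonneg c) hc hz).sub continuousAt_id) hsub
  exact Tendsto.limUnder_eq ((hcont.mono_left nhdsWithin_le_nhds).congr'
    ((eventually_schur_quotient_eq_constSchur hc hz h).mono fun _ hw => hw.symm))

end ConstantCoefficients

/-! ### The Schur algorithm run backwards -/

section SchurStep

/-- The backward step `u ↦ (c + u) / (1 + c̄ u)` of the Schur algorithm, an automorphism of the
disc when `|c| < 1`. -/
noncomputable def schurStep (c u : ℂ) : ℂ := (c + u) / (1 + conj c * u)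

/-- The square of `sinh` of half the hyperbolic distance in the unit disc. This function of the
distance suffices here, since contraction is needed without the triangle inequality. -/
noncomputable def sinhSqDist (u v : ℂ) : ℝ := ‖u - v‖ ^ 2 / ((1 - ‖u‖ ^ 2) * (1 - ‖v‖ ^ 2))

variable {c u v z : ℂ} {r : ℝ}

lemma one_add_conj_mul_ne_zero (hc : ‖c‖ ≤ 1) (hu : ‖u‖ < 1) : 1 + conj c * u ≠ 0 := by
  intro h
  have hnorm : ‖conj c * u‖ = 1 := by
    rw [eq_neg_of_add_eq_zero_right h, norm_neg, norm_one]
  rw [norm_mul, RCLike.norm_conj] at hnorm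
  nlinarith [norm_nonneg u]

lemma continuousAt_schurStep (hc : ‖c‖ ≤ 1) (hu : ‖u‖ < 1) :
    ContinuousAt (fun p : ℂ × ℂ => schurStep p.1 p.2) (c, u) := by
  have hne := one_add_conj_mul_ne_zero hc hu
  unfold schurStep
  fun_prop (disch := exact hne)

lemma one_sub_norm_schurStep_sq (h : 1 + conj c * u ≠ 0) :
    1 - ‖schurStep c u‖ ^ 2 = (1 - ‖c‖ ^ 2) * (1 - ‖u‖ ^ 2) / ‖1 + conj c * u‖ ^ 2 := by
  have hid := norm_sub_mul_sq_sub_norm_sub_conj_mul_sq (-conj c) u 1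
  simp only [neg_mul, sub_neg_eq_add, map_neg, Complex.conj_conj, mul_one, norm_one, norm_neg,
    RCLike.norm_conj, one_pow] at hid
  rw [schurStep, norm_div, div_pow, one_sub_div (pow_ne_zero 2 (norm_ne_zero_iff.mpr h)),
    add_comm c u, hid]

lemma norm_schurStep_lt_one (hc : ‖c‖ < 1) (hu : ‖u‖ < 1) : ‖schurStep c u‖ < 1 := by
  have hne := norm_pos_iff.mpr (one_add_conj_mul_ne_zero hc.le hu)
  have hpos : 0 < 1 - ‖schurStep c u‖ ^ 2 := by
    rw [one_sub_norm_schurStep_sq (norm_pos_iff.mp hne)]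
    exact div_pos (mul_pos (one_sub_norm_sq_pos hc) (one_sub_norm_sq_pos hu)) (by positivity)
  exact (sq_lt_one_iff₀ (norm_nonneg _)).mp (by linarith)

lemma schurStep_sub_schurStep (hu : 1 + conj c * u ≠ 0) (hv : 1 + conj c * v ≠ 0) :
    schurStep c u - schurStep c v
      = (1 - ‖c‖ ^ 2 : ℝ) * (u - v) / ((1 + conj c * u) * (1 + conj c * v)) := by
  push_cast
  rw [schurStep, schurStep, ← Complex.mul_conj', div_sub_div _ _ hu hv]
  ring

lemma sinhSqDist_schurStep (hc : ‖c‖ < 1) (hu : ‖u‖ < 1) (hv : ‖v‖ < 1) :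
    sinhSqDist (schurStep c u) (schurStep c v) = sinhSqDist u v := by
  have hu' := one_add_conj_mul_ne_zero hc.le hu
  have hv' := one_add_conj_mul_ne_zero hc.le hv
  have hpos := one_sub_norm_sq_pos hc
  have hcu := norm_ne_zero_iff.mpr hu'
  have hcv := norm_ne_zero_iff.mpr hv'
  rw [sinhSqDist, sinhSqDist, one_sub_norm_schurStep_sq hu', one_sub_norm_schurStep_sq hv',
    schurStep_sub_schurStep hu' hv', norm_div, norm_mul, norm_mul, Complex.norm_real,
    Real.norm_of_nonneg hpos.le]
  generalize ‖1 + conj c * u‖ = p at hcu ⊢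
  generalize ‖1 + conj c * v‖ = q at hcv ⊢
  field_simp

lemma sq_norm_sub_le_sinhSqDist (hu : ‖u‖ < 1) (hv : ‖v‖ < 1) :
    ‖u - v‖ ^ 2 ≤ sinhSqDist u v := by
  have hu' := one_sub_norm_sq_pos hu
  have hv' := one_sub_norm_sq_pos hv
  refine le_div_self (sq_nonneg _) (mul_pos hu' hv') ?_
  exact mul_le_one₀ (by linarith [sq_nonneg ‖u‖]) hv'.le (by linarith [sq_nonneg ‖v‖])

lemma norm_mul_lt_one (hz : ‖z‖ < 1) (hu : ‖u‖ ≤ 1) : ‖z * u‖ < 1 := by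
  rw [norm_mul]
  exact (mul_le_of_le_one_right (norm_nonneg z) hu).trans_lt hz

lemma one_sub_sq_le_one_sub_norm_mul_sq (hz : ‖z‖ ≤ r) (hu : ‖u‖ ≤ 1) :
    1 - r ^ 2 ≤ 1 - ‖z * u‖ ^ 2 := by
  have hle : ‖z * u‖ ≤ r := by
    rw [norm_mul]
    exact (mul_le_of_le_one_right (norm_nonneg z) hu).trans hz
  gcongr

lemma sinhSqDist_mul_le (hr : r < 1) (hz : ‖z‖ ≤ r) (hu : ‖u‖ < 1) (hv : ‖v‖ < 1) :
    sinhSqDist (z * u) (z * v) ≤ r ^ 2 * sinhSqDist u v := by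
  have hu' := one_sub_norm_sq_pos hu
  have hv' := one_sub_norm_sq_pos hv
  have hle : ∀ w : ℂ, 1 - ‖w‖ ^ 2 ≤ 1 - ‖z * w‖ ^ 2 := fun w => by
    rw [norm_mul]
    gcongr
    exact mul_le_of_le_one_left (norm_nonneg w) (hz.trans hr.le)
  rw [sinhSqDist, sinhSqDist, ← mul_sub, norm_mul, mul_pow, ← mul_div_assoc]
  gcongr ?_ ^ 2 * _ / ?_
  exact mul_le_mul (hle u) (hle v) hv'.le (hu'.le.trans (hle u))

lemma sinhSqDist_mul_le_of_norm_le_one (hr : r < 1) (hz : ‖z‖ ≤ r) (hu : ‖u‖ ≤ 1)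
    (hv : ‖v‖ ≤ 1) : sinhSqDist (z * u) (z * v) ≤ 4 / (1 - r ^ 2) ^ 2 := by
  have hr0 : 0 < 1 - r ^ 2 := by nlinarith [(norm_nonneg z).trans hz]
  have hu' := one_sub_sq_le_one_sub_norm_mul_sq hz hu
  have hv' := one_sub_sq_le_one_sub_norm_mul_sq hz hv
  have hzu := norm_mul_lt_one (hz.trans_lt hr) hu
  have hzv := norm_mul_lt_one (hz.trans_lt hr) hv
  have hsub : ‖z * u - z * v‖ ≤ 2 := (norm_sub_le _ _).trans (by linarith)
  have hzu0 := one_sub_norm_sq_pos hzu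
  rw [sinhSqDist, sq (1 - r ^ 2)]
  gcongr
  nlinarith [norm_nonneg (z * u - z * v)]

section Orbit

variable {s : ℕ → ℂ} {x y : ℕ → ℂ} (hs : ∀ i, ‖s i‖ < 1) (hr : r < 1) (hz : ‖z‖ ≤ r)
include hs hr hz

lemma norm_le_one_of_schurStep_orbit (hx₀ : ‖x 0‖ ≤ 1)
    (hx : ∀ i, x (i + 1) = schurStep (s i) (z * x i)) (i : ℕ) : ‖x i‖ ≤ 1 := by
  induction i with
  | zero => exact hx₀
  | succ i ih =>
    rw [hx]
    exact (norm_schurStep_lt_one (hs i) (norm_mul_lt_one (hz.trans_lt hr) ih)).le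

lemma sinhSqDist_schurStep_orbit_le (hx₀ : ‖x 0‖ ≤ 1) (hy₀ : ‖y 0‖ ≤ 1)
    (hx : ∀ i, x (i + 1) = schurStep (s i) (z * x i))
    (hy : ∀ i, y (i + 1) = schurStep (s i) (z * y i)) (k : ℕ) :
    sinhSqDist (z * x k) (z * y k) ≤ (r ^ 2) ^ k * (4 / (1 - r ^ 2) ^ 2) := by
  have hz1 := hz.trans_lt hr
  have hbound := norm_le_one_of_schurStep_orbit hs hr hz hx₀ hx
  have hbound' := norm_le_one_of_schurStep_orbit hs hr hz hy₀ hy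
  induction k with
  | zero => simpa only [pow_zero, one_mul] using sinhSqDist_mul_le_of_norm_le_one hr hz hx₀ hy₀
  | succ k ih =>
    have hxk := norm_mul_lt_one hz1 (hbound k)
    have hyk := norm_mul_lt_one hz1 (hbound' k)
    calc sinhSqDist (z * x (k + 1)) (z * y (k + 1))
        = sinhSqDist (z * schurStep (s k) (z * x k)) (z * schurStep (s k) (z * y k)) := by
          rw [hx, hy]
      _ ≤ r ^ 2 * sinhSqDist (z * x k) (z * y k) := by
          rw [← sinhSqDist_schurStep (hs k) hxk hyk]
          exact sinhSqDist_mul_le hr hz (norm_schurStep_lt_one (hs k) hxk)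
            (norm_schurStep_lt_one (hs k) hyk)
      _ ≤ (r ^ 2) ^ (k + 1) * (4 / (1 - r ^ 2) ^ 2) := by
          rw [pow_succ' (r ^ 2), mul_assoc]
          exact mul_le_mul_of_nonneg_left ih (sq_nonneg r)

lemma sq_norm_sub_schurStep_orbit_le (hx₀ : ‖x 0‖ ≤ 1) (hy₀ : ‖y 0‖ ≤ 1)
    (hx : ∀ i, x (i + 1) = schurStep (s i) (z * x i))
    (hy : ∀ i, y (i + 1) = schurStep (s i) (z * y i)) (k : ℕ) :
    ‖x (k + 1) - y (k + 1)‖ ^ 2 ≤ (r ^ 2) ^ k * (4 / (1 - r ^ 2) ^ 2) := by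
  have hz1 := hz.trans_lt hr
  have hxk := norm_mul_lt_one hz1 (norm_le_one_of_schurStep_orbit hs hr hz hx₀ hx k)
  have hyk := norm_mul_lt_one hz1 (norm_le_one_of_schurStep_orbit hs hr hz hy₀ hy k)
  rw [hx, hy]
  calc ‖schurStep (s k) (z * x k) - schurStep (s k) (z * y k)‖ ^ 2
      ≤ sinhSqDist (schurStep (s k) (z * x k)) (schurStep (s k) (z * y k)) :=
        sq_norm_sub_le_sinhSqDist (norm_schurStep_lt_one (hs k) hxk)
          (norm_schurStep_lt_one (hs k) hyk)
    _ = sinhSqDist (z * x k) (z * y k) := sinhSqDist_schurStep (hs k) hxk hyk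
    _ ≤ _ := sinhSqDist_schurStep_orbit_le hs hr hz hx₀ hy₀ hx hy k

end Orbit

/-- The orbit of `f` under the backward Schur algorithm at `z` with parameters `s`, with which the
quotients `Φ_n / Φ_n^*` are compared. -/
noncomputable def schurOrbit (s : ℕ → ℂ) (z f : ℂ) : ℕ → ℂ
  | 0 => f
  | i + 1 => schurStep (s i) (z * schurOrbit s z f i)

lemma tendsto_schurOrbit {ι : Type*} {l : Filter ι} {s : ι → ℕ → ℂ} {y : ι → ℂ} {f : ℂ}
    (hc : ‖c‖ ≤ 1) (hz : ‖z‖ < 1) (hf : ‖f‖ ≤ 1) (hfix : schurStep c (z * f) = f)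
    (hs : ∀ i, Tendsto (fun p => s p i) l (𝓝 c)) (hy : Tendsto y l (𝓝 z)) (i : ℕ) :
    Tendsto (fun p => schurOrbit (s p) (y p) f i) l (𝓝 f) := by
  induction i with
  | zero => exact tendsto_const_nhds
  | succ i ih =>
    have hstep := (continuousAt_schurStep hc (norm_mul_lt_one hz hf)).tendsto.comp
      ((hs i).prodMk_nhds (hy.mul ih))
    rwa [hfix] at hstep

-- The orbit of `f` has the same parameters as `x`, so the contraction brings the two together,
-- while it stays near `f` because the parameters are nearly `c`.
lemma tendsto_of_schurStep_orbit {ι : Type*} {l : Filter ι} {w y : ι → ℂ} {f : ℂ}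
    (hc : ‖c‖ ≤ 1) (hz : ‖z‖ < 1) (hf : ‖f‖ ≤ 1) (hfix : schurStep c (z * f) = f)
    (hy : Tendsto y l (𝓝 z))
    (hw : ∀ k, ∃ s x : ι → ℕ → ℂ, (∀ i, Tendsto (fun p => s p i) l (𝓝 c)) ∧
      ∀ᶠ p in l, (∀ i, ‖s p i‖ < 1) ∧ ‖x p 0‖ ≤ 1 ∧
        (∀ i, x p (i + 1) = schurStep (s p i) (y p * x p i)) ∧ x p k = w p) :
    Tendsto w l (𝓝 f) := by
  obtain ⟨r, hzr, hr⟩ := exists_between hz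
  have hr0 : 0 ≤ r := (norm_nonneg z).trans hzr.le
  have hpow : Tendsto (fun k => (r ^ 2) ^ k * (4 / (1 - r ^ 2) ^ 2)) atTop (𝓝 0) := by
    simpa only [zero_mul] using (tendsto_pow_atTop_nhds_zero_of_lt_one (sq_nonneg r)
      (pow_lt_one₀ hr0 hr two_ne_zero)).mul_const (4 / (1 - r ^ 2) ^ 2)
  rw [Metric.tendsto_nhds]
  intro ε hε
  obtain ⟨k, hk⟩ := (hpow.eventually_lt_const (by positivity : 0 < (ε / 2) ^ 2)).exists
  obtain ⟨s, x, hs, hx⟩ := hw (k + 1)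
  have horbit := Metric.tendsto_nhds.mp (tendsto_schurOrbit hc hz hf hfix hs hy (k + 1)) (ε / 2)
    (half_pos hε)
  filter_upwards [hx, horbit, hy.norm.eventually_lt_const hzr] with p ⟨hsp, hx₀, hxs, hxw⟩ hop hyp
  have hclose : ‖x p (k + 1) - schurOrbit (s p) (y p) f (k + 1)‖ < ε / 2 :=
    lt_of_pow_lt_pow_left₀ 2 (half_pos hε).le ((sq_norm_sub_schurStep_orbit_le hsp hr hyp.le hx₀ hf
      hxs (y := schurOrbit (s p) (y p) f) (fun _ => rfl) k).trans_lt hk)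
  rw [hxw, ← dist_eq_norm] at hclose
  linarith [dist_triangle (w p) (schurOrbit (s p) (y p) f (k + 1)) f]

end SchurStep

/-! ### Convergence of `Φ_n / Φ_n^*` in the disc -/

section InverseSchurIterate

/-- The inverse Schur iterate `Φ_n / Φ_n^*`. -/
noncomputable def invSchurIterate (a : ℕ → ℂ) (n : ℕ) (z : ℂ) : ℂ :=
  (opuc a n).eval z / (opucStar a n).eval z

section

variable {a : ℕ → ℂ} {z : ℂ} (ha : ∀ n, ‖a n‖ < 1) (n : ℕ) (hz : ‖z‖ ≤ 1)
include ha hz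

lemma norm_invSchurIterate_le_one : ‖invSchurIterate a n z‖ ≤ 1 := by
  rw [invSchurIterate, norm_div]
  exact div_le_one_of_le₀ (norm_opuc_le ha n hz) (norm_nonneg _)

lemma invSchurIterate_succ :
    invSchurIterate a (n + 1) z = schurStep (-conj (a n)) (z * invSchurIterate a n z) := by
  have hstar := opucStar_ne_zero ha n hz
  rw [invSchurIterate, invSchurIterate, schurStep, eval_opuc_succ, eval_opucStar_succ,
    map_neg, Complex.conj_conj, ← div_div_div_cancel_right₀ hstar]
  congr 1 <;> field_simp <;> ring

end

lemma schurStep_constSchur {c z : ℂ} (hc : ‖c‖ ≤ 1) (hz : ‖z‖ < 1) :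
    schurStep c (z * constSchur c z) = constSchur c z := by
  have harc := notMem_arc_of_norm_ne_one (norm_nonneg c) hc hz.ne
  have hne := one_add_conj_mul_ne_zero hc (norm_mul_lt_one hz (norm_constSchur_le_one hc hz))
  rw [schurStep, div_eq_iff hne]
  exact (constSchur_mul_eq harc (G_ne_self (norm_nonneg c) hc harc (.inr hz))).symm

variable {t : ℝ} {α : ℕ → ℕ → ℂ} {α₀ : ℂ} {n N : ℕ → ℕ}

lemma RatioSeq.sub_const (h : RatioSeq t n N) (k : ℕ) : RatioSeq t (fun j => n j - k) N := by
  obtain ⟨hn, hN, hratio⟩ := h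
  refine ⟨(tendsto_sub_atTop_nat k).comp hn, hN, ?_⟩
  have hk : Tendsto (fun j => (k : ℝ) / N j) atTop (𝓝 0) :=
    tendsto_const_nhds.div_atTop (tendsto_natCast_atTop_atTop.comp hN)
  have hsub := hratio.sub hk
  rw [sub_zero] at hsub
  refine hsub.congr' ?_
  filter_upwards [hn.eventually_ge_atTop k] with j hj
  rw [Nat.cast_sub hj, sub_div]

lemma RatioSeq.add_const (h : RatioSeq t n N) (k : ℕ) : RatioSeq t (fun j => n j + k) N := by
  obtain ⟨hn, hN, hratio⟩ := h
  refine ⟨(tendsto_add_atTop_nat k).comp hn, hN, ?_⟩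
  have hk : Tendsto (fun j => (k : ℝ) / N j) atTop (𝓝 0) :=
    tendsto_const_nhds.div_atTop (tendsto_natCast_atTop_atTop.comp hN)
  have hadd := hratio.add hk
  rw [add_zero] at hadd
  refine hadd.congr fun j => ?_
  rw [Nat.cast_add, add_div]

lemma tendsto_neg_conj_coeffs (hlim : RatioTendsto t α α₀) (h : RatioSeq t n N) :
    Tendsto (fun j => -conj (coeffs α (N j) (n j))) atTop (𝓝 (-conj α₀)) :=
  ((Complex.continuous_conj.tendsto α₀).comp (hlim n N h)).neg

lemma tendsto_invSchurIterate (hα : ∀ n N, ‖α n N‖ < 1) (hα₀ : ‖α₀‖ ≤ 1)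
    (hlim : RatioTendsto t α α₀) (h : RatioSeq t n N) {z : ℂ} (hz : ‖z‖ < 1) :
    Tendsto (fun p : ℕ × ℂ => invSchurIterate (coeffs α (N p.1)) (n p.1) p.2) (atTop ×ˢ 𝓝 z)
      (𝓝 (constSchur (-conj α₀) z)) := by
  have hc : ‖-conj α₀‖ ≤ 1 := by rwa [norm_neg, RCLike.norm_conj]
  have hy : Tendsto (fun p : ℕ × ℂ => p.2) (atTop ×ˢ 𝓝 z) (𝓝 z) := tendsto_snd
  refine tendsto_of_schurStep_orbit hc hz (norm_constSchur_le_one hc hz)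
    (schurStep_constSchur hc hz) hy fun k => ?_
  refine ⟨fun p i => -conj (coeffs α (N p.1) (n p.1 - k + i)),
    fun p i => invSchurIterate (coeffs α (N p.1)) (n p.1 - k + i) p.2, fun i =>
    (tendsto_neg_conj_coeffs hlim ((h.sub_const k).add_const i)).comp tendsto_fst, ?_⟩
  filter_upwards [tendsto_fst.eventually (h.1.eventually_ge_atTop k),
    hy.norm.eventually_lt_const hz] with p hk hp
  have ha : ∀ i, ‖coeffs α (N p.1) i‖ < 1 := fun i => hα i (N p.1)
  refine ⟨fun i => ?_, norm_invSchurIterate_le_one ha _ hp.le, fun i => ?_, ?_⟩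
  · rw [norm_neg, RCLike.norm_conj]
    exact ha _
  · exact invSchurIterate_succ ha _ hp.le
  · rw [Nat.sub_add_cancel hk]

end InverseSchurIterate

/-! ### Joint limits -/

section JointLimits

variable {ι X Y : Type*} {l : Filter ι}

lemma eventually_forall_of_isCompact [TopologicalSpace X] {P : ι → X → Prop} {K : Set X}
    (hK : IsCompact K) (h : ∀ z ∈ K, ∀ᶠ p : ι × X in l ×ˢ 𝓝 z, P p.1 p.2) :
    ∀ᶠ j in l, ∀ z ∈ K, P j z :=
  Eventually.mono (Eventually.curry (hK.mem_prod_nhdsSet_of_forall h)) fun _ hj z hz =>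
    hj.self_of_nhdsSet z hz

lemma continuousOn_of_tendsto_prod_nhdsWithin [TopologicalSpace X] [TopologicalSpace Y]
    [RegularSpace Y] [l.NeBot] {F : ι → X → Y} {g : X → Y} {K : Set X}
    (h : ∀ z ∈ K, Tendsto (fun p : ι × X => F p.1 p.2) (l ×ˢ 𝓝[K] z) (𝓝 (g z))) :
    ContinuousOn g K := by
  intro z hz
  refine (closed_nhds_basis (g z)).tendsto_right_iff.mpr fun V ⟨hV, hVclosed⟩ => ?_
  obtain ⟨p, hp, q, hq, hpq⟩ := eventually_prod_iff.mp ((h z hz).eventually hV)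
  filter_upwards [hq, self_mem_nhdsWithin] with w hw hwK
  have hFw : Tendsto (fun j => F j w) l (𝓝 (g w)) := (h w hwK).comp <|
    tendsto_id.prodMk (tendsto_const_pure.mono_right (pure_le_nhdsWithin hwK))
  exact hVclosed.mem_of_tendsto hFw (hp.mono fun j hj => hpq hj hw)

lemma tendstoUniformlyOn_of_tendsto_prod_nhdsWithin [TopologicalSpace X] [UniformSpace Y]
    [l.NeBot] {F : ι → X → Y} {g : X → Y} {K : Set X} (hK : IsCompact K)
    (h : ∀ z ∈ K, Tendsto (fun p : ι × X => F p.1 p.2) (l ×ˢ 𝓝[K] z) (𝓝 (g z))) :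
    TendstoUniformlyOn F g l K := by
  refine (tendstoLocallyUniformlyOn_iff_tendstoUniformlyOn_of_compact hK).mp <|
    tendstoLocallyUniformlyOn_iff_forall_tendsto.mpr fun z hz => ?_
  have hg := (continuousOn_of_tendsto_prod_nhdsWithin h z hz).tendsto.comp
    (tendsto_snd (f := l))
  exact (hg.prodMk_nhds (h z hz)).mono_right (nhds_le_uniformity (g z))

lemma tendsto_prod_nhds_of_lipschitzOnWith [PseudoMetricSpace X] [PseudoMetricSpace Y]
    {F : ι → X → Y} {g : X → Y} {x : X} {y : Y} {s : Set X} {L : NNReal} (hs : s ∈ 𝓝 x)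
    (hL : ∀ᶠ j in l, LipschitzOnWith L (F j) s) {k : Filter X} [k.NeBot] (hk : k ≤ 𝓝 x)
    (hF : ∀ᶠ w in k, Tendsto (fun j => F j w) l (𝓝 (g w))) (hg : Tendsto g k (𝓝 y)) :
    Tendsto (fun p : ι × X => F p.1 p.2) (l ×ˢ 𝓝 x) (𝓝 y) := by
  rw [Metric.tendsto_nhds]
  intro ε hε
  have hnear : ∀ᶠ w in 𝓝 x, L * dist w x < ε / 4 := by
    have hcont : Continuous fun w => L * dist w x := by fun_prop
    exact hcont.continuousAt.eventually_lt_const (by simpa using hε)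
  obtain ⟨w, hFw, hgw, hws, hwx⟩ := (hF.and <| (Metric.tendsto_nhds.mp hg (ε / 4)
    (by positivity)).and <| hk (Filter.inter_mem hs hnear)).exists
  have hj := hL.and (Metric.tendsto_nhds.mp hFw (ε / 4) (by positivity))
  refine eventually_prod_iff.mpr ⟨_, hj, _, Filter.inter_mem hs hnear, ?_⟩
  rintro j ⟨hLj, hFj⟩ z ⟨hzs, hzx⟩
  have hzw : dist (F j z) (F j w) ≤ L * (dist z x + dist w x) :=
    (hLj.dist_le_mul z hzs w hws).trans (by gcongr; exact dist_triangle_right z w x)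
  have hzx' : L * dist z x < ε / 4 := hzx
  have hwx' : L * dist w x < ε / 4 := hwx
  linarith [dist_triangle4 (F j z) (F j w) (g w) y]

end JointLimits

lemma ratioTendstoOnCompacts_of_tendsto_prod_nhds {t : ℝ} {P Q : ℕ → ℕ → ℂ[X]} {g : ℂ → ℂ}
    {S : Set ℂ} (h : ∀ n N : ℕ → ℕ, RatioSeq t n N → ∀ z ∈ S,
      (∀ᶠ p : ℕ × ℂ in atTop ×ˢ 𝓝 z, (Q (n p.1) (N p.1)).eval p.2 ≠ 0) ∧
      Tendsto (fun p : ℕ × ℂ => (P (n p.1) (N p.1)).eval p.2 / (Q (n p.1) (N p.1)).eval p.2)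
        (atTop ×ˢ 𝓝 z) (𝓝 (g z))) :
    RatioTendstoOnCompacts t P Q g S := fun n N hnN _ hKS hK =>
  ⟨eventually_forall_of_isCompact hK fun z hz => (h n N hnN z (hKS hz)).1,
    tendstoUniformlyOn_of_tendsto_prod_nhdsWithin hK fun z hz =>
      (h n N hnN z (hKS hz)).2.mono_left (Filter.prod_mono_right _ nhdsWithin_le_nhds)⟩

/-! ### Points without nearby zeros -/

section Gap

/-- The zeros of `Φ_{n_j, N_j}^{(β)}` eventually keep a positive distance from `ξ`, as they do for
every `ξ` outside `Λ_{β,t}`. -/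
def HasGap (α : ℕ → ℕ → ℂ) (β : ℂ) (n N : ℕ → ℕ) (ξ : ℂ) : Prop :=
  ∃ δ > 0, ∀ᶠ j in atTop, ∀ x, (popuc (coeffs α (N j)) β (n j)).eval x = 0 → δ ≤ ‖ξ - x‖

variable {α : ℕ → ℕ → ℂ} {β : ℂ} {t : ℝ} {n N : ℕ → ℕ} {ξ : ℂ}

lemma HasGap.exists_ball (h : HasGap α β n N ξ) :
    ∃ δ > 0, ∀ᶠ j in atTop, ∀ z ∈ Metric.ball ξ δ, ∀ x,
      (popuc (coeffs α (N j)) β (n j)).eval x = 0 → δ ≤ ‖z - x‖ := by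
  obtain ⟨δ, hδ, h⟩ := h
  refine ⟨δ / 2, half_pos hδ, h.mono fun j hj z hz x hx => ?_⟩
  have hξx := hj x hx
  rw [Metric.mem_ball'] at hz
  rw [← dist_eq_norm] at hξx ⊢
  linarith [dist_triangle ξ z x]

lemma HasGap.eventually_nhds (h : HasGap α β n N ξ) : ∀ᶠ z in 𝓝 ξ, HasGap α β n N z := by
  obtain ⟨δ, hδ, h⟩ := h.exists_ball
  filter_upwards [Metric.ball_mem_nhds ξ hδ] with z hz
  exact ⟨δ, hδ, h.mono fun j hj => hj z hz⟩

lemma HasGap.eventually_popuc_ne_zero (h : HasGap α β n N ξ) :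
    ∀ᶠ p : ℕ × ℂ in atTop ×ˢ 𝓝 ξ, (popuc (coeffs α (N p.1)) β (n p.1)).eval p.2 ≠ 0 := by
  obtain ⟨δ, hδ, h⟩ := h.exists_ball
  exact eventually_prod_iff.mpr ⟨_, h, _, Metric.ball_mem_nhds ξ hδ, fun hj _ hz =>
    eval_ne_zero_of_le_dist hδ (hj _ hz)⟩

lemma hasGap_of_notMem_limitZeros (hα : ∀ n N, ‖α n N‖ < 1) (hβ : ‖β‖ = 1)
    (hnN : RatioSeq t n N) (h : ξ ∉ limitZeros α t β) : HasGap α β n N ξ := by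
  have hcircle : ∀ j x, (popuc (coeffs α (N j)) β (n j)).eval x = 0 → ‖x‖ = 1 := fun j _ =>
    norm_eq_one_of_popuc_eq_zero (fun k => hα k (N j)) (n j) hβ
  by_cases hξ : ‖ξ‖ = 1
  · have hliminf : liminf (fun j => Metric.infEDist ξ (popucZeros α β (n j) (N j))) atTop ≠ 0 :=
      fun h0 => h ⟨hξ, n, N, hnN, h0⟩
    obtain ⟨c, hc0, hc⟩ := exists_between (pos_iff_ne_zero.mpr hliminf)
    refine ⟨c.toReal, ENNReal.toReal_pos hc0.ne' (ne_top_of_lt hc), ?_⟩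
    filter_upwards [eventually_lt_of_lt_liminf hc] with j hj x hx
    have hcx : c ≤ edist ξ x := hj.le.trans (Metric.infEDist_le_edist_of_mem ⟨hcircle j x hx, hx⟩)
    rw [edist_dist] at hcx
    exact dist_eq_norm ξ x ▸ ENNReal.toReal_le_of_le_ofReal dist_nonneg hcx
  · refine ⟨|‖ξ‖ - 1|, abs_pos.mpr (sub_ne_zero.mpr hξ), Eventually.of_forall fun j x hx => ?_⟩
    exact hcircle j x hx ▸ abs_norm_sub_norm_le ξ x

end Gap

/-! ### Limits off the unit circle -/

section FiniteMFormulas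

variable {a : ℕ → ℂ} {β : ℂ} {n : ℕ} {z : ℂ}

lemma finiteM_eq_of_opucStar_ne_zero (h : (opucStar a n).eval z ≠ 0) :
    finiteM a β n z = invSchurIterate a n z / (z * invSchurIterate a n z - conj β) := by
  have hdenom : z * invSchurIterate a n z - conj β
      = (popuc a β (n + 1)).eval z / (opucStar a n).eval z := by
    rw [invSchurIterate, eval_popuc_succ]
    field_simp
  rw [hdenom, invSchurIterate, finiteM, div_div_div_cancel_right₀ h]

lemma finiteM_eq_of_opuc_ne_zero (h : (opuc a n).eval z ≠ 0) :
    finiteM a β n z = 1 / (z - conj β * ((opucStar a n).eval z / (opuc a n).eval z)) := by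
  have hdenom : z - conj β * ((opucStar a n).eval z / (opuc a n).eval z)
      = (popuc a β (n + 1)).eval z / (opuc a n).eval z := by
    rw [eval_popuc_succ]
    field_simp
  rw [hdenom, one_div_div, finiteM]

lemma opucStar_div_opuc_eq (hz : z ≠ 0) :
    (opucStar a n).eval z / (opuc a n).eval z = conj (invSchurIterate a n (conj z)⁻¹) := by
  rw [eval_opuc a n hz, eval_opucStar a n hz, invSchurIterate, map_div₀,
    mul_div_mul_left _ _ (pow_ne_zero n hz)]

end FiniteMFormulas

section LimitM

variable {c β z : ℂ}

lemma norm_mul_of_norm_eq_one (hβ : ‖β‖ = 1) : ‖c * β‖ = ‖c‖ := by rw [norm_mul, hβ, mul_one]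

lemma norm_neg_conj_mul (hβ : ‖β‖ = 1) : ‖-conj c * β‖ = ‖c‖ := by
  rw [norm_mul_of_norm_eq_one hβ, norm_neg, RCLike.norm_conj]

lemma conj_constSchur_inv_conj (hc : ‖c‖ ≤ 1) (hz : z ∉ arc ‖c‖) (hz0 : z ≠ 0) :
    conj (constSchur c (conj z)⁻¹) = conj c * z / (G ‖c‖ z - 1) := by
  rw [constSchur, map_div₀, map_sub, conj_G_inv_conj (norm_nonneg c) hc hz hz0, map_inv₀,
    Complex.conj_conj, div_eq_mul_inv (G ‖c‖ z), ← sub_one_mul, ← div_eq_mul_inv,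
    div_div_eq_mul_div]

lemma G_ne_one (hc : ‖c‖ ≤ 1) (hz : 1 < ‖z‖) : G ‖c‖ z ≠ 1 := by
  have hz0 : z ≠ 0 := norm_pos_iff.mp (zero_lt_one.trans hz)
  have hw := norm_inv_conj_lt_one hz
  have hne := G_ne_self (norm_nonneg c) hc
    (notMem_arc_of_norm_ne_one (norm_nonneg c) hc hw.ne) (.inr hw)
  intro hG
  have hrefl := conj_G_inv_conj (norm_nonneg c) hc
    (notMem_arc_of_norm_ne_one (norm_nonneg c) hc hz.ne') hz0
  rw [hG, one_div, ← Complex.conj_conj z⁻¹, map_inv₀] at hrefl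
  exact hne (RingHom.injective _ hrefl)

/-- The limit of `Φ_n / Φ_{n+1}^{(β)}`, where `c = -ᾱβ`. The two formulas agree wherever both
denominators are nonzero. -/
noncomputable def limitM (c z : ℂ) : ℂ :=
  if ‖z‖ ≤ 1 then c / (z * (1 + c) - G ‖c‖ z)
  else (G ‖c‖ z - 1) / (z * (G ‖c‖ z - 1 - conj c))

lemma limitM_of_norm_le_one (hz : ‖z‖ ≤ 1) : limitM c z = c / (z * (1 + c) - G ‖c‖ z) :=
  if_pos hz

lemma limitM_of_one_lt_norm (hz : 1 < ‖z‖) :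
    limitM c z = (G ‖c‖ z - 1) / (z * (G ‖c‖ z - 1 - conj c)) :=
  if_neg hz.not_ge

lemma mul_constSchur_sub_conj_ne_zero (hc : ‖c‖ ≤ 1) (hβ : ‖β‖ = 1) (hz : ‖z‖ < 1) :
    z * constSchur c z - conj β ≠ 0 := by
  have hlt := norm_mul_lt_one hz (norm_constSchur_le_one hc hz)
  exact sub_ne_zero.mpr fun h => hlt.ne (by rw [h, RCLike.norm_conj, hβ])

lemma limitM_eq_constSchur_div (hc : ‖c‖ ≤ 1) (hβ : ‖β‖ = 1) (hz : ‖z‖ < 1) :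
    limitM (c * β) z = constSchur c z / (z * constSchur c z - conj β) := by
  have hnorm : ‖c * β‖ = ‖c‖ := norm_mul_of_norm_eq_one hβ
  have hD := mul_one_add_sub_G_ne_zero (hnorm.trans_le hc) hz
  rw [hnorm] at hD
  have hne := mul_constSchur_sub_conj_ne_zero hc hβ hz
  have hG := sub_ne_zero.mpr (G_ne_self (norm_nonneg c) hc
    (notMem_arc_of_norm_ne_one (norm_nonneg c) hc hz.ne) (.inr hz))
  rw [limitM_of_norm_le_one hz.le, hnorm, div_eq_div_iff hD hne, constSchur]
  field_simp
  linear_combination -c * (G ‖c‖ z - z) * mul_conj_of_norm_eq_one hβ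

lemma sub_conj_mul_div_eq (hz : 1 < ‖z‖) (hc : ‖c‖ ≤ 1) :
    z - conj β * (conj c * z / (G ‖c‖ z - 1))
      = z * (G ‖c‖ z - 1 - conj (c * β)) / (G ‖c‖ z - 1) := by
  have hG := sub_ne_zero.mpr (G_ne_one hc hz)
  rw [map_mul]
  field_simp

lemma limitM_eq_one_div (hc : ‖c‖ ≤ 1) (hβ : ‖β‖ = 1) (hz : 1 < ‖z‖) :
    limitM (c * β) z = 1 / (z - conj β * (conj c * z / (G ‖c‖ z - 1))) := by
  rw [sub_conj_mul_div_eq hz hc, one_div_div, limitM_of_one_lt_norm hz, norm_mul_of_norm_eq_one hβ]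

lemma sub_conj_mul_div_ne_zero (hc : ‖c‖ ≤ 1) (hβ : ‖β‖ = 1) (hz : 1 < ‖z‖) :
    z - conj β * (conj c * z / (G ‖c‖ z - 1)) ≠ 0 := by
  have hnorm : ‖c * β‖ = ‖c‖ := norm_mul_of_norm_eq_one hβ
  have hE := G_sub_one_sub_conj_ne_zero (hnorm.trans_le hc) hz
  rw [hnorm] at hE
  rw [sub_conj_mul_div_eq hz hc]
  exact div_ne_zero (mul_ne_zero (norm_pos_iff.mp (zero_lt_one.trans hz)) hE)
    (sub_ne_zero.mpr (G_ne_one hc hz))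

end LimitM

section OffCircle

variable {t : ℝ} {α : ℕ → ℕ → ℂ} {α₀ β : ℂ} {n N : ℕ → ℕ} {z : ℂ} (hα : ∀ n N, ‖α n N‖ < 1)
  (hα₀ : ‖α₀‖ ≤ 1) (hlim : RatioTendsto t α α₀) (h : RatioSeq t n N) (hβ : ‖β‖ = 1)
include hα hα₀ hlim h

lemma tendsto_opucStar_div_opuc_of_one_lt_norm (hz : 1 < ‖z‖) :
    Tendsto (fun p : ℕ × ℂ => (opucStar (coeffs α (N p.1)) (n p.1)).eval p.2
      / (opuc (coeffs α (N p.1)) (n p.1)).eval p.2) (atTop ×ˢ 𝓝 z)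
      (𝓝 (conj (constSchur (-conj α₀) (conj z)⁻¹))) := by
  have hz0 : z ≠ 0 := norm_pos_iff.mp (zero_lt_one.trans hz)
  have hreflect : Tendsto (fun w : ℂ => (conj w)⁻¹) (𝓝 z) (𝓝 (conj z)⁻¹) :=
    (Complex.continuous_conj.tendsto z).inv₀ ((_root_.map_ne_zero _).mpr hz0)
  have hinside := (tendsto_invSchurIterate hα hα₀ hlim h (norm_inv_conj_lt_one hz)).comp
    (tendsto_id.prodMap hreflect)
  refine ((Complex.continuous_conj.tendsto _).comp hinside).congr' ?_
  filter_upwards [tendsto_snd.eventually_ne hz0] with p hp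
  exact (opucStar_div_opuc_eq hp).symm

include hβ

lemma tendsto_finiteM_of_norm_lt_one (hz : ‖z‖ < 1) :
    Tendsto (fun p : ℕ × ℂ => finiteM (coeffs α (N p.1)) β (n p.1) p.2) (atTop ×ˢ 𝓝 z)
      (𝓝 (limitM (-conj α₀ * β) z)) := by
  have hc : ‖-conj α₀‖ ≤ 1 := by rwa [norm_neg, RCLike.norm_conj]
  have hf := tendsto_invSchurIterate hα hα₀ hlim h hz
  have hsnd : Tendsto (fun p : ℕ × ℂ => p.2) ((atTop : Filter ℕ) ×ˢ 𝓝 z) (𝓝 z) := tendsto_snd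
  rw [limitM_eq_constSchur_div hc hβ hz]
  refine (hf.div ((hsnd.mul hf).sub_const (conj β))
    (mul_constSchur_sub_conj_ne_zero hc hβ hz)).congr' ?_
  filter_upwards [hsnd.norm.eventually_lt_const hz] with p hp
  exact (finiteM_eq_of_opucStar_ne_zero
    (opucStar_ne_zero (fun k => hα k (N p.1)) (n p.1) hp.le)).symm

lemma tendsto_finiteM_of_one_lt_norm (hz : 1 < ‖z‖) :
    Tendsto (fun p : ℕ × ℂ => finiteM (coeffs α (N p.1)) β (n p.1) p.2) (atTop ×ˢ 𝓝 z)
      (𝓝 (limitM (-conj α₀ * β) z)) := by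
  have hc : ‖-conj α₀‖ ≤ 1 := by rwa [norm_neg, RCLike.norm_conj]
  have hratio := tendsto_opucStar_div_opuc_of_one_lt_norm hα hα₀ hlim h hz
  rw [conj_constSchur_inv_conj hc (notMem_arc_of_norm_ne_one (norm_nonneg _) hc hz.ne')
    (norm_pos_iff.mp (zero_lt_one.trans hz))] at hratio
  have hsnd : Tendsto (fun p : ℕ × ℂ => p.2) ((atTop : Filter ℕ) ×ˢ 𝓝 z) (𝓝 z) := tendsto_snd
  rw [limitM_eq_one_div hc hβ hz]
  refine (tendsto_const_nhds.div (hsnd.sub (hratio.const_mul (conj β)))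
    (sub_conj_mul_div_ne_zero hc hβ hz)).congr' ?_
  filter_upwards [hsnd.norm.eventually_const_lt hz] with p hp
  exact (finiteM_eq_of_opuc_ne_zero
    (opuc_ne_zero (fun k => hα k (N p.1)) (n p.1) hp.le)).symm

end OffCircle

/-! ### Limits on the unit circle -/

lemma nhdsWithin_ball_neBot {ξ : ℂ} (hξ : ‖ξ‖ = 1) : (𝓝[Metric.ball 0 1] ξ).NeBot := by
  rw [← mem_closure_iff_nhdsWithin_neBot, closure_ball 0 one_ne_zero]
  simp [hξ]

lemma one_sub_norm_sq_eq {u : ℂ} (hu : u ≠ 1) :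
    1 - ‖u‖ ^ 2 = 2 * ‖u - 1‖ ^ 2 * (1 / 2 - (u / (u - 1)).re) := by
  have hN := (Complex.normSq_pos.mpr (sub_ne_zero.mpr hu)).ne'
  rw [Complex.div_re, ← add_div, ← Complex.normSq_eq_norm_sq, ← Complex.normSq_eq_norm_sq]
  field_simp
  simp only [Complex.normSq_apply, Complex.sub_re, Complex.sub_im, Complex.one_re, Complex.one_im]
  ring

lemma one_sub_norm_sq_le {u : ℂ} (hu : u ≠ 1) (hu1 : ‖u‖ ≤ 1) {ε : ℝ}
    (h : |(u / (u - 1)).re - 1 / 2| ≤ ε) : 1 - ‖u‖ ^ 2 ≤ 8 * ε := by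
  have hnorm : ‖u - 1‖ ≤ 2 := (norm_sub_le u 1).trans (by rw [norm_one]; linarith)
  have hε : 0 ≤ ε := (abs_nonneg _).trans h
  calc 1 - ‖u‖ ^ 2 = 2 * ‖u - 1‖ ^ 2 * (1 / 2 - (u / (u - 1)).re) := one_sub_norm_sq_eq hu
    _ ≤ 2 * ‖u - 1‖ ^ 2 * ε := by gcongr; linarith [(abs_le.mp h).1]
    _ ≤ 2 * 2 ^ 2 * ε := by gcongr
    _ = 8 * ε := by ring

section LimitMBounds

variable {c β w : ℂ} (hc : ‖c‖ ≤ 1) (hw : ‖w‖ < 1)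
include hc hw

lemma norm_one_sub_mul_constSchur_le : ‖1 - w‖ * ‖constSchur c w‖ ≤ 2 * ‖c‖ := by
  have harc := notMem_arc_of_norm_ne_one (norm_nonneg c) hc hw.ne
  have hfix := constSchur_mul_eq harc (G_ne_self (norm_nonneg c) hc harc (.inr hw))
  have hwff : ‖w * constSchur c w * constSchur c w‖ ≤ 1 := by
    have hf := norm_constSchur_le_one hc hw
    rw [norm_mul, norm_mul]
    exact mul_le_one₀ (mul_le_one₀ hw.le (norm_nonneg _) hf) (norm_nonneg _) hf
  calc ‖1 - w‖ * ‖constSchur c w‖ = ‖c - conj c * (w * constSchur c w * constSchur c w)‖ := by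
        rw [← norm_mul]
        congr 1
        linear_combination hfix
    _ ≤ ‖c‖ + ‖c‖ * ‖w * constSchur c w * constSchur c w‖ :=
        (norm_sub_le _ _).trans_eq (by rw [norm_mul (conj c), RCLike.norm_conj])
    _ ≤ ‖c‖ + ‖c‖ * 1 := by gcongr
    _ = 2 * ‖c‖ := by ring

lemma one_sub_norm_sq_constSchur_le (hβ : ‖β‖ = 1) {ε : ℝ}
    (h : |(w * limitM (c * β) w).re - 1 / 2| ≤ ε) : 1 - ‖constSchur c w‖ ^ 2 ≤ 8 * ε := by
  have hβ0 : β ≠ 0 := left_ne_zero_of_mul_eq_one (mul_conj_of_norm_eq_one hβ)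
  have hsub : β * (w * constSchur c w) - 1 = β * (w * constSchur c w - conj β) := by
    linear_combination mul_conj_of_norm_eq_one hβ
  have hM : w * limitM (c * β) w
      = β * (w * constSchur c w) / (β * (w * constSchur c w) - 1) := by
    rw [limitM_eq_constSchur_div hc hβ hw, hsub, mul_div_mul_left _ _ hβ0, mul_div_assoc]
  have hne : β * (w * constSchur c w) ≠ 1 :=
    sub_ne_zero.mp <| hsub ▸ mul_ne_zero hβ0 (mul_constSchur_sub_conj_ne_zero hc hβ hw)
  have hle : ‖β * (w * constSchur c w)‖ ≤ ‖constSchur c w‖ := by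
    rw [norm_mul, norm_mul, hβ, one_mul]
    exact mul_le_of_le_one_left (norm_nonneg _) hw.le
  rw [hM] at h
  calc 1 - ‖constSchur c w‖ ^ 2 ≤ 1 - ‖β * (w * constSchur c w)‖ ^ 2 := by gcongr
    _ ≤ 8 * ε := one_sub_norm_sq_le hne (hle.trans (norm_constSchur_le_one hc hw)) h

end LimitMBounds

lemma abs_re_mul_finiteM_sub_half_le {a : ℕ → ℂ} (ha : ∀ n, ‖a n‖ < 1) {β : ℂ} (hβ : ‖β‖ = 1)
    {n : ℕ} {δ : ℝ} (hδ : 0 < δ) {w ξ : ℂ} (hξ : ‖ξ‖ = 1)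
    (hwx : ∀ x, (popuc a β (n + 1)).eval x = 0 → δ ≤ ‖w - x‖)
    (hξx : ∀ x, (popuc a β (n + 1)).eval x = 0 → δ ≤ ‖ξ - x‖) :
    |(w * finiteM a β n w).re - 1 / 2| ≤ (1 / δ + 1 / δ ^ 2) * ‖w - ξ‖ := by
  rw [← re_mul_finiteM hβ ha hξ (eval_ne_zero_of_le_dist hδ hξx), ← Complex.sub_re]
  calc |(w * finiteM a β n w - ξ * finiteM a β n ξ).re|
      ≤ ‖(w - ξ) * finiteM a β n w + ξ * (finiteM a β n w - finiteM a β n ξ)‖ :=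
        (Complex.abs_re_le_norm _).trans_eq (by congr 1; ring)
    _ ≤ ‖w - ξ‖ * ‖finiteM a β n w‖ + ‖finiteM a β n w - finiteM a β n ξ‖ :=
        (norm_add_le _ _).trans_eq (by rw [norm_mul, norm_mul, hξ, one_mul])
    _ ≤ ‖w - ξ‖ * (1 / δ) + ‖w - ξ‖ / δ ^ 2 := by
        gcongr
        · exact norm_finiteM_le hβ hδ ha hwx
        · exact norm_finiteM_sub_le hβ hδ ha hwx hξx
    _ = (1 / δ + 1 / δ ^ 2) * ‖w - ξ‖ := by ring

section OnCircle

variable {t : ℝ} {α : ℕ → ℕ → ℂ} {α₀ β : ℂ} {n N : ℕ → ℕ} {ξ : ℂ}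

lemma eventually_mem_ball_and_norm_lt_one {δ : ℝ} (hδ : 0 < δ) :
    ∀ᶠ w in 𝓝[Metric.ball 0 1] ξ, w ∈ Metric.ball ξ δ ∧ ‖w‖ < 1 := by
  filter_upwards [self_mem_nhdsWithin, nhdsWithin_le_nhds (Metric.ball_mem_nhds ξ hδ)]
    with w hw1 hwδ
  exact ⟨hwδ, mem_ball_zero_iff.mp hw1⟩

variable (hα : ∀ n N, ‖α n N‖ < 1) (hα₀ : ‖α₀‖ ≤ 1) (hlim : RatioTendsto t α α₀)
  (h : RatioSeq t n N) (hβ : ‖β‖ = 1)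
include hα hα₀ hlim h hβ

lemma tendsto_finiteM_apply {w : ℂ} (hw : ‖w‖ < 1) :
    Tendsto (fun j => finiteM (coeffs α (N j)) β (n j) w) atTop
      (𝓝 (limitM (-conj α₀ * β) w)) :=
  (tendsto_finiteM_of_norm_lt_one hα hα₀ hlim h hβ hw).comp
    (tendsto_id.prodMk tendsto_const_nhds)

variable (hξ : ‖ξ‖ = 1) (hgap : HasGap α β (fun j => n j + 1) N ξ)
include hξ hgap

lemma exists_forall_abs_re_mul_limitM_le :
    ∃ δ > 0, ∃ L : ℝ, ∀ w ∈ Metric.ball ξ δ, ‖w‖ < 1 →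
      |(w * limitM (-conj α₀ * β) w).re - 1 / 2| ≤ L * ‖w - ξ‖ := by
  obtain ⟨δ, hδ, hgap⟩ := hgap.exists_ball
  refine ⟨δ, hδ, 1 / δ + 1 / δ ^ 2, fun w hwδ hw => ?_⟩
  have hm := (tendsto_finiteM_apply hα hα₀ hlim h hβ hw).const_mul w
  refine le_of_tendsto (((Complex.continuous_re.tendsto _).comp hm).sub_const (1 / 2)).abs
    (hgap.mono fun j hj => ?_)
  exact abs_re_mul_finiteM_sub_half_le (fun k => hα k (N j)) hβ hδ hξ (hj w hwδ)
    (hj ξ (Metric.mem_ball_self hδ))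

/-- At a gap the limit of `Re (z m)` is the boundary value `1 / 2`, so the limiting Schur function
is unimodular there, while its fixed point equation gives `|1 - ξ| |f(ξ)| ≤ 2 |α₀|`. -/
lemma HasGap.norm_one_sub_le : ‖1 - ξ‖ ≤ 2 * ‖α₀‖ := by
  have hcn : ‖-conj α₀‖ = ‖α₀‖ := by rw [norm_neg, RCLike.norm_conj]
  have hc := hcn.trans_le hα₀
  obtain ⟨δ, hδ, L, hL⟩ := exists_forall_abs_re_mul_limitM_le hα hα₀ hlim h hβ hξ hgap
  have hbound : ∀ᶠ w in 𝓝[Metric.ball 0 1] ξ,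
      ‖1 - w‖ ^ 2 * (1 - 8 * (L * ‖w - ξ‖)) ≤ (2 * ‖α₀‖) ^ 2 := by
    filter_upwards [eventually_mem_ball_and_norm_lt_one hδ] with w ⟨hwδ, hw⟩
    have hf := one_sub_norm_sq_constSchur_le hc hw hβ (hL w hwδ hw)
    calc ‖1 - w‖ ^ 2 * (1 - 8 * (L * ‖w - ξ‖))
        ≤ ‖1 - w‖ ^ 2 * ‖constSchur (-conj α₀) w‖ ^ 2 := by gcongr; linarith
      _ = (‖1 - w‖ * ‖constSchur (-conj α₀) w‖) ^ 2 := by ring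
      _ ≤ (2 * ‖α₀‖) ^ 2 := pow_le_pow_left₀ (by positivity)
        ((norm_one_sub_mul_constSchur_le hc hw).trans_eq (by rw [hcn])) 2
  have hcont : Continuous fun w => ‖1 - w‖ ^ 2 * (1 - 8 * (L * ‖w - ξ‖)) := by fun_prop
  have := nhdsWithin_ball_neBot hξ
  have hle := le_of_tendsto ((hcont.tendsto ξ).mono_left nhdsWithin_le_nhds) hbound
  rw [sub_self, norm_zero, mul_zero, mul_zero, sub_zero, mul_one] at hle
  exact (sq_le_sq₀ (norm_nonneg _) (by positivity)).mp hle

variable (hα₀0 : α₀ ≠ 0) (hG : ContinuousAt (G ‖α₀‖) ξ)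
include hα₀0 hG

lemma HasGap.mul_one_add_sub_G_ne_zero_of_norm_eq_one :
    ξ * (1 + -conj α₀ * β) - G ‖α₀‖ ξ ≠ 0 := by
  have hcn : ‖-conj α₀ * β‖ = ‖α₀‖ := norm_neg_conj_mul hβ
  obtain ⟨δ, hδ, hgap⟩ := hgap.exists_ball
  have hbound : ∀ᶠ w in 𝓝[Metric.ball 0 1] ξ,
      ‖α₀‖ ≤ 1 / δ * ‖w * (1 + -conj α₀ * β) - G ‖α₀‖ w‖ := by
    filter_upwards [eventually_mem_ball_and_norm_lt_one hδ] with w ⟨hwδ, hw⟩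
    have hle : ‖limitM (-conj α₀ * β) w‖ ≤ 1 / δ :=
      le_of_tendsto (tendsto_finiteM_apply hα hα₀ hlim h hβ hw).norm <| hgap.mono fun j hj =>
        norm_finiteM_le hβ hδ (fun k => hα k (N j)) (hj w hwδ)
    have hD := mul_one_add_sub_G_ne_zero (hcn.trans_le hα₀) hw
    rwa [limitM_of_norm_le_one hw.le, norm_div, div_le_iff₀ (norm_pos_iff.mpr hD), hcn] at hle
  have hcont : ContinuousAt (fun w => 1 / δ * ‖w * (1 + -conj α₀ * β) - G ‖α₀‖ w‖) ξ := by
    fun_prop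
  have := nhdsWithin_ball_neBot hξ
  have hle := ge_of_tendsto (hcont.tendsto.mono_left nhdsWithin_le_nhds) hbound
  intro h0
  rw [h0, norm_zero, mul_zero] at hle
  exact hα₀0 (norm_le_zero_iff.mp hle)

lemma HasGap.tendsto_finiteM_of_norm_eq_one :
    Tendsto (fun p : ℕ × ℂ => finiteM (coeffs α (N p.1)) β (n p.1) p.2) (atTop ×ˢ 𝓝 ξ)
      (𝓝 (limitM (-conj α₀ * β) ξ)) := by
  have hcn : ‖-conj α₀ * β‖ = ‖α₀‖ := norm_neg_conj_mul hβ
  have hD := hgap.mul_one_add_sub_G_ne_zero_of_norm_eq_one hα hα₀ hlim h hβ hξ hα₀0 hG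
  obtain ⟨δ, hδ, hgap⟩ := hgap.exists_ball
  have := nhdsWithin_ball_neBot hξ
  have hdisc := eventually_mem_ball_and_norm_lt_one (ξ := ξ) hδ
  have hLipschitz : ∀ᶠ j in atTop, LipschitzOnWith (Real.toNNReal (1 / δ ^ 2))
      (finiteM (coeffs α (N j)) β (n j)) (Metric.ball ξ δ) := by
    filter_upwards [hgap] with j hj
    refine LipschitzOnWith.of_dist_le_mul fun z hz w hw => ?_
    rw [Real.coe_toNNReal _ (by positivity), one_div_mul_eq_div, dist_eq_norm, dist_eq_norm]
    exact norm_finiteM_sub_le hβ hδ (fun k => hα k (N j)) (hj z hz) (hj w hw)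
  have hboundary : Tendsto (limitM (-conj α₀ * β)) (𝓝[Metric.ball 0 1] ξ)
      (𝓝 (limitM (-conj α₀ * β) ξ)) := by
    have hcont : ContinuousAt
        (fun w => -conj α₀ * β / (w * (1 + -conj α₀ * β) - G ‖α₀‖ w)) ξ := by
      fun_prop (disch := exact hD)
    rw [limitM_of_norm_le_one hξ.le, hcn]
    refine (hcont.tendsto.mono_left nhdsWithin_le_nhds).congr' (hdisc.mono fun w hw => ?_)
    rw [limitM_of_norm_le_one hw.2.le, hcn]
  exact tendsto_prod_nhds_of_lipschitzOnWith (Metric.ball_mem_nhds ξ hδ) hLipschitz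
    nhdsWithin_le_nhds
    (hdisc.mono fun w hw => tendsto_finiteM_apply hα hα₀ hlim h hβ hw.2) hboundary

end OnCircle

lemma arc_subset_closure {a : ℝ} (ha0 : 0 ≤ a) (ha1 : a < 1) :
    arc a ⊆ closure {w : ℂ | ‖w‖ = 1 ∧ w.re < 1 - 2 * a ^ 2} := by
  have harcsin : Real.arcsin a < Real.pi / 2 := Real.arcsin_lt_pi_div_two.mpr ha1
  have hcos : Real.cos (2 * Real.arcsin a) = 1 - 2 * a ^ 2 := by
    rw [Real.cos_two_mul, Real.cos_sq', Real.sin_arcsin (by linarith) ha1.le]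
    ring
  rintro _ ⟨θ, hθ, hθ', rfl⟩
  have hmem : θ ∈ closure (Set.Ioo (2 * Real.arcsin a) (2 * Real.pi - 2 * Real.arcsin a)) := by
    rw [closure_Ioo (by linarith)]
    exact ⟨hθ, hθ'⟩
  have hexp : Continuous fun s : ℝ => Complex.exp (s * Complex.I) := by fun_prop
  refine closure_mono ?_ (image_closure_subset_closure_image hexp ⟨θ, hmem, rfl⟩)
  rintro _ ⟨s, ⟨hs, hs'⟩, rfl⟩
  refine ⟨Complex.norm_exp_ofReal_mul_I s, ?_⟩
  have hpos := Real.arcsin_nonneg.mpr ha0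
  rw [Complex.exp_ofReal_mul_I_re, ← hcos]
  rcases le_total s Real.pi with hsπ | hsπ
  · exact Real.cos_lt_cos_of_nonneg_of_le_pi (by linarith) hsπ hs
  · rw [← Real.cos_two_pi_sub s]
    exact Real.cos_lt_cos_of_nonneg_of_le_pi (by linarith) (by linarith) (by linarith)

lemma norm_one_sub_sq_of_norm_eq_one {w : ℂ} (hw : ‖w‖ = 1) : ‖1 - w‖ ^ 2 = 2 - 2 * w.re := by
  have h := Complex.normSq_sub 1 w
  rw [Complex.normSq_eq_norm_sq, Complex.normSq_eq_norm_sq w, hw] at h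
  simp only [map_one, one_mul, Complex.conj_re] at h
  linarith

section GapLimits

variable {t : ℝ} {α : ℕ → ℕ → ℂ} {α₀ β : ℂ} {n N : ℕ → ℕ} {z : ℂ} (hα : ∀ n N, ‖α n N‖ < 1)
  (hlim : RatioTendsto t α α₀) (h : RatioSeq t n N) (hβ : ‖β‖ = 1)
include hα hlim h hβ

lemma HasGap.notMem_arc (hα₀ : ‖α₀‖ < 1) (hgap : HasGap α β (fun j => n j + 1) N z) :
    z ∉ arc ‖α₀‖ := by
  intro hz
  obtain ⟨w, ⟨hw, hre⟩, hgapw⟩ := ((mem_closure_iff_frequently.mp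
    (arc_subset_closure (norm_nonneg α₀) hα₀ hz)).and_eventually hgap.eventually_nhds).exists
  have hle : ‖1 - w‖ ^ 2 ≤ (2 * ‖α₀‖) ^ 2 := by
    gcongr
    exact hgapw.norm_one_sub_le hα hα₀.le hlim h hβ hw
  rw [norm_one_sub_sq_of_norm_eq_one hw] at hle
  linarith

variable (hα₀ : ‖α₀‖ ≤ 1) (hz : ‖z‖ = 1 → α₀ ≠ 0 ∧ ContinuousAt (G ‖α₀‖) z)
include hα₀ hz

lemma HasGap.mul_one_add_sub_G_ne_zero (hgap : HasGap α β (fun j => n j + 1) N z)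
    (hz1 : ‖z‖ ≤ 1) : z * (1 + -conj α₀ * β) - G ‖α₀‖ z ≠ 0 := by
  rcases hz1.lt_or_eq with hlt | heq
  · have hcn : ‖-conj α₀ * β‖ = ‖α₀‖ := norm_neg_conj_mul hβ
    exact hcn ▸ VaryingOPUC.mul_one_add_sub_G_ne_zero (hcn.trans_le hα₀) hlt
  · exact hgap.mul_one_add_sub_G_ne_zero_of_norm_eq_one hα hα₀ hlim h hβ heq (hz heq).1 (hz heq).2

lemma HasGap.tendsto_finiteM (hgap : HasGap α β (fun j => n j + 1) N z) :
    Tendsto (fun p : ℕ × ℂ => finiteM (coeffs α (N p.1)) β (n p.1) p.2) (atTop ×ˢ 𝓝 z)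
      (𝓝 (limitM (-conj α₀ * β) z)) := by
  rcases lt_trichotomy ‖z‖ 1 with hlt | heq | hgt
  · exact tendsto_finiteM_of_norm_lt_one hα hα₀ hlim h hβ hlt
  · exact hgap.tendsto_finiteM_of_norm_eq_one hα hα₀ hlim h hβ heq (hz heq).1 (hz heq).2
  · exact tendsto_finiteM_of_one_lt_norm hα hα₀ hlim h hβ hgt

end GapLimits

/-! ### Quotients of consecutive paraorthogonal polynomials -/

lemma mul_limitM_add_eq_G {c z : ℂ} (hc : ‖c‖ ≤ 1)
    (hq : G ‖c‖ z ^ 2 - (z + 1) * G ‖c‖ z + z * (1 - (‖c‖ : ℂ) ^ 2) = 0)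
    (hD : ‖z‖ ≤ 1 → z * (1 + c) - G ‖c‖ z ≠ 0) :
    1 - c * z + z * limitM c z * (z * (1 + c) - (1 + conj c)) = G ‖c‖ z := by
  rw [← Complex.mul_conj'] at hq
  rcases le_or_gt ‖z‖ 1 with hz | hz
  · have hD := hD hz
    rw [limitM_of_norm_le_one hz]
    field_simp
    linear_combination hq
  · have hE := G_sub_one_sub_conj_ne_zero hc hz
    have hz0 : z ≠ 0 := norm_pos_iff.mp (zero_lt_one.trans hz)
    rw [limitM_of_one_lt_norm hz]
    field_simp
    linear_combination -hq

section PopucQuotient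

variable {t : ℝ} {α : ℕ → ℕ → ℂ} {α₀ β : ℂ} {n N : ℕ → ℕ} {z : ℂ} (hα : ∀ n N, ‖α n N‖ < 1)
  (hlim : RatioTendsto t α α₀) (h : RatioSeq t n N) (hβ : ‖β‖ = 1) (hα₀ : ‖α₀‖ ≤ 1)
  (hz : ‖z‖ = 1 → α₀ ≠ 0 ∧ ContinuousAt (G ‖α₀‖) z)
  (hq : G ‖α₀‖ z ^ 2 - (z + 1) * G ‖α₀‖ z + z * (1 - (‖α₀‖ : ℂ) ^ 2) = 0)
include hα hlim h hβ hα₀ hz hq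

lemma HasGap.tendsto_popuc_add_two_div (hgap : HasGap α β (fun j => n j + 1) N z) :
    Tendsto (fun p : ℕ × ℂ => (popuc (coeffs α (N p.1)) β (n p.1 + 2)).eval p.2
      / (popuc (coeffs α (N p.1)) β (n p.1 + 1)).eval p.2) (atTop ×ˢ 𝓝 z) (𝓝 (G ‖α₀‖ z)) := by
  have hcn : ‖-conj α₀ * β‖ = ‖α₀‖ := norm_neg_conj_mul hβ
  have hlimit : 1 + z * (conj α₀ * β) + z * limitM (-conj α₀ * β) z
      * (z * (1 - conj α₀ * β) - (1 - α₀ * conj β)) = G ‖α₀‖ z := by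
    have hG := mul_limitM_add_eq_G (c := -conj α₀ * β) (z := z) (hcn.trans_le hα₀)
      (hcn.symm ▸ hq) (hcn.symm ▸ hgap.mul_one_add_sub_G_ne_zero hα hlim h hβ hα₀ hz)
    rw [hcn, map_mul, map_neg, Complex.conj_conj] at hG
    linear_combination hG
  have hm := hgap.tendsto_finiteM hα hlim h hβ hα₀ hz
  have hsnd : Tendsto (fun p : ℕ × ℂ => p.2) ((atTop : Filter ℕ) ×ˢ 𝓝 z) (𝓝 z) := tendsto_snd
  have hcoeff : Tendsto (fun p : ℕ × ℂ => coeffs α (N p.1) (n p.1)) (atTop ×ˢ 𝓝 z) (𝓝 α₀) :=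
    (hlim n N h).comp tendsto_fst
  have hcoeff' := ((Complex.continuous_conj.tendsto α₀).comp hcoeff).mul_const β
  rw [← hlimit]
  refine (((hsnd.mul hcoeff').const_add 1).add ((hsnd.mul hm).mul
    ((hsnd.mul (hcoeff'.const_sub 1)).sub ((hcoeff.mul_const (conj β)).const_sub 1)))).congr' ?_
  filter_upwards [hgap.eventually_popuc_ne_zero] with p hp
  exact (popuc_div_popuc_eq hβ hp).symm

lemma HasGap.tendsto_popuc_div_popuc (hgap : HasGap α β n N z) :
    Tendsto (fun p : ℕ × ℂ => (popuc (coeffs α (N p.1)) β (n p.1 + 1)).eval p.2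
      / (popuc (coeffs α (N p.1)) β (n p.1)).eval p.2) (atTop ×ˢ 𝓝 z) (𝓝 (G ‖α₀‖ z)) := by
  have hpos : ∀ᶠ j in atTop, n j - 1 + 1 = n j :=
    (h.1.eventually_ge_atTop 1).mono fun j hj => Nat.sub_add_cancel hj
  have hgap' : HasGap α β (fun j => n j - 1 + 1) N z := by
    obtain ⟨δ, hδ, hgap⟩ := hgap
    exact ⟨δ, hδ, (hgap.and hpos).mono fun j ⟨hj, hnj⟩ => by simpa only [hnj] using hj⟩
  refine (hgap'.tendsto_popuc_add_two_div hα hlim (h.sub_const 1) hβ hα₀ hz hq).congr' ?_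
  filter_upwards [tendsto_fst.eventually hpos] with p hp
  rw [show n p.1 - 1 + 2 = n p.1 + 1 by omega, hp]

end PopucQuotient

/-! ### The arc consists of limits of zeros -/

section Hurwitz

variable {x : ℂ} {r m : ℝ} (hr : 0 < r) (hm : 0 < m)
include hr hm

lemma le_norm_of_forall_mem_sphere {f : ℂ → ℂ}
    (hf : DifferentiableOn ℂ f (Metric.closedBall x r))
    (hne : ∀ z ∈ Metric.closedBall x r, f z ≠ 0) (hle : ∀ z ∈ Metric.sphere x r, m ≤ ‖f z‖) :
    m ≤ ‖f x‖ := by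
  have hdiff : DiffContOnCl ℂ (fun z => (f z)⁻¹) (Metric.ball x r) :=
    DifferentiableOn.diffContOnCl (by rw [closure_ball x hr.ne']; exact hf.inv hne)
  have hmax : ‖(f x)⁻¹‖ ≤ m⁻¹ := by
    refine Complex.norm_le_of_forall_mem_frontier_norm_le Metric.isBounded_ball hdiff
      (fun z hz => ?_) (subset_closure (Metric.mem_ball_self hr))
    rw [norm_inv]
    exact inv_anti₀ hm (hle z (frontier_ball x hr.ne' ▸ hz))
  rw [norm_inv] at hmax
  exact (inv_le_inv₀ (norm_pos_iff.mpr (hne x (Metric.mem_closedBall_self hr.le))) hm).mp hmax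

lemma ne_zero_of_tendstoUniformlyOn {ι : Type*} {l : Filter ι} [l.NeBot] {F : ι → ℂ → ℂ}
    {g : ℂ → ℂ} (hF : ∀ᶠ j in l, DifferentiableOn ℂ (F j) (Metric.closedBall x r))
    (hne : ∀ᶠ j in l, ∀ z ∈ Metric.closedBall x r, F j z ≠ 0)
    (hFg : TendstoUniformlyOn F g l (Metric.closedBall x r))
    (hg : ∀ z ∈ Metric.sphere x r, m ≤ ‖g z‖) : g x ≠ 0 := by
  have hhalf : ∀ᶠ j in l, m / 2 ≤ ‖F j x‖ := by
    filter_upwards [hF, hne, Metric.tendstoUniformlyOn_iff.mp hFg (m / 2) (half_pos hm)]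
      with j hdiff hj hdist
    refine le_norm_of_forall_mem_sphere hr (half_pos hm) hdiff hj fun z hz => ?_
    have hzdist := hdist z (Metric.sphere_subset_closedBall hz)
    rw [dist_eq_norm] at hzdist
    linarith [hg z hz, norm_le_norm_add_norm_sub' (g z) (F j z)]
  have hx := hFg.tendsto_at (Metric.mem_closedBall_self hr.le)
  exact norm_pos_iff.mp ((half_pos hm).trans_le (ge_of_tendsto hx.norm hhalf))

end Hurwitz

section LimitZeros

variable {t : ℝ} {α : ℕ → ℕ → ℂ} {α₀ β : ℂ} {n N : ℕ → ℕ} (hα : ∀ n N, ‖α n N‖ < 1)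
  (hlim : RatioTendsto t α α₀) (h : RatioSeq t n N) (hβ : ‖β‖ = 1)
include hα hlim h hβ

/-- Otherwise `Φ_{n+1}^{(β)} / Φ_n^{(β)}` would have no zeros near `-1`, contradicting Hurwitz's
theorem, because it converges to `G_1(z) = z + 1`. -/
lemma neg_one_mem_limitZeros (hα₀ : ‖α₀‖ = 1) : (-1 : ℂ) ∈ limitZeros α t β := by
  by_contra hmem
  have hα₀0 : α₀ ≠ 0 := norm_ne_zero_iff.mp (hα₀ ▸ one_ne_zero)
  have hG : G ‖α₀‖ = fun z => z + 1 := funext fun z => by rw [hα₀, G_one]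
  have hgap := hasGap_of_notMem_limitZeros hα hβ h hmem
  have hgap' := hasGap_of_notMem_limitZeros hα hβ (h.add_const 1) hmem
  obtain ⟨ε, hε, hball⟩ := Metric.nhds_basis_closedBall.mem_iff.mp
    (hgap.eventually_nhds.and hgap'.eventually_nhds)
  have hK := isCompact_closedBall (-1 : ℂ) ε
  have hden : ∀ᶠ j in atTop, ∀ z ∈ Metric.closedBall (-1) ε,
      (popuc (coeffs α (N j)) β (n j)).eval z ≠ 0 :=
    eventually_forall_of_isCompact hK fun z hz => (hball hz).1.eventually_popuc_ne_zero
  have hnum : ∀ᶠ j in atTop, ∀ z ∈ Metric.closedBall (-1) ε,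
      (popuc (coeffs α (N j)) β (n j + 1)).eval z ≠ 0 :=
    eventually_forall_of_isCompact hK fun z hz => (hball hz).2.eventually_popuc_ne_zero
  have hunif : TendstoUniformlyOn (fun j z => (popuc (coeffs α (N j)) β (n j + 1)).eval z
      / (popuc (coeffs α (N j)) β (n j)).eval z) (fun z => z + 1) atTop
      (Metric.closedBall (-1) ε) := by
    refine tendstoUniformlyOn_of_tendsto_prod_nhdsWithin hK fun z hz => ?_
    have hz := (hball hz).1.tendsto_popuc_div_popuc hα hlim h hβ hα₀.le
      (fun _ => ⟨hα₀0, by rw [hG]; fun_prop⟩) (by rw [hG, hα₀]; push_cast; ring)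
    rw [hG] at hz
    exact hz.mono_left (Filter.prod_mono_right _ nhdsWithin_le_nhds)
  refine ne_zero_of_tendstoUniformlyOn hε hε ?_ ?_ hunif (fun z hz => ?_) (neg_add_cancel 1)
  · exact hden.mono fun j hj =>
      (Polynomial.differentiable _).differentiableOn.div
        (Polynomial.differentiable _).differentiableOn hj
  · exact (hnum.and hden).mono fun j hj z hz => div_ne_zero (hj.1 z hz) (hj.2 z hz)
  · simpa using (mem_sphere_iff_norm.mp hz).ge

lemma arc_subset_limitZeros (hα₀ : ‖α₀‖ ≤ 1) : arc ‖α₀‖ ⊆ limitZeros α t β := by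
  intro z hz
  rcases hα₀.lt_or_eq with hlt | heq
  · by_contra hmem
    exact (hasGap_of_notMem_limitZeros hα hβ (h.add_const 1) hmem).notMem_arc hα hlim h hβ hlt hz
  · obtain ⟨hnorm, hre⟩ := (mem_arc_iff (norm_nonneg _) hα₀).mp hz
    have hsq := norm_one_sub_sq_of_norm_eq_one (w := -z) (by rwa [norm_neg])
    rw [heq] at hre
    rw [sub_neg_eq_add, Complex.neg_re] at hsq
    have hz1 : 1 + z = 0 := norm_eq_zero.mp <| pow_eq_zero_iff two_ne_zero |>.mp <|
      le_antisymm (by linarith) (sq_nonneg _)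
    rw [eq_neg_of_add_eq_zero_right hz1]
    exact neg_one_mem_limitZeros hα hlim h hβ heq

end LimitZeros

/-! ### Limits of the quotients -/

section LimitFormulas

variable {c z : ℂ}

lemma mul_limitM_sub_one_eq_of_norm_le_one (hz : ‖z‖ ≤ 1) (hD : z * (1 + c) - G ‖c‖ z ≠ 0) :
    z * limitM c z - 1 = (G ‖c‖ z - z) / (z * (1 + c) - G ‖c‖ z) := by
  rw [limitM_of_norm_le_one hz]
  field_simp
  ring

variable (hc : ‖c‖ ≤ 1)
include hc

lemma mul_limitM_sub_one_eq_of_one_lt_norm (hz : 1 < ‖z‖) :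
    z * limitM c z - 1 = conj c / (G ‖c‖ z - 1 - conj c) := by
  have hE := G_sub_one_sub_conj_ne_zero hc hz
  have hz0 : z ≠ 0 := norm_pos_iff.mp (zero_lt_one.trans hz)
  rw [limitM_of_one_lt_norm hz]
  field_simp
  ring

variable (hz : z ∉ arc ‖c‖) (hD : ‖z‖ ≤ 1 → z * (1 + c) - G ‖c‖ z ≠ 0)
include hz hD

lemma mFun_eq_limitM : mFun c z = limitM c z := by
  rcases le_or_gt ‖z‖ 1 with hz1 | hz1
  · rw [(isUnit_sub_constCMV_and_mFun_eq_div hc hz (hD hz1)).2, limitM_of_norm_le_one hz1]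
  · rw [mFun_eq_G_sub_one_div hc hz (norm_pos_iff.mp (zero_lt_one.trans hz1))
      (G_sub_one_sub_conj_ne_zero hc hz1), limitM_of_one_lt_norm hz1]

variable (hc0 : c ≠ 0)
include hc0

lemma mul_limitM_sub_one_ne_zero : z * limitM c z - 1 ≠ 0 := by
  rcases le_or_gt ‖z‖ 1 with hz1 | hz1
  · rw [mul_limitM_sub_one_eq_of_norm_le_one hz1 (hD hz1)]
    exact div_ne_zero (sub_ne_zero.mpr (G_ne_self (norm_nonneg c) hc hz
      (.inl (norm_ne_zero_iff.mpr hc0)))) (hD hz1)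
  · rw [mul_limitM_sub_one_eq_of_one_lt_norm hc hz1]
    exact div_ne_zero ((_root_.map_ne_zero _).mpr hc0) (G_sub_one_sub_conj_ne_zero hc hz1)

lemma limitM_div_mul_limitM_sub_one : limitM c z / (z * limitM c z - 1) = constSchur c z := by
  have hG := sub_ne_zero.mpr (G_ne_self (norm_nonneg c) hc hz (.inl (norm_ne_zero_iff.mpr hc0)))
  rcases le_or_gt ‖z‖ 1 with hz1 | hz1
  · rw [mul_limitM_sub_one_eq_of_norm_le_one hz1 (hD hz1), limitM_of_norm_le_one hz1,
      div_div_div_cancel_right₀ (hD hz1), constSchur]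
  · have hE := G_sub_one_sub_conj_ne_zero hc hz1
    have hz0 : z ≠ 0 := norm_pos_iff.mp (zero_lt_one.trans hz1)
    have hcc : conj c ≠ 0 := (_root_.map_ne_zero _).mpr hc0
    rw [mul_limitM_sub_one_eq_of_one_lt_norm hc hz1, limitM_of_one_lt_norm hz1, constSchur]
    field_simp
    linear_combination G_norm_quadratic hz

end LimitFormulas

lemma constSchur_mul_of_norm_eq_one {c β z : ℂ} (hβ : ‖β‖ = 1) :
    constSchur (c * β) z = constSchur c z * β := by
  rw [constSchur, constSchur, norm_mul_of_norm_eq_one hβ, mul_div_right_comm]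

lemma opucStar_div_popuc_eq {a : ℕ → ℂ} {β : ℂ} (hβ : ‖β‖ = 1) {n : ℕ} {z : ℂ}
    (h : (popuc a β (n + 1)).eval z ≠ 0) :
    (opucStar a n).eval z / (popuc a β (n + 1)).eval z = β * (z * finiteM a β n z - 1) := by
  rw [finiteM]
  field_simp
  rw [eval_popuc_succ]
  linear_combination -(opucStar a n).eval z * mul_conj_of_norm_eq_one hβ

lemma ne_zero_of_notMem_arc {c z : ℂ} (hz : ‖z‖ = 1) (h : z ∉ arc ‖c‖) : c ≠ 0 := by
  rintro rfl
  refine h ((mem_arc_iff (norm_nonneg _) (by simp)).mpr ⟨hz, ?_⟩)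
  simpa [hz] using Complex.re_le_norm z

section NotMemLimitZeros

variable {t : ℝ} {α : ℕ → ℕ → ℂ} {α₀ β : ℂ} {n N : ℕ → ℕ} {z : ℂ} (hα : ∀ n N, ‖α n N‖ < 1)
  (hlim : RatioTendsto t α α₀) (h : RatioSeq t n N) (hβ : ‖β‖ = 1) (hα₀ : ‖α₀‖ ≤ 1)
  (hz : z ∉ limitZeros α t β)
include hα hlim h hβ hα₀ hz

lemma notMem_arc_of_notMem_limitZeros : z ∉ arc ‖α₀‖ := fun hmem =>
  hz (arc_subset_limitZeros hα hlim h hβ hα₀ hmem)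

lemma ne_zero_and_continuousAt_G_of_notMem_limitZeros (hz1 : ‖z‖ = 1) :
    α₀ ≠ 0 ∧ ContinuousAt (G ‖α₀‖) z :=
  have harc := notMem_arc_of_notMem_limitZeros hα hlim h hβ hα₀ hz
  ⟨ne_zero_of_notMem_arc hz1 harc, continuousAt_G (norm_nonneg _) hα₀ harc⟩

lemma mul_one_add_sub_G_ne_zero_of_notMem_limitZeros (hz1 : ‖z‖ ≤ 1) :
    z * (1 + -conj α₀ * β) - G ‖-conj α₀ * β‖ z ≠ 0 := by
  rw [norm_neg_conj_mul hβ]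
  exact (hasGap_of_notMem_limitZeros hα hβ (h.add_const 1) hz).mul_one_add_sub_G_ne_zero hα hlim h
    hβ hα₀ (ne_zero_and_continuousAt_G_of_notMem_limitZeros hα hlim h hβ hα₀ hz) hz1

lemma tendsto_finiteM_of_notMem_limitZeros :
    Tendsto (fun p : ℕ × ℂ => finiteM (coeffs α (N p.1)) β (n p.1) p.2) (atTop ×ˢ 𝓝 z)
      (𝓝 (limitM (-conj α₀ * β) z)) :=
  (hasGap_of_notMem_limitZeros hα hβ (h.add_const 1) hz).tendsto_finiteM hα hlim h hβ hα₀
    (ne_zero_and_continuousAt_G_of_notMem_limitZeros hα hlim h hβ hα₀ hz)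

lemma tendsto_opucStar_div_popuc :
    Tendsto (fun p : ℕ × ℂ => (opucStar (coeffs α (N p.1)) (n p.1)).eval p.2
      / (popuc (coeffs α (N p.1)) β (n p.1 + 1)).eval p.2) (atTop ×ˢ 𝓝 z)
      (𝓝 (β * (z * limitM (-conj α₀ * β) z - 1))) := by
  have hm := tendsto_finiteM_of_notMem_limitZeros hα hlim h hβ hα₀ hz
  refine (((tendsto_snd.mul hm).sub_const 1).const_mul β).congr' ?_
  filter_upwards [(hasGap_of_notMem_limitZeros hα hβ (h.add_const 1) hz).eventually_popuc_ne_zero]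
    with p hp
  exact (opucStar_div_popuc_eq hβ hp).symm

variable (hα₀0 : α₀ ≠ 0)
include hα₀0

lemma mul_mul_limitM_sub_one_ne_zero : β * (z * limitM (-conj α₀ * β) z - 1) ≠ 0 := by
  have hβ0 : β ≠ 0 := left_ne_zero_of_mul_eq_one (mul_conj_of_norm_eq_one hβ)
  have hcn : ‖-conj α₀ * β‖ = ‖α₀‖ := norm_neg_conj_mul hβ
  exact mul_ne_zero hβ0 <| mul_limitM_sub_one_ne_zero (hcn.trans_le hα₀)
    (hcn.symm ▸ notMem_arc_of_notMem_limitZeros hα hlim h hβ hα₀ hz)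
    (mul_one_add_sub_G_ne_zero_of_notMem_limitZeros hα hlim h hβ hα₀ hz)
    (norm_ne_zero_iff.mp (hcn.symm ▸ norm_ne_zero_iff.mpr hα₀0))

lemma eventually_opucStar_ne_zero :
    ∀ᶠ p : ℕ × ℂ in atTop ×ˢ 𝓝 z, (opucStar (coeffs α (N p.1)) (n p.1)).eval p.2 ≠ 0 := by
  filter_upwards [(tendsto_opucStar_div_popuc hα hlim h hβ hα₀ hz).eventually_ne
    (mul_mul_limitM_sub_one_ne_zero hα hlim h hβ hα₀ hz hα₀0)] with p hp
  exact left_ne_zero_of_mul hp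

lemma tendsto_invSchurIterate_of_notMem_limitZeros :
    Tendsto (fun p : ℕ × ℂ => invSchurIterate (coeffs α (N p.1)) (n p.1) p.2) (atTop ×ˢ 𝓝 z)
      (𝓝 (constSchur (-conj α₀) z)) := by
  have hβ0 : β ≠ 0 := left_ne_zero_of_mul_eq_one (mul_conj_of_norm_eq_one hβ)
  have hcn : ‖-conj α₀ * β‖ = ‖α₀‖ := norm_neg_conj_mul hβ
  have hlimit : limitM (-conj α₀ * β) z / (β * (z * limitM (-conj α₀ * β) z - 1))
      = constSchur (-conj α₀) z := by
    rw [mul_comm β, ← div_div, limitM_div_mul_limitM_sub_one (hcn.trans_le hα₀)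
      (hcn.symm ▸ notMem_arc_of_notMem_limitZeros hα hlim h hβ hα₀ hz)
      (mul_one_add_sub_G_ne_zero_of_notMem_limitZeros hα hlim h hβ hα₀ hz)
      (norm_ne_zero_iff.mp (hcn.symm ▸ norm_ne_zero_iff.mpr hα₀0)),
      constSchur_mul_of_norm_eq_one hβ, mul_div_cancel_right₀ _ hβ0]
  rw [← hlimit]
  refine ((tendsto_finiteM_of_notMem_limitZeros hα hlim h hβ hα₀ hz).div
    (tendsto_opucStar_div_popuc hα hlim h hβ hα₀ hz)
    (mul_mul_limitM_sub_one_ne_zero hα hlim h hβ hα₀ hz hα₀0)).congr' ?_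
  filter_upwards [(hasGap_of_notMem_limitZeros hα hβ (h.add_const 1) hz).eventually_popuc_ne_zero]
    with p hp
  rw [Pi.div_apply, finiteM, div_div_div_cancel_right₀ hp, invSchurIterate]

end NotMemLimitZeros

section Quotients

variable {t : ℝ} {α : ℕ → ℕ → ℂ} {α₀ β : ℂ} (hα : ∀ n N, ‖α n N‖ < 1) (hα₀ : ‖α₀‖ ≤ 1)
  (hlim : RatioTendsto t α α₀)
include hα hα₀ hlim

theorem tendsto_opuc_div_popuc (hβ : ‖β‖ = 1) :
    RatioTendstoOnCompacts t
      (fun n N => opuc (coeffs α N) n) (fun n N => popuc (coeffs α N) β (n + 1))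
      (mFun (-conj α₀ * β)) (limitZeros α t β)ᶜ := by
  refine ratioTendstoOnCompacts_of_tendsto_prod_nhds fun n N h z hz => ⟨?_, ?_⟩
  · exact (hasGap_of_notMem_limitZeros hα hβ (h.add_const 1) hz).eventually_popuc_ne_zero
  · have hcn : ‖-conj α₀ * β‖ = ‖α₀‖ := norm_neg_conj_mul hβ
    rw [mFun_eq_limitM (hcn.trans_le hα₀)
      (hcn.symm ▸ notMem_arc_of_notMem_limitZeros hα hlim h hβ hα₀ hz)
      (mul_one_add_sub_G_ne_zero_of_notMem_limitZeros hα hlim h hβ hα₀ hz)]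
    exact tendsto_finiteM_of_notMem_limitZeros hα hlim h hβ hα₀ hz

theorem tendsto_popuc_succ_div_popuc (hβ : ‖β‖ = 1) :
    RatioTendstoOnCompacts t
      (fun n N => popuc (coeffs α N) β (n + 1)) (fun n N => popuc (coeffs α N) β n)
      (G ‖α₀‖) (limitZeros α t β)ᶜ := by
  refine ratioTendstoOnCompacts_of_tendsto_prod_nhds fun n N h z hz => ?_
  have hgap := hasGap_of_notMem_limitZeros hα hβ h hz
  exact ⟨hgap.eventually_popuc_ne_zero, hgap.tendsto_popuc_div_popuc hα hlim h hβ hα₀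
    (ne_zero_and_continuousAt_G_of_notMem_limitZeros hα hlim h hβ hα₀ hz)
    (G_quadratic (notMem_arc_of_notMem_limitZeros hα hlim h hβ hα₀ hz))⟩

theorem tendsto_opuc_div_opucStar_ball :
    RatioTendstoOnCompacts t
      (fun n N => opuc (coeffs α N) n) (fun n N => opucStar (coeffs α N) n)
      (schurFun (-conj α₀)) (Metric.ball 0 1) := by
  refine ratioTendstoOnCompacts_of_tendsto_prod_nhds fun n N h z hz => ?_
  have hz1 : ‖z‖ < 1 := mem_ball_zero_iff.mp hz
  have hc : ‖-conj α₀‖ ≤ 1 := by rwa [norm_neg, RCLike.norm_conj]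
  rw [schurFun_eq_constSchur hc (notMem_arc_of_norm_ne_one (norm_nonneg _) hc hz1.ne) (.inr hz1)]
  refine ⟨?_, tendsto_invSchurIterate hα hα₀ hlim h hz1⟩
  filter_upwards [tendsto_snd.eventually ((continuous_norm.tendsto z).eventually_lt_const hz1)]
    with p hp
  exact opucStar_ne_zero (fun k => hα k (N p.1)) (n p.1) (le_of_lt hp)

variable (hα₀0 : α₀ ≠ 0)
include hα₀0

lemma limits_of_notMem_limitZerosInter {n N : ℕ → ℕ} (h : RatioSeq t n N) {z : ℂ}
    (hz : z ∉ limitZerosInter α t) :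
    z ∉ arc ‖-conj α₀‖ ∧
    (∀ᶠ p : ℕ × ℂ in atTop ×ˢ 𝓝 z, (opucStar (coeffs α (N p.1)) (n p.1)).eval p.2 ≠ 0) ∧
    Tendsto (fun p : ℕ × ℂ => invSchurIterate (coeffs α (N p.1)) (n p.1) p.2) (atTop ×ˢ 𝓝 z)
      (𝓝 (constSchur (-conj α₀) z)) := by
  simp only [limitZerosInter, Set.mem_ofPred_eq, not_forall] at hz
  obtain ⟨β, hβ, hz⟩ := hz
  rw [norm_neg, RCLike.norm_conj]
  exact ⟨notMem_arc_of_notMem_limitZeros hα hlim h hβ hα₀ hz,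
    eventually_opucStar_ne_zero hα hlim h hβ hα₀ hz hα₀0,
    tendsto_invSchurIterate_of_notMem_limitZeros hα hlim h hβ hα₀ hz hα₀0⟩

theorem tendsto_opuc_div_opucStar :
    RatioTendstoOnCompacts t
      (fun n N => opuc (coeffs α N) n) (fun n N => opucStar (coeffs α N) n)
      (schurFun (-conj α₀)) (limitZerosInter α t)ᶜ := by
  refine ratioTendstoOnCompacts_of_tendsto_prod_nhds fun n N h z hz => ?_
  have hc : ‖-conj α₀‖ ≤ 1 := by rwa [norm_neg, RCLike.norm_conj]
  have hc0 : -conj α₀ ≠ 0 := neg_ne_zero.mpr ((_root_.map_ne_zero _).mpr hα₀0)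
  obtain ⟨harc, hne, hf⟩ := limits_of_notMem_limitZerosInter hα hα₀ hlim hα₀0 h hz
  rw [schurFun_eq_constSchur hc harc (.inl hc0)]
  exact ⟨hne, hf⟩

end Quotients

lemma one_add_conj_mul_constSchur {c z : ℂ} (hz : z ∉ arc ‖c‖) (hG : G ‖c‖ z ≠ z) :
    1 + conj c * (z * constSchur c z) = G ‖c‖ z := by
  rw [constSchur]
  field_simp [sub_ne_zero.mpr hG]
  linear_combination -G_norm_quadratic hz

lemma add_div_constSchur {c z : ℂ} (hc : c ≠ 0) : z + c / constSchur c z = G ‖c‖ z := by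
  rw [constSchur, div_div_cancel₀ hc, add_sub_cancel]

section SuccQuotients

variable {t : ℝ} {α : ℕ → ℕ → ℂ} {α₀ : ℂ} (hα : ∀ n N, ‖α n N‖ < 1) (hα₀ : ‖α₀‖ ≤ 1)
  (hlim : RatioTendsto t α α₀) (hα₀0 : α₀ ≠ 0)
include hα hα₀ hlim hα₀0

theorem tendsto_opucStar_succ_div_opucStar :
    RatioTendstoOnCompacts t
      (fun n N => opucStar (coeffs α N) (n + 1)) (fun n N => opucStar (coeffs α N) n)
      (G ‖α₀‖) (limitZerosInter α t)ᶜ := by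
  refine ratioTendstoOnCompacts_of_tendsto_prod_nhds fun n N h z hz => ?_
  obtain ⟨harc, hne, hf⟩ := limits_of_notMem_limitZerosInter hα hα₀ hlim hα₀0 h hz
  refine ⟨hne, ?_⟩
  have hcn : ‖-conj α₀‖ = ‖α₀‖ := by rw [norm_neg, RCLike.norm_conj]
  have hG := G_ne_self (norm_nonneg _) (hcn.trans_le hα₀) harc
    (.inl (hcn.trans_ne (norm_ne_zero_iff.mpr hα₀0)))
  have hA : Tendsto (fun p : ℕ × ℂ => coeffs α (N p.1) (n p.1)) (atTop ×ˢ 𝓝 z) (𝓝 α₀) :=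
    (hlim n N h).comp tendsto_fst
  have hlimit : 1 - α₀ * (z * constSchur (-conj α₀) z) = G ‖α₀‖ z := by
    rw [← hcn, ← one_add_conj_mul_constSchur harc hG, map_neg, Complex.conj_conj, neg_mul,
      sub_eq_add_neg]
  rw [← hlimit]
  refine ((hA.mul (tendsto_snd.mul hf)).const_sub 1).congr' ?_
  filter_upwards [hne] with p hp
  rw [eval_opucStar_succ, invSchurIterate]
  field_simp

theorem tendsto_opuc_succ_div_opuc :
    RatioTendstoOnCompacts t
      (fun n N => opuc (coeffs α N) (n + 1)) (fun n N => opuc (coeffs α N) n)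
      (G ‖α₀‖) (limitZerosInter α t)ᶜ := by
  refine ratioTendstoOnCompacts_of_tendsto_prod_nhds fun n N h z hz => ?_
  obtain ⟨harc, -, hf⟩ := limits_of_notMem_limitZerosInter hα hα₀ hlim hα₀0 h hz
  have hcn : ‖-conj α₀‖ = ‖α₀‖ := by rw [norm_neg, RCLike.norm_conj]
  have hc0 : -conj α₀ ≠ 0 := neg_ne_zero.mpr ((_root_.map_ne_zero _).mpr hα₀0)
  have hG := G_ne_self (norm_nonneg _) (hcn.trans_le hα₀) harc (.inl (norm_ne_zero_iff.mpr hc0))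
  have hf0 : constSchur (-conj α₀) z ≠ 0 := div_ne_zero hc0 (sub_ne_zero.mpr hG)
  have hopuc : ∀ᶠ p : ℕ × ℂ in atTop ×ˢ 𝓝 z,
      (opuc (coeffs α (N p.1)) (n p.1)).eval p.2 ≠ 0 := by
    filter_upwards [hf.eventually_ne hf0] with p hp
    exact (div_ne_zero_iff.mp hp).1
  refine ⟨hopuc, ?_⟩
  have hA : Tendsto (fun p : ℕ × ℂ => -conj (coeffs α (N p.1) (n p.1))) (atTop ×ˢ 𝓝 z)
      (𝓝 (-conj α₀)) :=
    ((Complex.continuous_conj.tendsto α₀).comp ((hlim n N h).comp tendsto_fst)).neg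
  rw [← hcn, ← add_div_constSchur hc0]
  refine (tendsto_snd.add (hA.div hf hf0)).congr' ?_
  filter_upwards [hopuc] with p hp
  rw [Pi.div_apply, eval_opuc_succ, invSchurIterate]
  field_simp
  ring

end SuccQuotients

/-! ### The case of vanishing limit -/

lemma extendFrom_G_zero_ball {z : ℂ} (hz : ‖z‖ ≤ 1) : extendFrom (Metric.ball 0 1) (G 0) z = 1 := by
  refine extendFrom_eq ?_ (tendsto_const_nhds.congr' ?_)
  · rwa [closure_ball 0 one_ne_zero, mem_closedBall_zero_iff]
  · filter_upwards [self_mem_nhdsWithin] with w hw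
    exact (G_zero_of_norm_lt (mem_ball_zero_iff.mp hw)).symm

lemma extendFrom_G_zero_compl {z : ℂ} (hz : 1 ≤ ‖z‖) :
    extendFrom (Metric.closedBall 0 1)ᶜ (G 0) z = z := by
  refine extendFrom_eq ?_ ((tendsto_id.mono_left nhdsWithin_le_nhds).congr' ?_)
  · rwa [closure_compl, interior_closedBall 0 one_ne_zero, Set.mem_compl_iff,
      mem_ball_zero_iff, not_lt]
  · filter_upwards [self_mem_nhdsWithin] with w hw
    exact (G_zero_of_one_lt_norm (by simpa using hw)).symm

section VanishingLimit

variable {t : ℝ} {α : ℕ → ℕ → ℂ} (hα : ∀ n N, ‖α n N‖ < 1) (hlim : RatioTendsto t α 0)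
include hα hlim

theorem tendsto_opucStar_succ_div_opucStar_of_zero :
    RatioTendstoOnCompacts t
      (fun n N => opucStar (coeffs α N) (n + 1)) (fun n N => opucStar (coeffs α N) n)
      (extendFrom (Metric.ball 0 1) (G 0)) (Metric.closedBall 0 1) := by
  intro n N h K hK _
  have hK1 : ∀ z ∈ K, ‖z‖ ≤ 1 := fun z hz => mem_closedBall_zero_iff.mp (hK hz)
  have hne : ∀ j, ∀ z ∈ K, (opucStar (coeffs α (N j)) (n j)).eval z ≠ 0 := fun j z hz =>
    opucStar_ne_zero (fun k => hα k (N j)) (n j) (hK1 z hz)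
  refine ⟨Eventually.of_forall hne, Metric.tendstoUniformlyOn_iff.mpr fun ε hε => ?_⟩
  filter_upwards [Metric.tendsto_nhds.mp (hlim n N h) ε hε] with j hj z hz
  have hpos := norm_pos_iff.mpr (hne j z hz)
  have hle : ‖z‖ * ‖(opuc (coeffs α (N j)) (n j)).eval z‖
      ≤ ‖(opucStar (coeffs α (N j)) (n j)).eval z‖ :=
    (mul_le_of_le_one_left (norm_nonneg _) (hK1 z hz)).trans
      (norm_opuc_le (fun k => hα k (N j)) (n j) (hK1 z hz))
  rw [dist_zero_right] at hj
  rw [extendFrom_G_zero_ball (hK1 z hz), dist_eq_norm, eval_opucStar_succ,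
    one_sub_div (hne j z hz), sub_sub_cancel, norm_div, div_lt_iff₀ hpos, norm_mul, norm_mul]
  exact (mul_le_mul_of_nonneg_left hle (norm_nonneg _)).trans_lt (mul_lt_mul_of_pos_right hj hpos)

theorem tendsto_opuc_succ_div_opuc_of_zero :
    RatioTendstoOnCompacts t
      (fun n N => opuc (coeffs α N) (n + 1)) (fun n N => opuc (coeffs α N) n)
      (extendFrom (Metric.closedBall 0 1)ᶜ (G 0)) (Metric.ball 0 1)ᶜ := by
  intro n N h K hK _
  have hK1 : ∀ z ∈ K, 1 ≤ ‖z‖ := fun z hz => by simpa using hK hz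
  have hne : ∀ j, ∀ z ∈ K, (opuc (coeffs α (N j)) (n j)).eval z ≠ 0 := fun j z hz =>
    opuc_ne_zero (fun k => hα k (N j)) (n j) (hK1 z hz)
  refine ⟨Eventually.of_forall hne, Metric.tendstoUniformlyOn_iff.mpr fun ε hε => ?_⟩
  filter_upwards [Metric.tendsto_nhds.mp (hlim n N h) ε hε] with j hj z hz
  have hpos := norm_pos_iff.mpr (hne j z hz)
  have hle := norm_opucStar_le (fun k => hα k (N j)) (n j) (hK1 z hz)
  rw [dist_zero_right] at hj
  rw [extendFrom_G_zero_compl (hK1 z hz), dist_eq_norm, eval_opuc_succ, sub_div' (hne j z hz),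
    sub_sub_cancel, norm_div, div_lt_iff₀ hpos, norm_mul, RCLike.norm_conj]
  exact (mul_le_mul_of_nonneg_left hle (norm_nonneg _)).trans_lt (mul_lt_mul_of_pos_right hj hpos)

end VanishingLimit

end VaryingOPUC

theorem theorem3p3 (β : ℂ) (hβ : ‖β‖ = 1) (t : ℝ) (ht : 0 < t)
    (α : ℕ → ℕ → ℂ) (hα : ∀ n N, ‖α n N‖ < 1)
    (α₀ : ℂ) (hα₀ : ‖α₀‖ ≤ 1) (hlim : RatioTendsto t α α₀) :
    -- `Φ_n / Φ_{n+1}^{(β)}`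
    RatioTendstoOnCompacts t
      (fun n N => opuc (coeffs α N) n) (fun n N => popuc (coeffs α N) β (n + 1))
      (mFun (-conj α₀ * β)) (limitZeros α t β)ᶜ ∧
    -- `Φ_n / Φ_n^*`
    (α₀ ≠ 0 → RatioTendstoOnCompacts t
      (fun n N => opuc (coeffs α N) n) (fun n N => opucStar (coeffs α N) n)
      (schurFun (-conj α₀)) (limitZerosInter α t)ᶜ) ∧
    (α₀ = 0 → RatioTendstoOnCompacts t
      (fun n N => opuc (coeffs α N) n) (fun n N => opucStar (coeffs α N) n)
      (schurFun (-conj α₀)) (Metric.ball 0 1)) ∧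
    -- `Φ_{n+1}^* / Φ_n^*`; for `α₀ = 0` the values of `G_0` on the circle are limits from inside
    (α₀ ≠ 0 → RatioTendstoOnCompacts t
      (fun n N => opucStar (coeffs α N) (n + 1)) (fun n N => opucStar (coeffs α N) n)
      (G ‖α₀‖) (limitZerosInter α t)ᶜ) ∧
    (α₀ = 0 → RatioTendstoOnCompacts t
      (fun n N => opucStar (coeffs α N) (n + 1)) (fun n N => opucStar (coeffs α N) n)
      (extendFrom (Metric.ball 0 1) (G 0)) (Metric.closedBall 0 1)) ∧
    -- `Φ_{n+1} / Φ_n`; for `α₀ = 0` the values of `G_0` on the circle are limits from outside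
    (α₀ ≠ 0 → RatioTendstoOnCompacts t
      (fun n N => opuc (coeffs α N) (n + 1)) (fun n N => opuc (coeffs α N) n)
      (G ‖α₀‖) (limitZerosInter α t)ᶜ) ∧
    (α₀ = 0 → RatioTendstoOnCompacts t
      (fun n N => opuc (coeffs α N) (n + 1)) (fun n N => opuc (coeffs α N) n)
      (extendFrom (Metric.closedBall 0 1)ᶜ (G 0)) (Metric.ball 0 1)ᶜ) ∧
    -- `Φ_{n+1}^{(β)} / Φ_n^{(β)}`
    RatioTendstoOnCompacts t
      (fun n N => popuc (coeffs α N) β (n + 1)) (fun n N => popuc (coeffs α N) β n)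
      (G ‖α₀‖) (limitZeros α t β)ᶜ :=
  ⟨tendsto_opuc_div_popuc hα hα₀ hlim hβ,
    fun h => tendsto_opuc_div_opucStar hα hα₀ hlim h,
    fun _ => tendsto_opuc_div_opucStar_ball hα hα₀ hlim,
    fun h => tendsto_opucStar_succ_div_opucStar hα hα₀ hlim h,
    fun h => tendsto_opucStar_succ_div_opucStar_of_zero hα (h ▸ hlim),
    fun h => tendsto_opuc_succ_div_opuc hα hα₀ hlim h,
    fun h => tendsto_opuc_succ_div_opuc_of_zero hα (h ▸ hlim),
    tendsto_popuc_succ_div_popuc hα hα₀ hlim hβ⟩
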